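/- **Theorem B (Fundamental identities).** Let $\mathfrak g=\bigoplus_{p\in\mathbb Z}\mathfrak g_p$ be a real transitive graded Lie algebra ($\mathfrak g_-=\bigoplus_{p<0}\mathfrak g_p$ is finite dimensional, and $A\in\mathfrak g_i$, $i\ge 0$, $[A,\mathfrak g_-]=0$ imply $A=0$) which is the prolongation of its truncation $\mathfrak g[k_0]=\bigoplus_{p\le k_0}\mathfrak g_p$, $k_0\ge 0$: for each $p>k_0$, $\mathfrak g_p$ consists of all derivations $\mathfrak g_-\to\mathfrak g$ of degree $p$. Let $\partial$ be the Spencer coboundary of $\operatorname{Hom}(\wedge^\bullet\mathfrak g_-,\mathfrak g)$, and let $W=\{W^1_\ell,W^2_{\ell+1}\}_{\ell\ge k_0}$ be subspaces with $\operatorname{Hom}(\mathfrak g_-,\mathfrak g)_\ell=W^1_\ell\oplus\partial\mathfrak g_\ell$ and $\operatorname{Hom}(\wedge^2\mathfrak g_-,\mathfrak g)_{\ell+1}=W^2_{\ell+1}\oplus\partial\operatorname{Hom}(\mathfrak g_-,\mathfrak g)_{\ell+1}$. Let $Q^{(k_0)}\to\cdots\to Q^{(0)}\to Q^{(-1)}=(M,F)$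 be a normal geometric structure of order $k_0$ of type $(\mathfrak g_-,G_0,\dots,G_{k_0})$ on a filtered manifold $(M,F)$. That is, put $E^{(i)}=\bigoplus_{p\le i}\mathfrak g_p$; each $Q^{(i)}\to Q^{(i-1)}$ is a principal bundle with a Lie group $G_i$ with Lie algebra $\mathfrak g_i$ and is a principal subbundle of the universal frame bundle $\mathscr S^{(i)}Q^{(i-1)}$. The points of the latter are the classes modulo $F^{i+1}GL(E^{(i-1)})$ of the universal linear frames, which are the filtration preserving isomorphisms $\zeta:E^{(i-1)}\to T_qQ^{(i-1)}$ such that: for $i=0$, $\operatorname{gr}\zeta$ is an isomorphism of graded Lie algebras $\mathfrak g_-\to\operatorname{gr}T_qM$; for $i\ge1$, $\zeta$ sends $A\in\mathfrak g_{i-1}$ to the fundamental vector of $A$ at $q$ and induces on $E^{(i-2)}$ a frame in the class $q$. An element $A\in\mathfrak g_i=\operatorname{Lie}(G_i)$ acts on $E^{(i-1)}$ (modulo $F^{i+1}$) by $\operatorname{ad}A$ on $\mathfrak g_-$ and by $0$ on $\mathfrak g_0\oplus\dots\oplus\mathfrak g_{i-1}$. Let $\mathscr S_WQ^{(k_0)}=\varprojlim_\ell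 Q^{(\ell)}$ be its $W$-normal step prolongation: for $\ell\ge k_0$, $Q^{(\ell+1)}$ is the set of all $z\in\mathscr S^{(\ell+1)}Q^{(\ell)}$ with $\kappa_{[\ell+1]}(z)\in W^2_{\ell+1}$ and $\tau_{[\ell+1]}(z)(A,\cdot)\in W^1_\ell$ for all $A\in\mathfrak g_0\oplus\dots\oplus\mathfrak g_{\ell-1}$, which is again a normal geometric structure, with $\operatorname{Lie}(G_{\ell+1})=\mathfrak g_{\ell+1}$. Let $\theta$ be the canonical form of $\mathscr S_WQ^{(k_0)}$ (the absolute parallelism given by the inverse of the frames), and let $\gamma$ be its structure function: $d\theta+\frac12\gamma(\theta,\theta)=0$. Split $\gamma=\kappa+\tau+\sigma$ according to $\wedge^2\mathfrak g_-$, $\mathfrak g_-\wedge\mathfrak g_+$, $\wedge^2\mathfrak g_+$, where $\mathfrak g_+=\bigoplus_{a\ge0}\mathfrak g_a$. A map $\mathfrak g_a\wedge\mathfrak g_b\to\mathfrak g_c$ has degree $c-a-b$ and modified degree $c-\tilde a-\tilde b$, $\tilde a=\min(a,-1)$; the subscripts $(r)$ and $[s]$ denote the components of degree $r$ and of modified degree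 $s$. For $U\in\mathfrak g$ write $U=U_-+U_+$ with $U_\pm\in\mathfrak g_\pm$. Let $D_Xf$ be the derivative of a function $f$ along the vector field $\theta^{-1}(X)$, let $\mathfrak S$ denote cyclic sums and $\mathscr A_{X,Y}G(X,Y)=G(X,Y)-G(Y,X)$ (degrees are permuted along with the elements), and let $(\rho(A)\kappa_{[s]})(X,Y)=[A,\kappa_{[s]}(X,Y)]-\kappa_{[s]}([A,X]_-,Y)-\kappa_{[s]}(X,[A,Y]_-)$. Then the components of $\gamma$ are smooth functions, each on some $Q^{(\ell)}$, and at every point of $\mathscr S_WQ^{(k_0)}$: 1. For $X\in\mathfrak g_x$, $Y\in\mathfrak g_y$, $Z\in\mathfrak g_z$ with $x,y,z<0$ and every integer $k\ge0$, $$(\partial\kappa_{[k]})(X,Y,Z)=\mathfrak S_{X,Y,Z}\Big\{\sum_{\substack{d_1+d_2=k\\ d_1,d_2>0}}\big\{\kappa_{[d_1]}(\kappa_{[d_2]}(X,Y)_-,Z)+\tau_{(d_1)[k+x+y+1]}(\kappa_{[d_2]}(X,Y)_+,Z)\big\}-D_X\kappa_{[k+x]}(Y,Z)\Big\}.$$ 2.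 For $X\in\mathfrak g_x$, $Y\in\mathfrak g_y$, $A\in\mathfrak g_a$ with $x,y<0\le a$, every integer $d\ge0$ and $k=d+a+1$, $$\begin{aligned}(\partial\tau_{(d)[k]}(A,\cdot))(X,Y)={}&(D_A\kappa_{[k-1]}+\rho(A)\kappa_{[d]})(X,Y)-\mathscr A_{X,Y}\tau_{(d)[k+x]}([A,X]_+,Y)\\&+[\kappa_{[d]}(X,Y)_+,A]-\sigma_{(0)[k+x+y+1]}(\kappa_{[d]}(X,Y)_+,A)\\&-\sum_{\substack{\delta_1+\delta_2=d\\-a\le\delta_1<d,\ \delta_1\ne0}}\big\{\tau_{(\delta_1)[\delta_1+a+1]}(\kappa_{[\delta_2]}(X,Y)_-,A)+\sigma_{(\delta_1)[k+x+y+1]}(\kappa_{[\delta_2]}(X,Y)_+,A)\big\}\\&-\mathscr A_{X,Y}\sum_{\substack{d_1+d_2=d\\d_1,d_2>0}}\big\{\kappa_{[d_1]}(\tau_{(d_2)[k-d_1]}(A,X)_-,Y)+\tau_{(d_1)[k+x]}(\tau_{(d_2)[k-d_1]}(A,X)_+,Y)\big\}\\&+\mathscr A_{X,Y}D_Y\tau_{(d+y)[k+y]}(A,X).\end{aligned}$$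 3. For $A\in\mathfrak g_a$, $B\in\mathfrak g_b$, $X\in\mathfrak g_x$ with $x<0\le a,b$, every integer $d$ and $k=d+a+b+2$, $$\begin{aligned}[\sigma_{(d)[k]}(A,B),X]={}&\mathscr A_{A,B}\sum_{\substack{d_1+d_2=d\\0\le d_2\le d+a}}\big\{\sigma_{(d_1)[k+x]}(A,\tau_{(d_2)[k-1-(d_1+a)]}(B,X)_+)+\tau_{(d_1)[k-1-(d_2+b)]}(A,\tau_{(d_2)[k-1-(d_1+a)]}(B,X)_-)\big\}\\&+\sum_{\substack{\delta_1+\delta_2=d\\0<\delta_1\le d+\min(a,b)}}\tau_{(\delta_1)[k-1]}(X,\sigma_{(\delta_2)[k-\delta_1]}(A,B))\\&+D_X\sigma_{(d+x)[k+x]}(A,B)+\mathscr A_{A,B}D_A\tau_{(d+a)[k-1]}(B,X).\end{aligned}$$ 4. For $A\in\mathfrak g_a$, $B\in\mathfrak g_b$, $C\in\mathfrak g_c$ with $a,b,c\ge0$, every integer $d$ and $k=d+a+b+c+3$, $$\mathfrak S_{A,B,C}\Big\{\sum_{\substack{d_1+d_2=d\\-\min\{a,b\}\le d_2\le d+c}}\sigma_{(d_1)[k-1]}(\sigma_{(d_2)[k-1-c-d_1]}(A,B),C)-D_C\sigma_{(d+c)[k-1]}(A,B)\Big\}=0.$$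 -/

import Mathlib

open scoped Manifold ContDiff DirectSum

noncomputable section

namespace StepProlongation

universe u v w

/-! ### Graded Lie algebras and Spencer cochains -/

section Algebra

variable {L : Type u} [LieRing L] [LieAlgebra ℝ L]
variable (𝒢 : ℤ → Submodule ℝ L) [GradedLieAlgebra 𝒢]

/-- The component of degree `p` of an element of `𝔤 = ⨁ 𝔤_p`. -/
def comp (p : ℤ) : L →ₗ[ℝ] L :=
  (𝒢 p).subtype ∘ₗ DirectSum.component ℝ ℤ (fun i => 𝒢 i) p ∘ₗ
    (DirectSum.decomposeLinearEquiv 𝒢).toLinearMap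

/-- `x ↦ x_-`, the projection onto `𝔤_- = ⨁_{p < 0} 𝔤_p`. -/
def minusPart : L →ₗ[ℝ] L :=
  (DirectSum.decomposeLinearEquiv 𝒢).symm.toLinearMap ∘ₗ
    DFinsupp.filterLinearMap ℝ (fun i => 𝒢 i) (fun p : ℤ => p < 0) ∘ₗ
      (DirectSum.decomposeLinearEquiv 𝒢).toLinearMap

/-- `x ↦ x_+`, the projection onto `⨁_{p ≥ 0} 𝔤_p`. -/
def plusPart : L →ₗ[ℝ] L := LinearMap.id - minusPart 𝒢

/-- The filtration `F^p 𝔤 = ⨁_{q ≥ p} 𝔤_q`. -/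
def algFilt (p : ℤ) : Submodule ℝ L := ⨅ q : ℤ, ⨅ _ : q < p, LinearMap.ker (comp 𝒢 q)

/-- `𝔤` is a transitive graded Lie algebra whose negative part is finite dimensional and
concentrated in degrees `≥ -μ`. -/
structure IsTransitive (μ : ℕ) : Prop where
  finite : ∀ p : ℤ, p < 0 → FiniteDimensional ℝ (𝒢 p)
  depth : ∀ p : ℤ, p < -(μ : ℤ) → 𝒢 p = ⊥
  transitive : ∀ i : ℤ, 0 ≤ i → ∀ A ∈ 𝒢 i,
    (∀ p : ℤ, p < 0 → ∀ X ∈ 𝒢 p, ⁅A, X⁆ = 0) → A = 0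

/-- `Hom(𝔤_-, 𝔤)_r`; cochains are extended by zero to the non-negative part. -/
def Hom1 (r : ℤ) : Submodule ℝ (L →ₗ[ℝ] L) where
  carrier := {c | (∀ p : ℤ, 0 ≤ p → ∀ X ∈ 𝒢 p, c X = 0) ∧
    ∀ p : ℤ, p < 0 → ∀ X ∈ 𝒢 p, c X ∈ 𝒢 (p + r)}
  add_mem' := by
    rintro c c' ⟨h1, h2⟩ ⟨h1', h2'⟩
    refine ⟨fun p hp X hX => ?_, fun p hp X hX => ?_⟩
    · simp [h1 p hp X hX, h1' p hp X hX]
    · exact Submodule.add_mem _ (h2 p hp X hX) (h2' p hp X hX)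
  zero_mem' := by
    refine ⟨fun p hp X hX => ?_, fun p hp X hX => ?_⟩ <;> simp
  smul_mem' := by
    rintro t c ⟨h1, h2⟩
    refine ⟨fun p hp X hX => ?_, fun p hp X hX => ?_⟩
    · simp [h1 p hp X hX]
    · exact Submodule.smul_mem _ t (h2 p hp X hX)

/-- `Hom(∧² 𝔤_-, 𝔤)_r`; cochains are extended by zero to the non-negative part. -/
def Hom2 (r : ℤ) : Submodule ℝ (L →ₗ[ℝ] L →ₗ[ℝ] L) where
  carrier := {c | (∀ X, c X X = 0) ∧ (∀ p : ℤ, 0 ≤ p → ∀ X ∈ 𝒢 p, c X = 0) ∧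
    ∀ p q : ℤ, p < 0 → q < 0 → ∀ X ∈ 𝒢 p, ∀ Y ∈ 𝒢 q, c X Y ∈ 𝒢 (p + q + r)}
  add_mem' := by
    rintro c c' ⟨h0, h1, h2⟩ ⟨h0', h1', h2'⟩
    refine ⟨fun X => ?_, fun p hp X hX => ?_, fun p q hp hq X hX Y hY => ?_⟩
    · simp [h0 X, h0' X]
    · simp [h1 p hp X hX, h1' p hp X hX]
    · exact Submodule.add_mem _ (h2 p q hp hq X hX Y hY) (h2' p q hp hq X hX Y hY)
  zero_mem' := by
    refine ⟨fun X => ?_, fun p hp X hX => ?_, fun p q hp hq X hX Y hY => ?_⟩ <;> simp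
  smul_mem' := by
    rintro t c ⟨h0, h1, h2⟩
    refine ⟨fun X => ?_, fun p hp X hX => ?_, fun p q hp hq X hX Y hY => ?_⟩
    · simp [h0 X]
    · simp [h1 p hp X hX]
    · exact Submodule.smul_mem _ t (h2 p q hp hq X hX Y hY)

/-- The Spencer coboundary `(∂c)(X, Y)` of a 1-cochain, for `X, Y ∈ 𝔤_-`. -/
def spencer1 (c : L → L) (X Y : L) : L := ⁅X, c Y⁆ - ⁅Y, c X⁆ - c ⁅X, Y⁆

/-- The Spencer coboundary `(∂c)(X, Y, Z)` of a 2-cochain, for `X, Y, Z ∈ 𝔤_-`. -/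
def spencer2 (c : L → L → L) (X Y Z : L) : L :=
  ⁅X, c Y Z⁆ - ⁅Y, c X Z⁆ + ⁅Z, c X Y⁆ - c ⁅X, Y⁆ Z + c ⁅X, Z⁆ Y - c ⁅Y, Z⁆ X

/-- `∂ : 𝔤 → Hom(𝔤_-, 𝔤)`, `(∂A)(X) = [X, A]`. -/
def bd0 : L →ₗ[ℝ] L →ₗ[ℝ] L :=
  LinearMap.mk₂ ℝ (fun A X => ⁅minusPart 𝒢 X, A⁆) (by intros; simp) (by intros; simp)
    (by intros; simp) (by intros; simp)

/-- `∂ : Hom(𝔤_-, 𝔤) → Hom(∧² 𝔤_-, 𝔤)`. -/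
def bd1 : (L →ₗ[ℝ] L) →ₗ[ℝ] L →ₗ[ℝ] L →ₗ[ℝ] L where
  toFun c := LinearMap.mk₂ ℝ (fun X Y => spencer1 c (minusPart 𝒢 X) (minusPart 𝒢 Y))
    (by intros; simp only [spencer1, map_add, add_lie, lie_add]; abel)
    (by intros; simp only [spencer1, map_smul, smul_lie, lie_smul, smul_sub])
    (by intros; simp only [spencer1, map_add, add_lie, lie_add]; abel)
    (by intros; simp only [spencer1, map_smul, smul_lie, lie_smul, smul_sub])
  map_add' c c' := by
    ext X Y
    simp only [spencer1, LinearMap.mk₂_apply, LinearMap.add_apply, lie_add]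
    abel
  map_smul' t c := by
    ext X Y
    simp only [spencer1, LinearMap.mk₂_apply, LinearMap.smul_apply, lie_smul, smul_sub,
      RingHom.id_apply]

/-- The transitive graded Lie algebra `𝔤` is the prolongation of its truncation
`𝔤[k] = ⨁_{p ≤ k} 𝔤_p`: in each degree `p > k`, the space `𝔤_p` consists of all derivations
`𝔤_- → 𝔤` of degree `p`. -/
def IsProlongation (k : ℕ) : Prop :=
  ∀ p : ℤ, (k : ℤ) < p → ∀ c ∈ Hom1 𝒢 p,
    (∀ x y : ℤ, x < 0 → y < 0 → ∀ X ∈ 𝒢 x, ∀ Y ∈ 𝒢 y, c ⁅X, Y⁆ = ⁅c X, Y⁆ + ⁅X, c Y⁆) →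
    ∃ A ∈ 𝒢 p, ∀ x : ℤ, x < 0 → ∀ X ∈ 𝒢 x, c X = ⁅A, X⁆

/-- `W = {W¹_ℓ, W²_{ℓ+1}}_{ℓ ≥ k}` is a choice of complementary subspaces:
`Hom(𝔤_-, 𝔤)_ℓ = W¹_ℓ ⊕ ∂ 𝔤_ℓ` and
`Hom(∧² 𝔤_-, 𝔤)_{ℓ+1} = W²_{ℓ+1} ⊕ ∂ Hom(𝔤_-, 𝔤)_{ℓ+1}`. -/
structure IsComplements (k : ℕ) (W1 : ℕ → Submodule ℝ (L →ₗ[ℝ] L))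
    (W2 : ℕ → Submodule ℝ (L →ₗ[ℝ] L →ₗ[ℝ] L)) : Prop where
  disjoint1 : ∀ ℓ : ℕ, k ≤ ℓ → W1 ℓ ⊓ (𝒢 (ℓ : ℤ)).map (bd0 𝒢) = ⊥
  sup1 : ∀ ℓ : ℕ, k ≤ ℓ → W1 ℓ ⊔ (𝒢 (ℓ : ℤ)).map (bd0 𝒢) = Hom1 𝒢 (ℓ : ℤ)
  disjoint2 : ∀ ℓ : ℕ, k ≤ ℓ → W2 (ℓ + 1) ⊓ (Hom1 𝒢 ((ℓ : ℤ) + 1)).map (bd1 𝒢) = ⊥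
  sup2 : ∀ ℓ : ℕ, k ≤ ℓ →
    W2 (ℓ + 1) ⊔ (Hom1 𝒢 ((ℓ : ℤ) + 1)).map (bd1 𝒢) = Hom2 𝒢 ((ℓ : ℤ) + 1)

/-- Cyclic sum over three homogeneous elements, listed together with their degrees. -/
def cyclicSum (f : ℤ → L → ℤ → L → ℤ → L → L) (x : ℤ) (X : L) (y : ℤ) (Y : L) (z : ℤ) (Z : L) :
    L :=
  f x X y Y z Z + f y Y z Z x X + f z Z x X y Y

/-- Alternating sum over two homogeneous elements, listed together with their degrees. -/
def altSum (f : ℤ → L → ℤ → L → L) (x : ℤ) (X : L) (y : ℤ) (Y : L) : L :=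
  f x X y Y - f y Y x X

end Algebra

/-! ### Calculus for functions with values in a real vector space

The values of all functions to which this is applied lie in a finite dimensional subspace, so that
smoothness and derivatives can be tested on linear functionals. -/

section Calculus

variable {L : Type u} [AddCommGroup L] [Module ℝ L]
variable {n : ℕ} {M : Type v} [TopologicalSpace M] [ChartedSpace (EuclideanSpace ℝ (Fin n)) M]

/-- `f` is differentiable at `x`, and its derivative along `ξ` is `l`. -/
def HasDerivAlong (f : M → L) (x : M) (ξ : TangentSpace (𝓡 n) x) (l : L) : Prop :=
  ∀ φ : Module.Dual ℝ L,
    MDifferentiableAt (𝓡 n) 𝓘(ℝ, ℝ) (fun y => φ (f y)) x ∧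
      mfderiv (𝓡 n) 𝓘(ℝ, ℝ) (fun y => φ (f y)) x ξ = φ l

open Classical in
/-- The derivative of `f` at `x` along `ξ`. -/
def derivAlong (f : M → L) (x : M) (ξ : TangentSpace (𝓡 n) x) : L :=
  if h : ∃ l, HasDerivAlong f x ξ l then h.choose else 0

/-- Smoothness of a function with values in `L` on a set. -/
def SmoothOn (f : M → L) (s : Set M) : Prop :=
  ∀ φ : Module.Dual ℝ L, ContMDiffOn (𝓡 n) 𝓘(ℝ, ℝ) ∞ (fun y => φ (f y)) s

/-- The exterior derivative `dα(ξ, η)` of an `L`-valued 1-form `α` at `x`, computed in the chart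
around `x`; the normalization is `dα(ξ, η) = ξ α(η) - η α(ξ) - α([ξ, η])`. -/
def extD (α : ∀ y : M, TangentSpace (𝓡 n) y → L) (x : M) (ξ η : TangentSpace (𝓡 n) x) : L :=
  let e := extChartAt (𝓡 n) x
  let αe : EuclideanSpace ℝ (Fin n) → EuclideanSpace ℝ (Fin n) → L := fun v y =>
    α (e.symm y) (mfderiv 𝓘(ℝ, EuclideanSpace ℝ (Fin n)) (𝓡 n) e.symm y v)
  let ξe : EuclideanSpace ℝ (Fin n) :=
    mfderiv (𝓡 n) 𝓘(ℝ, EuclideanSpace ℝ (Fin n)) e x ξ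
  let ηe : EuclideanSpace ℝ (Fin n) :=
    mfderiv (𝓡 n) 𝓘(ℝ, EuclideanSpace ℝ (Fin n)) e x η
  derivAlong (n := n) (αe ηe) (e x) ξe - derivAlong (n := n) (αe ξe) (e x) ηe

/-- Transport of tangent vectors along an equality of base points. -/
def tcast {x y : M} (h : x = y) (ξ : TangentSpace (𝓡 n) x) : TangentSpace (𝓡 n) y := h ▸ ξ

end Calculus

/-! ### Towers of frame bundles -/

section Tower

variable {L : Type u} [LieRing L] [LieAlgebra ℝ L]
variable (𝒢 : ℤ → Submodule ℝ L) [GradedLieAlgebra 𝒢]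
variable {d e : ℕ → ℕ}
variable (Q : ℕ → Type v) [∀ n, TopologicalSpace (Q n)]
  [∀ n, ChartedSpace (EuclideanSpace ℝ (Fin (d n))) (Q n)] [∀ n, IsManifold (𝓡 (d n)) ∞ (Q n)]
variable (G : ℕ → Type w) [∀ n, Group (G n)] [∀ n, TopologicalSpace (G n)]
  [∀ n, ChartedSpace (EuclideanSpace ℝ (Fin (e n))) (G n)]

/-- The data of a tower `⋯ → Q^{(1)} → Q^{(0)} → Q^{(-1)} = M` of frame bundles with structure
groups `G_n`. Here `Q n` is `Q^{(n-1)}`, so that `Q (n + 1) → Q n` has the structure group `G n`.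
The model space `E^{(n-1)} = 𝔤_- ⊕ 𝔤_0 ⊕ ⋯ ⊕ 𝔤_{n-1}` of `Q n` is identified with `𝔤 / F^n 𝔤`, and
linear frames `E^{(n-1)} → T_q (Q n)` with linear maps on `𝔤` which vanish on `F^n 𝔤`. -/
structure TowerData where
  /-- the tangential filtration of `M = Q 0` -/
  F : ℤ → ∀ x : Q 0, Submodule ℝ (TangentSpace (𝓡 (d 0)) x)
  /-- the projection `Q^{(n)} → Q^{(n-1)}` -/
  π : ∀ n, Q (n + 1) → Q n
  /-- the right action of `G_n` on `Q^{(n)}` -/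
  act : ∀ n, Q (n + 1) → G n → Q (n + 1)
  /-- `rep n a` represents `a ∈ G_n` as an automorphism of `E^{(n-1)}` modulo `F^{n+1}` -/
  rep : ∀ n, G n → L →ₗ[ℝ] L
  /-- the identification of `𝔤_n` with the Lie algebra of `G_n` -/
  lie : ∀ n : ℕ, 𝒢 (n : ℤ) ≃ₗ[ℝ] TangentSpace (𝓡 (e n)) (1 : G n)
  /-- a point `z` of `Q^{(n)}` over `q ∈ Q^{(n-1)}` is a class of linear frames at `q` modulo
  `F^{n+1}`: `Fr n z q` is the set of the frames at `q` in this class (empty if `z` does not lie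
  over `q`) -/
  Fr : ∀ n, Q (n + 1) → ∀ q : Q n, Set (L →ₗ[ℝ] TangentSpace (𝓡 (d n)) q)

namespace TowerData

variable {𝒢 Q G}
variable (T : TowerData 𝒢 (d := d) (e := e) Q G)

/-- The canonical filtration `F^p T_q (Q n)`. -/
def filt : ∀ n, ℤ → ∀ q : Q n, Submodule ℝ (TangentSpace (𝓡 (d n)) q)
  | 0, p, x => T.F p x
  | n + 1, p, q => if p ≤ n then
      (filt n p (T.π n q)).comap (mfderiv (𝓡 (d (n + 1))) (𝓡 (d n)) (T.π n) q).toLinearMap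
    else ⊥

/-- `ξ` is the value at `q ∈ Q^{(n)}` of the fundamental vector field of `A ∈ 𝔤_n`, that is, the
velocity at `t = 0` of `q · exp(tA)`. -/
def IsFund (n : ℕ) (A : 𝒢 (n : ℤ)) (q : Q (n + 1)) (ξ : TangentSpace (𝓡 (d (n + 1))) q) : Prop :=
  (⟨q, ξ⟩ : TangentBundle (𝓡 (d (n + 1))) (Q (n + 1))) =
    ⟨T.act n q 1, mfderiv (𝓡 (e n)) (𝓡 (d (n + 1))) (fun a => T.act n q a) 1 (T.lie n A)⟩

/-- `ζ` induces a filtration preserving isomorphism `E^{(n-1)} = 𝔤 / F^n 𝔤 → T_q (Q n)`. -/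
structure IsFilteredIso (n : ℕ) (q : Q n) (ζ : L →ₗ[ℝ] TangentSpace (𝓡 (d n)) q) : Prop where
  surj : Function.Surjective ζ
  ker : LinearMap.ker ζ = algFilt 𝒢 (n : ℤ)
  filt : ∀ p : ℤ, (algFilt 𝒢 p).map ζ = T.filt n p q

/-- `gr ζ : 𝔤_- → gr T_x M` is compatible with the brackets, the bracket of `gr T_x M` being
induced by the bracket of vector fields. -/
def GrBracket (x : Q 0) (ζ : L →ₗ[ℝ] TangentSpace (𝓡 (d 0)) x) : Prop :=
  ∀ p q : ℤ, p < 0 → q < 0 → ∀ X ∈ 𝒢 p, ∀ Y ∈ 𝒢 q,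
    ∀ (U : Set (Q 0)) (V V' : ∀ y : Q 0, TangentSpace (𝓡 (d 0)) y), IsOpen U → x ∈ U →
      ContMDiffOn (𝓡 (d 0)) (𝓡 (d 0)).tangent ∞
        (fun y => (⟨y, V y⟩ : TangentBundle (𝓡 (d 0)) (Q 0))) U →
      ContMDiffOn (𝓡 (d 0)) (𝓡 (d 0)).tangent ∞
        (fun y => (⟨y, V' y⟩ : TangentBundle (𝓡 (d 0)) (Q 0))) U →
      (∀ y ∈ U, V y ∈ T.F p y) → (∀ y ∈ U, V' y ∈ T.F q y) →
      V x - ζ X ∈ T.F (p + 1) x → V' x - ζ Y ∈ T.F (q + 1) x →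
      VectorField.mlieBracket (𝓡 (d 0)) V V' x - ζ ⁅X, Y⁆ ∈ T.F (p + q + 1) x

/-- The universal linear frames at `q ∈ Q n = Q^{(n-1)}`, that is, the fibre over `q` of the
universal linear frame bundle of order `n` of the geometric structure `Q^{(n-1)}`. -/
def IsUnivFrame : ∀ (n : ℕ) (q : Q n), (L →ₗ[ℝ] TangentSpace (𝓡 (d n)) q) → Prop
  | 0, x, ζ => T.IsFilteredIso 0 x ζ ∧ T.GrBracket x ζ
  | n + 1, q, ζ => T.IsFilteredIso (n + 1) q ζ ∧
      (∀ A : 𝒢 (n : ℤ), T.IsFund n A q (ζ A)) ∧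
      (mfderiv (𝓡 (d (n + 1))) (𝓡 (d n)) (T.π n) q).toLinearMap ∘ₗ ζ ∈ T.Fr n q (T.π n q)

/-- Two frames at `q ∈ Q n` agree modulo `F^{n+1} GL(E^{(n-1)})`. -/
def FrameCongr (n : ℕ) (q : Q n) (ζ ζ' : L →ₗ[ℝ] TangentSpace (𝓡 (d n)) q) : Prop :=
  ∀ p : ℤ, ∀ X ∈ 𝒢 p, ζ' X - ζ X ∈ T.filt n (p + n + 1) q

/-- `(M, F)` is a filtered manifold, with `F^{-μ} = TM`. -/
structure IsFilteredManifold (μ : ℕ) : Prop where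
  anti : ∀ (p q : ℤ) (x : Q 0), p ≤ q → T.F q x ≤ T.F p x
  top : ∀ x : Q 0, T.F (-(μ : ℤ)) x = ⊤
  bot : ∀ x : Q 0, T.F 0 x = ⊥
  subbundle : ∀ (p : ℤ) (x : Q 0), ∃ U : Set (Q 0), IsOpen U ∧ x ∈ U ∧
    ∃ (r : ℕ) (V : Fin r → ∀ y : Q 0, TangentSpace (𝓡 (d 0)) y),
      (∀ i, ContMDiffOn (𝓡 (d 0)) (𝓡 (d 0)).tangent ∞
        (fun y => (⟨y, V i y⟩ : TangentBundle (𝓡 (d 0)) (Q 0))) U) ∧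
      ∀ y ∈ U, LinearIndependent ℝ (fun i => V i y) ∧
        Submodule.span ℝ (Set.range fun i => V i y) = T.F p y
  bracket : ∀ (p q : ℤ) (U : Set (Q 0)) (V V' : ∀ y : Q 0, TangentSpace (𝓡 (d 0)) y), IsOpen U →
    ContMDiffOn (𝓡 (d 0)) (𝓡 (d 0)).tangent ∞
      (fun y => (⟨y, V y⟩ : TangentBundle (𝓡 (d 0)) (Q 0))) U →
    ContMDiffOn (𝓡 (d 0)) (𝓡 (d 0)).tangent ∞
      (fun y => (⟨y, V' y⟩ : TangentBundle (𝓡 (d 0)) (Q 0))) U →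
    (∀ y ∈ U, V y ∈ T.F p y) → (∀ y ∈ U, V' y ∈ T.F q y) →
    ∀ y ∈ U, VectorField.mlieBracket (𝓡 (d 0)) V V' y ∈ T.F (p + q) y

/-- `Q (n + 1) → Q n` is a principal fibre bundle with structure group `G n`. -/
structure IsPrincipal (n : ℕ) : Prop where
  smooth_π : ContMDiff (𝓡 (d (n + 1))) (𝓡 (d n)) ∞ (T.π n)
  smooth_act : ContMDiff ((𝓡 (d (n + 1))).prod (𝓡 (e n))) (𝓡 (d (n + 1))) ∞
    (fun p : Q (n + 1) × G n => T.act n p.1 p.2)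
  act_one : ∀ z, T.act n z 1 = z
  act_mul : ∀ z a b, T.act n z (a * b) = T.act n (T.act n z a) b
  π_act : ∀ z a, T.π n (T.act n z a) = T.π n z
  simply_transitive : ∀ z z', T.π n z = T.π n z' → ∃! a, T.act n z a = z'
  /-- local trivializations `(q, a) ↦ s(q) · a`, with inverse `z ↦ (π(z), c(z))` -/
  locally_trivial : ∀ q₀ : Q n, ∃ (U : Set (Q n)) (s : Q n → Q (n + 1)) (c : Q (n + 1) → G n),
    IsOpen U ∧ q₀ ∈ U ∧ ContMDiffOn (𝓡 (d n)) (𝓡 (d (n + 1))) ∞ s U ∧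
    ContMDiffOn (𝓡 (d (n + 1))) (𝓡 (e n)) ∞ c (T.π n ⁻¹' U) ∧
    (∀ q ∈ U, T.π n (s q) = q) ∧ ∀ z ∈ T.π n ⁻¹' U, T.act n (s (T.π n z)) (c z) = z

/-- `Q^{(n)} → Q^{(n-1)}` is a principal subbundle of the universal frame bundle of order `n` of
`Q^{(n-1)}`: its points are classes of universal linear frames modulo `F^{n+1}`, on which `G_n` acts
by composition. -/
structure IsFrameSubbundle (n : ℕ) : Prop where
  principal : T.IsPrincipal n
  nonempty : ∀ z : Q (n + 1), (T.Fr n z (T.π n z)).Nonempty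
  base : ∀ (z : Q (n + 1)) (q : Q n), ∀ ζ ∈ T.Fr n z q, q = T.π n z
  univ : ∀ (z : Q (n + 1)) (q : Q n), ∀ ζ ∈ T.Fr n z q, T.IsUnivFrame n q ζ
  frame_class : ∀ (z : Q (n + 1)) (q : Q n), ∀ ζ ∈ T.Fr n z q, ∀ ζ', T.IsUnivFrame n q ζ' →
    (ζ' ∈ T.Fr n z q ↔ T.FrameCongr n q ζ ζ')
  injective : ∀ (z z' : Q (n + 1)) (q : Q n), ∀ ζ ∈ T.Fr n z q, ζ ∈ T.Fr n z' q → z = z'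
  act_frame : ∀ (z : Q (n + 1)) (a : G n) (q : Q n), ∀ ζ ∈ T.Fr n z q,
    ζ ∘ₗ T.rep n a ∈ T.Fr n (T.act n z a) q
  /-- the inclusion into the universal frame bundle is smooth -/
  smooth_frame : ∀ z₀ : Q (n + 1), ∃ (U : Set (Q (n + 1)))
    (s : ∀ z : Q (n + 1), L →ₗ[ℝ] TangentSpace (𝓡 (d n)) (T.π n z)), IsOpen U ∧ z₀ ∈ U ∧
    (∀ z ∈ U, s z ∈ T.Fr n z (T.π n z)) ∧
    ∀ X : L, ContMDiffOn (𝓡 (d (n + 1))) (𝓡 (d n)).tangent ∞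
      (fun z => (⟨T.π n z, s z X⟩ : TangentBundle (𝓡 (d n)) (Q n))) U

/-- The Lie algebra of `G_n`, as a Lie algebra of endomorphisms of `E^{(n-1)}` modulo `F^{n+1}`, is
`𝔤_n`, where `A ∈ 𝔤_n` acts by the bracket on `𝔤_-` and by zero on `𝔤_0 ⊕ ⋯ ⊕ 𝔤_{n-1}`. -/
structure IsNormalGroup (n : ℕ) : Prop where
  smooth : ∀ p : ℤ, p < n → ∀ X ∈ 𝒢 p, SmoothOn (n := e n) (fun a => T.rep n a X) Set.univ
  deriv_neg : ∀ (A : 𝒢 (n : ℤ)) (p : ℤ), p < 0 → ∀ X ∈ 𝒢 p,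
    HasDerivAlong (n := e n) (fun a => T.rep n a X) 1 (T.lie n A) ⁅(A : L), X⁆
  deriv_nonneg : ∀ (A : 𝒢 (n : ℤ)) (p : ℤ), 0 ≤ p → p < n → ∀ X ∈ 𝒢 p,
    HasDerivAlong (n := e n) (fun a => T.rep n a X) 1 (T.lie n A) 0

/-- For every `n`, the tower up to `Q^{(n)}` is a normal geometric structure of order `n` and of type
`(𝔤_-, G_0, …, G_n)`, where the Lie algebra of `G_i` is `𝔤_i`. -/
structure IsNormal (μ : ℕ) : Prop where
  filtered : T.IsFilteredManifold μ
  subbundle : ∀ n, T.IsFrameSubbundle n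
  group : ∀ n, T.IsNormalGroup n

/-- The `𝔤_p`-component of `ζ⁻¹(ξ)`, for a frame `ζ` at `q`. -/
def coframe {n : ℕ} {q : Q n} (𝒢 : ℤ → Submodule ℝ L) [GradedLieAlgebra 𝒢] (p : ℤ)
    (ζ : L →ₗ[ℝ] TangentSpace (𝓡 (d n)) q) (ξ : TangentSpace (𝓡 (d n)) q) : L :=
  comp 𝒢 p (Classical.epsilon fun X => ζ X = ξ)

/-- `s` is a smooth section over the open set `U` of the universal linear frame bundle over `Q n`. -/
structure IsFrameSection (n : ℕ) (U : Set (Q n)) (s : ∀ q : Q n, L →ₗ[ℝ] TangentSpace (𝓡 (d n)) q) :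
    Prop where
  isOpen : IsOpen U
  univ : ∀ q ∈ U, T.IsUnivFrame n q (s q)
  smooth : ∀ X : L, ContMDiffOn (𝓡 (d n)) (𝓡 (d n)).tangent ∞
    (fun q => (⟨q, s q X⟩ : TangentBundle (𝓡 (d n)) (Q n))) U

/-- The `𝔤_p`-component of the structure function of a section `s` of the universal linear frame
bundle over `Q n`: for the 1-form `θ = s⁻¹` it is `-dθ_p(s(X), s(Y))`. -/
def sectionGamma {n : ℕ} (𝒢 : ℤ → Submodule ℝ L) [GradedLieAlgebra 𝒢]
    (s : ∀ q : Q n, L →ₗ[ℝ] TangentSpace (𝓡 (d n)) q) (q : Q n) (p : ℤ) (X Y : L) : L :=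
  -extD (n := d n) (fun y ξ => coframe 𝒢 p (s y) ξ) q (s q X) (s q Y)

/-- The normalization conditions `κ_[ℓ+1] ∈ W²_{ℓ+1}` and `τ_[ℓ+1](A, ·) ∈ W¹_ℓ` for all
`A ∈ 𝔤_0 ⊕ ⋯ ⊕ 𝔤_{ℓ-1}`, at a universal linear frame `ζ` of `Q^{(ℓ)} = Q (ℓ + 1)`. The components of
the structure function which occur here depend only on the class of `ζ` modulo `F^{ℓ+2}`, so that
they can be computed with an arbitrary section through `ζ`. -/
def IsNormalized (ℓ : ℕ) (W1 : Submodule ℝ (L →ₗ[ℝ] L)) (W2 : Submodule ℝ (L →ₗ[ℝ] L →ₗ[ℝ] L))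
    (q : Q (ℓ + 1)) (ζ : L →ₗ[ℝ] TangentSpace (𝓡 (d (ℓ + 1))) q) : Prop :=
  ∃ (U : Set (Q (ℓ + 1))) (s : ∀ y : Q (ℓ + 1), L →ₗ[ℝ] TangentSpace (𝓡 (d (ℓ + 1))) y),
    T.IsFrameSection (ℓ + 1) U s ∧ q ∈ U ∧ s q = ζ ∧
    (∃ c ∈ W2, ∀ x y : ℤ, x < 0 → y < 0 → ∀ X ∈ 𝒢 x, ∀ Y ∈ 𝒢 y,
      c X Y = sectionGamma 𝒢 s q (x + y + (ℓ + 1)) X Y) ∧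
    ∀ a : ℤ, 0 ≤ a → a < ℓ → ∀ A ∈ 𝒢 a, ∃ c ∈ W1, ∀ y : ℤ, y < 0 → ∀ Y ∈ 𝒢 y,
      c Y = sectionGamma 𝒢 s q (y + ℓ) A Y

/-- The tower is the `W`-normal step prolongation of its truncation `Q^{(k)}`: for every `ℓ ≥ k`,
`Q^{(ℓ+1)}` consists of all classes of universal linear frames of `Q^{(ℓ)}` satisfying the
normalization conditions. -/
def IsStepProlongation (k : ℕ) (W1 : ℕ → Submodule ℝ (L →ₗ[ℝ] L))
    (W2 : ℕ → Submodule ℝ (L →ₗ[ℝ] L →ₗ[ℝ] L)) : Prop :=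
  ∀ ℓ : ℕ, k ≤ ℓ → ∀ (q : Q (ℓ + 1)) (ζ : L →ₗ[ℝ] TangentSpace (𝓡 (d (ℓ + 1))) q),
    (∃ z : Q (ℓ + 1 + 1), ζ ∈ T.Fr (ℓ + 1) z q) ↔
      T.IsUnivFrame (ℓ + 1) q ζ ∧ T.IsNormalized ℓ (W1 ℓ) (W2 (ℓ + 1)) q ζ

/-! ### The projective limit, its canonical form and its structure function -/

/-- The projective limit of the tower. -/
def Limit : Type v := {z : ∀ n, Q n // ∀ n, T.π n (z (n + 1)) = z n}

variable {T}

/-- The differential of the projection `Q (n + j) → Q n` at a point of the limit. -/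
def push (z : T.Limit) (n : ℕ) :
    ∀ j : ℕ, TangentSpace (𝓡 (d (n + j))) (z.1 (n + j)) → TangentSpace (𝓡 (d n)) (z.1 n)
  | 0, ξ => ξ
  | j + 1, ξ => push z n j (tcast (z.2 (n + j))
      (mfderiv (𝓡 (d (n + j + 1))) (𝓡 (d (n + j))) (T.π (n + j)) (z.1 (n + j + 1)) ξ))

/-- The image in `T (Q n)` of the vector `X̃ = θ⁻¹(X)` of the absolute parallelism at `z`. It is the
image of `ζ(X)` for any frame `ζ` in the class `z.1 (n + μ + 1)`: another choice changes `ζ(X)` by an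
element of `F^{n+1}`, which is mapped to zero. -/
def vec (μ : ℕ) (z : T.Limit) (n : ℕ) (X : L) : TangentSpace (𝓡 (d n)) (z.1 n) :=
  push z n μ ((Classical.epsilon fun ζ => ζ ∈ T.Fr (n + μ) (z.1 (n + μ + 1)) (z.1 (n + μ))) X)

variable (T)

/-- The `𝔤_p`-component of the canonical Pfaff class of `Q^{(m)} = Q (m + 1)`. If `p + μ ≤ m`, it
does not depend on the choice of the representative frame, and its pull back to the limit is the
`𝔤_p`-component of the canonical form `θ`. -/
def theta (p : ℤ) (m : ℕ) (z : Q (m + 1)) (ξ : TangentSpace (𝓡 (d (m + 1))) z) : L :=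
  coframe 𝒢 p (Classical.epsilon fun ζ => ζ ∈ T.Fr m z (T.π m z))
    (mfderiv (𝓡 (d (m + 1))) (𝓡 (d m)) (T.π m) z ξ)

variable {T}

/-- The `𝔤_c`-component of the structure function: `γ(z)(X, Y)_c = -dθ_c(X̃, Ỹ)`, which is the
equation `dθ + ½ γ(θ, θ) = 0`. -/
def gamma (μ : ℕ) (z : T.Limit) (c : ℤ) (X Y : L) : L :=
  -extD (n := d ((c + μ).toNat + 1)) (T.theta c (c + μ).toNat) (z.1 ((c + μ).toNat + 1))
    (vec μ z ((c + μ).toNat + 1) X) (vec μ z ((c + μ).toNat + 1) Y)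

/-- `ã = min(a, -1)`, used for the modified degree: `𝔤_a ∧ 𝔤_b → 𝔤_c` has the degree `c - a - b` and
the modified degree `c - ã - b̃`. -/
def tilde (a : ℤ) : ℤ := min a (-1)

/-- `κ_[s]`, the component of the modified degree `s` of `κ = γ|_{∧² 𝔤_-}`. -/
def kappa (μ : ℕ) (z : T.Limit) (s : ℤ) (X Y : L) : L :=
  ∑ᶠ (a : ℤ) (b : ℤ) (_ : a < 0 ∧ b < 0),
    gamma μ z (tilde a + tilde b + s) (comp 𝒢 a X) (comp 𝒢 b Y)

/-- `τ_{(r)[s]}`, the component of degree `r` and modified degree `s` of `τ`, the restriction of `γ`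
to `𝔤_- ∧ 𝔤_+`, where `𝔤_+ = ⨁_{a ≥ 0} 𝔤_a`. -/
def tau (μ : ℕ) (z : T.Limit) (r s : ℤ) (X Y : L) : L :=
  ∑ᶠ (a : ℤ) (b : ℤ) (_ : ((a < 0 ∧ 0 ≤ b) ∨ (0 ≤ a ∧ b < 0)) ∧ a + b + r = tilde a + tilde b + s),
    gamma μ z (a + b + r) (comp 𝒢 a X) (comp 𝒢 b Y)

/-- `σ_{(r)[s]}`, the component of degree `r` and modified degree `s` of `σ = γ|_{∧² 𝔤_+}`. -/
def sigma (μ : ℕ) (z : T.Limit) (r s : ℤ) (X Y : L) : L :=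
  ∑ᶠ (a : ℤ) (b : ℤ) (_ : (0 ≤ a ∧ 0 ≤ b) ∧ a + b + r = tilde a + tilde b + s),
    gamma μ z (a + b + r) (comp 𝒢 a X) (comp 𝒢 b Y)

/-- Smooth functions on the limit, which factor through some `Q m`. -/
def SmoothLim (f : T.Limit → L) : Prop :=
  ∃ (m : ℕ) (f' : Q m → L), (∀ z, f z = f' (z.1 m)) ∧ SmoothOn (n := d m) f' Set.univ

/-- `l` is the derivative at `z` of the function `f` on the limit along `X̃ = θ⁻¹(X)`. -/
def HasCovDeriv (μ : ℕ) (X : L) (f : T.Limit → L) (z : T.Limit) (l : L) : Prop :=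
  ∃ (m : ℕ) (f' : Q m → L), (∀ y, f y = f' (y.1 m)) ∧
    HasDerivAlong (n := d m) f' (z.1 m) (vec μ z m X) l

open Classical in
/-- The covariant derivative `D_X f` of a function on the limit. -/
def covD (μ : ℕ) (X : L) (f : T.Limit → L) (z : T.Limit) : L :=
  if h : ∃ l, HasCovDeriv μ X f z l then h.choose else 0

/-- `(ρ(A)κ_[s])(X, Y) = [A, κ_[s](X, Y)] - κ_[s]([A, X]_-, Y) - κ_[s](X, [A, Y]_-)`. -/
def rhoKappa (μ : ℕ) (z : T.Limit) (s : ℤ) (A X Y : L) : L :=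
  ⁅A, kappa μ z s X Y⁆ - kappa μ z s (minusPart 𝒢 ⁅A, X⁆) Y - kappa μ z s X (minusPart 𝒢 ⁅A, Y⁆)

end TowerData

end Tower

end StepProlongation

end

noncomputable section

namespace StepProlongation

universe u v w

set_option linter.unusedSectionVars false

/-! ### Homogeneous components -/

section GradedComponents

variable {L : Type u} [LieRing L] [LieAlgebra ℝ L]
variable (𝒢 : ℤ → Submodule ℝ L) [GradedLieAlgebra 𝒢]

/-! All four identities are components of one equation, the Bianchi identity `bianchi`: the cyclic
sum of γ(γ(X,Y),Z) − D_Z γ(X,Y) vanishes. It is d(dθ) = 0 applied to dθ = −½γ(θ,θ). What separates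
the four cases is which arguments lie in 𝔤_- and which in 𝔤_+, together with the knowledge of γ in
low degrees.

The limit may be infinite dimensional, so the equation is proved one component at a time on finite
levels. Since 𝔤 has no degrees below −μ, changing a frame within its class moves every vector by a
controlled amount. It follows that the vectors of the parallelism are well defined at every level
(`vecL_eq_pushL`), that θ_c is a smooth form on `Q (c + μ + 1)`, that γ_c ignores `algFilt 𝒢 (c + μ
+ 1)`, and that γ_c is a function on `Q N` as soon as N ≥ c + 2μ + 2 (`gamma_congr`). Everything is
then pulled back to one chart of `Q N` (`locZ`, `LocRel`), where dθ_c = −γ_c and dd = 0 are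
statements about functions on a Euclidean space. As 𝔤 carries no topology, vectors are tested on
linear functionals; differentiation is legitimate because each 𝔤_p has finite dimension.

The low degree part of γ is found by comparing the canonical frame at level n with a smooth local
section of the frame bundle (`dForm_section`). The transformation `secH` between them is, up to
higher order, the representation of the group coordinate (`secH_eq_comp_rep`). A vector B of 𝔤_n is
vertical over `Q n`, so the structure function of the section does not see it, and γ(B,·) is the
derivative of this transformation along the fundamental vector B, namely the action of B on
E^{(n-1)} (`secH_gammaSum`, `fderiv_rep`). Hence γ is the bracket on 𝔤_+ ⊗ 𝔤_- in degrees ≤ 0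
(`gamma_of_nonneg_neg`), and it vanishes on 𝔤_a ∧ 𝔤_b in target degrees below max(a,b)
(`gamma_of_nonneg`). On ∧²𝔤_- the compatibility of gr ζ with the bracket of vector fields gives γ =
bracket in degrees ≤ 0 (`gamma_of_neg`).

Inserting this into the Bianchi identity, the terms where one factor has degree 0 become brackets
and assemble to the Spencer coboundary or to [σ(A,B),X]; vanishing in low degree bounds the
remaining sums (`gamma_gammaSum` and its special cases). When the total degree is 0 the two extreme
terms coincide, and the difference is accounted for by the Jacobi identity. -/

lemma comp_apply (p : ℤ) (X : L) : comp 𝒢 p X = (DirectSum.decompose 𝒢 X p : L) := rfl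

lemma comp_mem (p : ℤ) (X : L) : comp 𝒢 p X ∈ 𝒢 p := by
  rw [comp_apply]; exact SetLike.coe_mem _

variable {𝒢}

lemma comp_of_mem {p : ℤ} {X : L} (h : X ∈ 𝒢 p) : comp 𝒢 p X = X := by
  rw [comp_apply, DirectSum.decompose_of_mem_same 𝒢 h]

lemma comp_of_mem_ne {p q : ℤ} {X : L} (h : X ∈ 𝒢 p) (hpq : p ≠ q) : comp 𝒢 q X = 0 := by
  rw [comp_apply, DirectSum.decompose_of_mem_ne 𝒢 h hpq]

lemma comp_of_mem_eq_ite {p : ℤ} (q : ℤ) {X : L} (h : X ∈ 𝒢 p) :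
    comp 𝒢 q X = if p = q then X else 0 := by
  split_ifs with hpq
  · subst hpq; exact comp_of_mem h
  · exact comp_of_mem_ne h hpq

variable (𝒢) in
/-- Two linear maps on a graded Lie algebra agree if they agree on homogeneous elements. -/
lemma linearMap_ext_graded {M : Type*} [AddCommGroup M] [Module ℝ M] {f g : L →ₗ[ℝ] M}
    (h : ∀ p, ∀ X ∈ 𝒢 p, f X = g X) : f = g := by
  ext X
  induction X using DirectSum.Decomposition.inductionOn 𝒢 with
  | zero => simp
  | homogeneous m => exact h _ _ m.2
  | add m m' h1 h2 => simp [h1, h2]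

lemma ext_comp {X Y : L} (h : ∀ p, comp 𝒢 p X = comp 𝒢 p Y) : X = Y := by
  apply (DirectSum.decompose 𝒢).injective
  ext p
  exact h p

lemma comp_eq_zero_of_bot {p : ℤ} (h : 𝒢 p = ⊥) (X : L) : comp 𝒢 p X = 0 := by
  have := comp_mem 𝒢 p X
  rwa [h, Submodule.mem_bot] at this

variable (𝒢) in
lemma minusPart_eq_of_mem {p : ℤ} {X : L} (h : X ∈ 𝒢 p) :
    minusPart 𝒢 X = if p < 0 then X else 0 := by
  have h1 : DirectSum.decompose 𝒢 X = DirectSum.of (fun i => 𝒢 i) p ⟨X, h⟩ :=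
    DirectSum.decompose_of_mem 𝒢 h
  have : minusPart 𝒢 X = (DirectSum.decompose 𝒢).symm
      (DFinsupp.filter (fun p : ℤ => p < 0) (DirectSum.decompose 𝒢 X)) := rfl
  rw [this, h1]
  change (DirectSum.decompose 𝒢).symm (DFinsupp.filter _ (DFinsupp.single p _)) = _
  rw [DFinsupp.filter_single]
  split_ifs with hp
  · exact DirectSum.decompose_symm_of 𝒢 ⟨X, h⟩
  · exact DirectSum.decompose_symm_zero 𝒢

lemma minusPart_of_neg {p : ℤ} {X : L} (h : X ∈ 𝒢 p) (hp : p < 0) : minusPart 𝒢 X = X := by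
  rw [minusPart_eq_of_mem 𝒢 h, if_pos hp]

lemma minusPart_of_nonneg {p : ℤ} {X : L} (h : X ∈ 𝒢 p) (hp : 0 ≤ p) : minusPart 𝒢 X = 0 := by
  rw [minusPart_eq_of_mem 𝒢 h, if_neg (not_lt.2 hp)]

lemma plusPart_of_neg {p : ℤ} {X : L} (h : X ∈ 𝒢 p) (hp : p < 0) : plusPart 𝒢 X = 0 := by
  simp [plusPart, minusPart_of_neg h hp]

lemma plusPart_of_nonneg {p : ℤ} {X : L} (h : X ∈ 𝒢 p) (hp : 0 ≤ p) : plusPart 𝒢 X = X := by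
  simp [plusPart, minusPart_of_nonneg h hp]

lemma mem_algFilt {p : ℤ} {X : L} : X ∈ algFilt 𝒢 p ↔ ∀ q < p, comp 𝒢 q X = 0 := by
  simp [algFilt]

lemma mem_algFilt_of_mem {p q : ℤ} {X : L} (h : X ∈ 𝒢 p) (hqp : q ≤ p) : X ∈ algFilt 𝒢 q :=
  mem_algFilt.2 fun r hr => comp_of_mem_ne h (by omega)

variable (𝒢) in
lemma algFilt_anti {p q : ℤ} (h : p ≤ q) : algFilt 𝒢 q ≤ algFilt 𝒢 p :=
  fun _ hX => mem_algFilt.2 fun r hr => mem_algFilt.1 hX r (by omega)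

lemma lie_mem {p q : ℤ} {X Y : L} (hX : X ∈ 𝒢 p) (hY : Y ∈ 𝒢 q) : ⁅X, Y⁆ ∈ 𝒢 (p + q) :=
  SetLike.GradedBracket.bracket_mem hX hY

variable (𝒢) in
/-- The sum of the components of degree in `[-μ, n)`. -/
def trunc (μ : ℕ) (n : ℤ) : L →ₗ[ℝ] L := ∑ p ∈ Finset.Ico (-(μ : ℤ)) n, comp 𝒢 p

lemma trunc_apply (μ : ℕ) (n : ℤ) (X : L) :
    trunc 𝒢 μ n X = ∑ p ∈ Finset.Ico (-(μ : ℤ)) n, comp 𝒢 p X := by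
  simp [trunc]

lemma comp_sum_of_mem (s : Finset ℤ) (f : ℤ → L) (hf : ∀ p, f p ∈ 𝒢 p) (q : ℤ) :
    comp 𝒢 q (∑ p ∈ s, f p) = if q ∈ s then f q else 0 := by
  rw [map_sum]
  simp_rw [comp_of_mem_eq_ite q (hf _)]
  simp

lemma comp_trunc {μ : ℕ} {n p : ℤ} (hd : ∀ p : ℤ, p < -(μ : ℤ) → 𝒢 p = ⊥) (hp : p < n) (X : L) :
    comp 𝒢 p (trunc 𝒢 μ n X) = comp 𝒢 p X := by
  rw [trunc_apply, comp_sum_of_mem _ _ (fun p => comp_mem 𝒢 p X)]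
  split_ifs with h
  · rfl
  · rw [comp_eq_zero_of_bot (hd p _)]
    simp only [Finset.mem_Ico, not_and, not_lt] at h
    by_contra h'
    exact absurd (h (by omega)) (by omega)

/-- Lets an element of 𝔤 be replaced by finitely many of its components wherever only a quotient by
a step of the filtration matters. -/
lemma sub_trunc_mem {μ : ℕ} (n : ℤ) (hd : ∀ p : ℤ, p < -(μ : ℤ) → 𝒢 p = ⊥) (X : L) :
    X - trunc 𝒢 μ n X ∈ algFilt 𝒢 n :=
  mem_algFilt.2 fun q hq => by rw [map_sub, comp_trunc hd hq, sub_self]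

end GradedComponents

/-- The linear functional separating points of a real vector space. -/
lemma eq_of_forall_dual {L : Type*} [AddCommGroup L] [Module ℝ L] {l l' : L}
    (h : ∀ φ : Module.Dual ℝ L, φ l = φ l') : l = l' :=
  (Module.forall_dual_apply_eq_zero_iff ℝ (l - l')).1 (fun φ => by simp [h φ]) |> sub_eq_zero.1

/-! ### Derivatives of vector valued functions -/

section VectorValued

open Topology

variable {L : Type u} [AddCommGroup L] [Module ℝ L]
variable {n : ℕ} {M : Type v} [TopologicalSpace M] [ChartedSpace (EuclideanSpace ℝ (Fin n)) M]

lemma HasDerivAlong.unique {f : M → L} {x : M} {ξ : TangentSpace (𝓡 n) x} {l l' : L}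
    (h : HasDerivAlong f x ξ l) (h' : HasDerivAlong f x ξ l') : l = l' :=
  eq_of_forall_dual fun φ => (h φ).2.symm.trans (h' φ).2

lemma HasDerivAlong.derivAlong_eq {f : M → L} {x : M} {ξ : TangentSpace (𝓡 n) x} {l : L}
    (h : HasDerivAlong f x ξ l) : derivAlong f x ξ = l := by
  have h' : ∃ l, HasDerivAlong f x ξ l := ⟨l, h⟩
  rw [derivAlong, dif_pos h']
  exact h'.choose_spec.unique h

/-- A finite dimensional subspace has finitely many coordinate functionals on the whole space. -/
lemma exists_coordinates (S : Submodule ℝ L) [FiniteDimensional ℝ S] :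
    ∃ (r : ℕ) (b : Fin r → L) (c : Fin r → Module.Dual ℝ L),
      (∀ i, b i ∈ S) ∧ ∀ x ∈ S, x = ∑ i, c i x • b i := by
  obtain ⟨P, hP⟩ := S.subtype.exists_leftInverse_of_injective S.ker_subtype
  let B := Module.finBasis ℝ S
  refine ⟨_, fun i => (B i : L), fun i => B.coord i ∘ₗ P, fun i => (B i).2, fun x hx => ?_⟩
  have h1 : P x = ⟨x, hx⟩ := by
    have := LinearMap.congr_fun hP ⟨x, hx⟩
    simpa using this
  have h2 := B.sum_repr ⟨x, hx⟩
  have h3 := congrArg S.subtype h2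
  rw [map_sum] at h3
  simp only [map_smul, Submodule.subtype_apply] at h3
  simp only [LinearMap.comp_apply, h1, Module.Basis.coord_apply]
  exact h3.symm

/-- A function with values in a finite dimensional subspace whose coordinates are differentiable has
a derivative. -/
lemma exists_hasDerivAlong (S : Submodule ℝ L) [FiniteDimensional ℝ S] {f : M → L}
    (hS : ∀ y, f y ∈ S) {x : M}
    (hf : ∀ φ : Module.Dual ℝ L, MDifferentiableAt (𝓡 n) 𝓘(ℝ, ℝ) (fun y => φ (f y)) x)
    (ξ : TangentSpace (𝓡 n) x) : ∃ l ∈ S, HasDerivAlong f x ξ l := by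
  obtain ⟨r, b, c, hb, hc⟩ := exists_coordinates S
  let D : Fin r → EuclideanSpace ℝ (Fin n) →L[ℝ] ℝ := fun i =>
    mfderiv (𝓡 n) 𝓘(ℝ, ℝ) (fun y => c i (f y)) x
  refine ⟨∑ i, D i ξ • b i,
    Submodule.sum_mem _ fun i _ => Submodule.smul_mem _ _ (hb i), fun φ => ⟨hf φ, ?_⟩⟩
  have h1 : (fun y => φ (f y)) = ∑ i, (φ (b i)) • (fun y => c i (f y)) := by
    funext y
    conv_lhs => rw [hc (f y) (hS y)]
    simp [mul_comm]
  have h2 : HasMFDerivAt (𝓡 n) 𝓘(ℝ, ℝ) (∑ i, (φ (b i)) • (fun y => c i (f y))) x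
      (∑ i, (φ (b i)) • D i : EuclideanSpace ℝ (Fin n) →L[ℝ] ℝ) :=
    HasMFDerivAt.sum fun i _ => ((hf (c i)).hasMFDerivAt).const_smul (φ (b i))
  rw [h1, h2.mfderiv, map_sum]
  simp only [map_smul, smul_eq_mul]
  refine (sum_apply Finset.univ (fun i => φ (b i) • D i) ξ).trans ?_
  exact Finset.sum_congr rfl fun i _ => mul_comm _ _

end VectorValued

/-! ### Product rule, pull back and dd = 0 in Euclidean space. -/

section EuclideanCalculus

open Topology

variable {L : Type u} [AddCommGroup L] [Module ℝ L]

lemma hasDerivAlong_euclidean {k : ℕ} {f : EuclideanSpace ℝ (Fin k) → L}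
    {y v : EuclideanSpace ℝ (Fin k)} {l : L} :
    HasDerivAlong (n := k) f y v l ↔ ∀ φ : Module.Dual ℝ L,
      DifferentiableAt ℝ (fun u => φ (f u)) y ∧ fderiv ℝ (fun u => φ (f u)) y v = φ l := by
  refine forall_congr' fun φ => ?_
  rw [mdifferentiableAt_iff_differentiableAt, mfderiv_eq_fderiv]
  exact Iff.rfl

/-- The product rule for a linear form applied to a vector, where both depend on a parameter and the
vector stays in a finite dimensional subspace. -/
lemma fderiv_pairing {E : Type*} [NormedAddCommGroup E] [NormedSpace ℝ E]
    (S : Submodule ℝ L) [FiniteDimensional ℝ S] {h : E → Module.Dual ℝ L} {f : E → L} {y v : E}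
    {l : L} (hS : ∀ u, f u ∈ S) (hl : l ∈ S)
    (hh : ∀ x, DifferentiableAt ℝ (fun u => h u x) y)
    (hf : ∀ φ : Module.Dual ℝ L,
      DifferentiableAt ℝ (fun u => φ (f u)) y ∧ fderiv ℝ (fun u => φ (f u)) y v = φ l) :
    DifferentiableAt ℝ (fun u => h u (f u)) y ∧
      fderiv ℝ (fun u => h u (f u)) y v = fderiv ℝ (fun u => h u (f y)) y v + h y l := by
  obtain ⟨r, b, c, hb, hc⟩ := exists_coordinates S
  -- In coordinates on S the pairing is a finite sum of products of real functions; no topology on L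
  -- is needed.
  have h1 : (fun u => h u (f u)) = fun u => ∑ i, c i (f u) * h u (b i) := by
    funext u
    conv_lhs => rw [hc (f u) (hS u)]
    simp
  have h2 : (fun u => h u (f y)) = fun u => ∑ i, c i (f y) * h u (b i) := by
    funext u
    conv_lhs => rw [hc (f y) (hS y)]
    simp
  have h3 : h y l = ∑ i, c i l * h y (b i) := by
    conv_lhs => rw [hc l hl]
    simp
  have h4 : HasFDerivAt (fun u => ∑ i, c i (f u) * h u (b i))
      (∑ i, (c i (f y) • fderiv ℝ (fun u => h u (b i)) y +
        h y (b i) • fderiv ℝ (fun u => c i (f u)) y)) y :=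
    HasFDerivAt.fun_sum fun i _ => ((hf (c i)).1.hasFDerivAt).mul ((hh (b i)).hasFDerivAt)
  have h5 : HasFDerivAt (fun u => ∑ i, c i (f y) * h u (b i))
      (∑ i, (c i (f y) • fderiv ℝ (fun u => h u (b i)) y)) y :=
    HasFDerivAt.fun_sum fun i _ => ((hh (b i)).hasFDerivAt).const_mul _
  rw [h1, h2, h3, h4.fderiv, h5.fderiv]
  refine ⟨h4.differentiableAt, ?_⟩
  simp only [sum_apply, add_apply,
    smul_apply, smul_eq_mul, (hf _).2]
  rw [← Finset.sum_add_distrib]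
  exact Finset.sum_congr rfl fun i _ => by ring

/-- On a finite dimensional source an operator is the sum of the rank one operators given by its
values on the standard basis. -/
lemma contDiffAt_clm_of_apply {E F : Type*} [NormedAddCommGroup E] [NormedSpace ℝ E]
    [NormedAddCommGroup F] [NormedSpace ℝ F] {k : ℕ} {N : ℕ∞ω}
    {A : E → EuclideanSpace ℝ (Fin k) →L[ℝ] F} {y : E}
    (h : ∀ w, ContDiffAt ℝ N (fun u => A u w) y) : ContDiffAt ℝ N A y := by
  have : A = fun u => ∑ i, (EuclideanSpace.proj i : EuclideanSpace ℝ (Fin k) →L[ℝ] ℝ).smulRight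
      (A u (EuclideanSpace.single i 1)) := by
    funext u
    ext w
    have hw : w = ∑ i, w i • EuclideanSpace.single i (1 : ℝ) := by
      ext j
      simp [Finset.sum_apply, Pi.single_apply]
    conv_lhs => rw [hw, map_sum]
    simp
  rw [this]
  refine ContDiffAt.sum fun i _ => ?_
  exact ContDiffAt.comp y (ContinuousLinearMap.smulRightL ℝ (EuclideanSpace ℝ (Fin k)) F
    (EuclideanSpace.proj i)).contDiff.contDiffAt (h _)

/-- The exterior derivative of a 1-form is compatible with pull back. -/
lemma fderiv_pullback_sub {E E' : Type*} [NormedAddCommGroup E] [NormedSpace ℝ E]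
    [NormedAddCommGroup E'] [NormedSpace ℝ E'] {a : E' → E' →L[ℝ] ℝ} {f : E → E'} {y : E}
    (ha : DifferentiableAt ℝ a (f y)) (hf : ContDiffAt ℝ 2 f y) (v w : E) :
    fderiv ℝ (fun u => a (f u) (fderiv ℝ f u w)) y v -
        fderiv ℝ (fun u => a (f u) (fderiv ℝ f u v)) y w =
      fderiv ℝ a (f y) (fderiv ℝ f y v) (fderiv ℝ f y w) -
        fderiv ℝ a (f y) (fderiv ℝ f y w) (fderiv ℝ f y v) := by
  have hf1 : DifferentiableAt ℝ f y := hf.differentiableAt (by norm_num)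
  have hf2 : DifferentiableAt ℝ (fderiv ℝ f) y :=
    (hf.fderiv_right (m := 1) (by norm_num)).differentiableAt (by norm_num)
  have key : ∀ v w : E, fderiv ℝ (fun u => a (f u) (fderiv ℝ f u w)) y v =
      fderiv ℝ a (f y) (fderiv ℝ f y v) (fderiv ℝ f y w) +
        a (f y) (fderiv ℝ (fderiv ℝ f) y v w) := by
    intro v w
    have h1 : HasFDerivAt (fun u => a (f u)) ((fderiv ℝ a (f y)).comp (fderiv ℝ f y)) y :=
      ha.hasFDerivAt.comp y hf1.hasFDerivAt
    have h2 : HasFDerivAt (fun u => fderiv ℝ f u w)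
        ((ContinuousLinearMap.apply ℝ E' w).comp (fderiv ℝ (fderiv ℝ f) y)) y :=
      (ContinuousLinearMap.apply ℝ E' w).hasFDerivAt.comp y hf2.hasFDerivAt
    rw [(h1.clm_apply h2).fderiv]
    simp [add_comm]
  -- The second derivative of f enters both terms of the antisymmetrization; its symmetry makes it
  -- cancel.
  have hsymm := (hf.isSymmSndFDerivAt (by simp)).eq v w
  rw [key, key, hsymm]
  ring

/-- The exterior derivative of the differential of a 1-form vanishes. -/
lemma fderiv_fderiv_cyclic {E : Type*} [NormedAddCommGroup E] [NormedSpace ℝ E] {a : E → E → ℝ}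
    {y : E} (ha : ∀ w, ContDiffAt ℝ 2 (fun u => a u w) y) (u v w : E) :
    (fderiv ℝ (fun t => fderiv ℝ (fun t => a t w) t v - fderiv ℝ (fun t => a t v) t w) y u) +
    (fderiv ℝ (fun t => fderiv ℝ (fun t => a t u) t w - fderiv ℝ (fun t => a t w) t u) y v) +
    (fderiv ℝ (fun t => fderiv ℝ (fun t => a t v) t u - fderiv ℝ (fun t => a t u) t v) y w)
      = 0 := by
  have hd : ∀ w, DifferentiableAt ℝ (fderiv ℝ (fun t => a t w)) y := fun w =>
    ((ha w).fderiv_right (m := 1) (by norm_num)).differentiableAt (by norm_num)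
  have h2 : ∀ v w, HasFDerivAt (fun t => fderiv ℝ (fun t => a t w) t v)
      ((ContinuousLinearMap.apply ℝ ℝ v).comp (fderiv ℝ (fderiv ℝ (fun t => a t w)) y)) y :=
    fun v w => (ContinuousLinearMap.apply ℝ ℝ v).hasFDerivAt.comp y (hd w).hasFDerivAt
  have hs : ∀ u v w, fderiv ℝ (fderiv ℝ (fun t => a t w)) y u v =
      fderiv ℝ (fderiv ℝ (fun t => a t w)) y v u := fun u v w =>
    ((ha w).isSymmSndFDerivAt (by simp)).eq u v
  rw [((h2 v w).fun_sub (h2 w v)).fderiv, ((h2 w u).fun_sub (h2 u w)).fderiv,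
    ((h2 u v).fun_sub (h2 v u)).fderiv]
  simp only [sub_apply, ContinuousLinearMap.comp_apply,
    ContinuousLinearMap.apply_apply]
  rw [hs v u w, hs w u v, hs w v u]
  ring

end EuclideanCalculus

/-! ### Differential forms on manifolds, in charts -/

section Forms

open Topology

variable {n : ℕ} {M : Type v} [TopologicalSpace M] [ChartedSpace (EuclideanSpace ℝ (Fin n)) M]

/-- The 1-form `α` in the chart around `x`. -/
def chartForm (α : ∀ q : M, TangentSpace (𝓡 n) q →ₗ[ℝ] ℝ) (x : M) (u : EuclideanSpace ℝ (Fin n)) :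
    EuclideanSpace ℝ (Fin n) →L[ℝ] ℝ :=
  LinearMap.toContinuousLinearMap (E := EuclideanSpace ℝ (Fin n))
    ((α ((extChartAt (𝓡 n) x).symm u)) ∘ₗ
      (mfderiv 𝓘(ℝ, EuclideanSpace ℝ (Fin n)) (𝓡 n) (extChartAt (𝓡 n) x).symm u).toLinearMap)

lemma chartForm_apply (α : ∀ q : M, TangentSpace (𝓡 n) q →ₗ[ℝ] ℝ) (x : M)
    (u w : EuclideanSpace ℝ (Fin n)) :
    chartForm α x u w = α ((extChartAt (𝓡 n) x).symm u)
      (mfderiv 𝓘(ℝ, EuclideanSpace ℝ (Fin n)) (𝓡 n) (extChartAt (𝓡 n) x).symm u w) := rfl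

/-- Smoothness of a 1-form around `x`. -/
def SmoothFormAt (α : ∀ q : M, TangentSpace (𝓡 n) q →ₗ[ℝ] ℝ) (x : M) : Prop :=
  ContDiffAt ℝ ∞ (chartForm α x) (extChartAt (𝓡 n) x x)

/-- The exterior derivative of a real valued 1-form. -/
def dForm (α : ∀ q : M, TangentSpace (𝓡 n) q →ₗ[ℝ] ℝ) (x : M)
    (ξ η : EuclideanSpace ℝ (Fin n)) : ℝ :=
  fderiv ℝ (chartForm α x) (extChartAt (𝓡 n) x x) ξ η -
    fderiv ℝ (chartForm α x) (extChartAt (𝓡 n) x x) η ξ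

/-- All tangent spaces are the same model space, so vectors can be compared there while the base
point changes. Later transport lemmas use the same device. -/
lemma form_congr {L : Type*} (α : ∀ q : M, TangentSpace (𝓡 n) q → L) {q q' : M} (h : q = q')
    {ξ ξ' : EuclideanSpace ℝ (Fin n)} (h' : ξ = ξ') : α q ξ = α q' ξ' := by
  subst h; subst h'; rfl

lemma eventually_contMDiffAt {k : ℕ} {F : EuclideanSpace ℝ (Fin k) → M}
    {y : EuclideanSpace ℝ (Fin k)}
    (hF : ∀ᶠ t in 𝓝 y, ContMDiffAt 𝓘(ℝ, EuclideanSpace ℝ (Fin k)) (𝓡 n) ∞ F t) (x : M)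
    (hx : F y ∈ (extChartAt (𝓡 n) x).source) :
    ∀ᶠ t in 𝓝 y, ContMDiffAt 𝓘(ℝ, EuclideanSpace ℝ (Fin k)) (𝓡 n) ∞ F t ∧
      F t ∈ (extChartAt (𝓡 n) x).source :=
  hF.and (hF.self_of_nhds.continuousAt.preimage_mem_nhds
    ((isOpen_extChartAt_source x).mem_nhds hx))

lemma two_le_infty : (2 : ℕ∞ω) ≤ ∞ := by
  exact WithTop.coe_le_coe.2 (le_top : (2 : ℕ∞) ≤ ⊤)

variable [IsManifold (𝓡 n) ∞ M]

lemma contMDiffAt_extChartAt_symm {x : M} {u : EuclideanSpace ℝ (Fin n)}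
    (hu : u ∈ (extChartAt (𝓡 n) x).target) :
    ContMDiffAt 𝓘(ℝ, EuclideanSpace ℝ (Fin n)) (𝓡 n) ∞ (extChartAt (𝓡 n) x).symm u :=
  (contMDiffOn_extChartAt_symm x).contMDiffAt ((isOpen_extChartAt_target x).mem_nhds hu)

lemma mfderiv_eq_of_chart {k : ℕ} {F : EuclideanSpace ℝ (Fin k) → M}
    {y : EuclideanSpace ℝ (Fin k)} (x : M)
    (hx : F y ∈ (extChartAt (𝓡 n) x).source)
    (hF : ContMDiffAt 𝓘(ℝ, EuclideanSpace ℝ (Fin k)) (𝓡 n) ∞ F y) (w : EuclideanSpace ℝ (Fin k)) :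
    (mfderiv 𝓘(ℝ, EuclideanSpace ℝ (Fin k)) (𝓡 n) F y w : EuclideanSpace ℝ (Fin n)) =
      mfderiv 𝓘(ℝ, EuclideanSpace ℝ (Fin n)) (𝓡 n) (extChartAt (𝓡 n) x).symm
        (extChartAt (𝓡 n) x (F y))
        (fderiv ℝ (fun t => extChartAt (𝓡 n) x (F t)) y w) := by
  have hn : (extChartAt (𝓡 n) x).source ∈ 𝓝 (F y) := (isOpen_extChartAt_source x).mem_nhds hx
  have h1 : F =ᶠ[𝓝 y] (extChartAt (𝓡 n) x).symm ∘ (fun t => extChartAt (𝓡 n) x (F t)) := by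
    filter_upwards [hF.continuousAt.preimage_mem_nhds hn] with t ht
    exact ((extChartAt (𝓡 n) x).left_inv ht).symm
  have hx' : F y ∈ (chartAt (EuclideanSpace ℝ (Fin n)) x).source := by
    rwa [extChartAt_source] at hx
  have h2 : ContMDiffAt 𝓘(ℝ, EuclideanSpace ℝ (Fin k)) 𝓘(ℝ, EuclideanSpace ℝ (Fin n)) ∞
      (fun t => extChartAt (𝓡 n) x (F t)) y :=
    (contMDiffAt_extChartAt' hx').comp y hF
  have h3 := contMDiffAt_extChartAt_symm ((extChartAt (𝓡 n) x).map_source hx)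
  have h4 := mfderiv_comp y (h3.mdifferentiableAt (by simp)) (h2.mdifferentiableAt (by simp))
  rw [h1.mfderiv_eq, h4, mfderiv_eq_fderiv]
  rfl

lemma form_mfderiv_eq_chartForm {k : ℕ} (α : ∀ q : M, TangentSpace (𝓡 n) q →ₗ[ℝ] ℝ)
    {F : EuclideanSpace ℝ (Fin k) → M} {y : EuclideanSpace ℝ (Fin k)} (x : M)
    (hx : F y ∈ (extChartAt (𝓡 n) x).source)
    (hF : ContMDiffAt 𝓘(ℝ, EuclideanSpace ℝ (Fin k)) (𝓡 n) ∞ F y) (w : EuclideanSpace ℝ (Fin k)) :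
    α (F y) (mfderiv 𝓘(ℝ, EuclideanSpace ℝ (Fin k)) (𝓡 n) F y w) =
      chartForm α x (extChartAt (𝓡 n) x (F y))
        (fderiv ℝ (fun t => extChartAt (𝓡 n) x (F t)) y w) := by
  rw [chartForm_apply]
  exact form_congr (fun q => α q) ((extChartAt (𝓡 n) x).left_inv hx).symm
    (mfderiv_eq_of_chart x hx hF w)

/-- The exterior derivative of the pull back of a 1-form. -/
lemma fderiv_form_pullback {k : ℕ} {α : ∀ q : M, TangentSpace (𝓡 n) q →ₗ[ℝ] ℝ}
    {F : EuclideanSpace ℝ (Fin k) → M} {y : EuclideanSpace ℝ (Fin k)}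
    (hα : SmoothFormAt α (F y))
    (hF : ∀ᶠ t in 𝓝 y, ContMDiffAt 𝓘(ℝ, EuclideanSpace ℝ (Fin k)) (𝓡 n) ∞ F t)
    (v w : EuclideanSpace ℝ (Fin k)) :
    fderiv ℝ (fun t => α (F t) (mfderiv 𝓘(ℝ, EuclideanSpace ℝ (Fin k)) (𝓡 n) F t w)) y v -
      fderiv ℝ (fun t => α (F t) (mfderiv 𝓘(ℝ, EuclideanSpace ℝ (Fin k)) (𝓡 n) F t v)) y w =
    dForm α (F y) (mfderiv 𝓘(ℝ, EuclideanSpace ℝ (Fin k)) (𝓡 n) F y v)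
      (mfderiv 𝓘(ℝ, EuclideanSpace ℝ (Fin k)) (𝓡 n) F y w) := by
  set x := F y with hxdef
  have hx : F y ∈ (extChartAt (𝓡 n) x).source := mem_extChartAt_source x
  set f : EuclideanSpace ℝ (Fin k) → EuclideanSpace ℝ (Fin n) := fun t => extChartAt (𝓡 n) x (F t)
    with hf
  have hev := eventually_contMDiffAt hF x hx
  have h1 : ∀ w, (fun t => α (F t) (mfderiv 𝓘(ℝ, EuclideanSpace ℝ (Fin k)) (𝓡 n) F t w)) =ᶠ[𝓝 y]
      fun t => chartForm α x (f t) (fderiv ℝ f t w) := by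
    intro w
    filter_upwards [hev] with t ht
    exact form_mfderiv_eq_chartForm α x ht.2 ht.1 w
  rw [(h1 v).fderiv_eq, (h1 w).fderiv_eq]
  have hfs : ContDiffAt ℝ ∞ f y := by
    have : ContMDiffAt 𝓘(ℝ, EuclideanSpace ℝ (Fin k)) 𝓘(ℝ, EuclideanSpace ℝ (Fin n)) ∞ f y :=
      (contMDiffAt_extChartAt (x := x)).comp y hF.self_of_nhds
    exact this.contDiffAt
  have hα' : DifferentiableAt ℝ (chartForm α x) (f y) := hα.differentiableAt (by simp)
  rw [fderiv_pullback_sub hα' (hfs.of_le two_le_infty)]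
  -- A chart has derivative the identity at its own centre, so coordinate vectors at F y are already
  -- the tangent vectors used by `dForm`.
  have h2 : ∀ w, fderiv ℝ f y w =
      mfderiv 𝓘(ℝ, EuclideanSpace ℝ (Fin k)) (𝓡 n) F y w := by
    intro w
    have h3 : mfderiv 𝓘(ℝ, EuclideanSpace ℝ (Fin k)) 𝓘(ℝ, EuclideanSpace ℝ (Fin n)) f y =
        (mfderiv (𝓡 n) 𝓘(ℝ, EuclideanSpace ℝ (Fin n)) (extChartAt (𝓡 n) x) (F y)).comp
        (mfderiv 𝓘(ℝ, EuclideanSpace ℝ (Fin k)) (𝓡 n) F y) :=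
      mfderiv_comp y (mdifferentiableAt_extChartAt (mem_chart_source _ x))
        (hF.self_of_nhds.mdifferentiableAt (by simp))
    rw [← mfderiv_eq_fderiv, h3, ← hxdef, mfderiv_extChartAt_self]
    rfl
  simp only [h2]
  rfl

end Forms

/-! ### Exterior derivatives of vector valued forms. -/

section ExtD

variable {L : Type u} [AddCommGroup L] [Module ℝ L]
variable {n : ℕ} {M : Type v} [TopologicalSpace M] [ChartedSpace (EuclideanSpace ℝ (Fin n)) M]
variable [IsManifold (𝓡 n) ∞ M]

/-- The exterior derivative of a vector valued 1-form, tested on a linear functional. -/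
lemma dual_extD (S : Submodule ℝ L) [FiniteDimensional ℝ S]
    (α : ∀ q : M, TangentSpace (𝓡 n) q →ₗ[ℝ] L) (hS : ∀ q ξ, α q ξ ∈ S) (x : M)
    (hα : ∀ φ : Module.Dual ℝ L, SmoothFormAt (fun q => φ ∘ₗ α q) x)
    (ξ η : EuclideanSpace ℝ (Fin n)) :
    extD (fun q => α q) x ξ η ∈ S ∧ ∀ φ : Module.Dual ℝ L,
      φ (extD (fun q => α q) x ξ η) = dForm (fun q => φ ∘ₗ α q) x ξ η := by
  set e := extChartAt (𝓡 n) x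
  let a : EuclideanSpace ℝ (Fin n) → EuclideanSpace ℝ (Fin n) → L := fun v y =>
    α (e.symm y) (mfderiv 𝓘(ℝ, EuclideanSpace ℝ (Fin n)) (𝓡 n) e.symm y v)
  have h1 : ∀ (v : EuclideanSpace ℝ (Fin n)) (φ : Module.Dual ℝ L),
      (fun y => φ (a v y)) = fun y => chartForm (fun q => φ ∘ₗ α q) x y v := fun v φ => rfl
  have hd : ∀ φ : Module.Dual ℝ L,
      DifferentiableAt ℝ (chartForm (fun q => φ ∘ₗ α q) x) (e x) := fun φ =>
    (hα φ).differentiableAt (by simp)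
  -- Values in the finite dimensional S guarantee that the derivatives exist, so the default value 0
  -- of `derivAlong` never enters.
  have h2 : ∀ v w : EuclideanSpace ℝ (Fin n), ∃ l ∈ S,
      HasDerivAlong (n := n) (a v) (e x) w l := by
    intro v w
    refine exists_hasDerivAlong S (fun y => hS _ _) (fun φ => ?_) w
    rw [mdifferentiableAt_iff_differentiableAt, h1]
    exact (ContinuousLinearMap.apply ℝ ℝ v).differentiableAt.comp _ (hd φ)
  have h3 : ∀ (v w : EuclideanSpace ℝ (Fin n)) (φ : Module.Dual ℝ L),
      fderiv ℝ (fun y => φ (a v y)) (e x) w =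
        fderiv ℝ (chartForm (fun q => φ ∘ₗ α q) x) (e x) w v := by
    intro v w φ
    have h4 : HasFDerivAt (fun y => chartForm (fun q => φ ∘ₗ α q) x y v)
        ((ContinuousLinearMap.apply ℝ ℝ v).comp
          (fderiv ℝ (chartForm (fun q => φ ∘ₗ α q) x) (e x))) (e x) :=
      (ContinuousLinearMap.apply ℝ ℝ v).hasFDerivAt.comp _ (hd φ).hasFDerivAt
    rw [h1, h4.fderiv]
    rfl
  obtain ⟨l, hlS, hl⟩ := h2 η ξ
  obtain ⟨l', hlS', hl'⟩ := h2 ξ η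
  have h5 : extD (fun q => α q) x ξ η = l - l' := by
    have : extD (fun q => α q) x ξ η = derivAlong (n := n) (a (mfderiv (𝓡 n)
        𝓘(ℝ, EuclideanSpace ℝ (Fin n)) e x η)) (e x) (mfderiv (𝓡 n)
        𝓘(ℝ, EuclideanSpace ℝ (Fin n)) e x ξ) - derivAlong (n := n) (a (mfderiv (𝓡 n)
        𝓘(ℝ, EuclideanSpace ℝ (Fin n)) e x ξ)) (e x) (mfderiv (𝓡 n)
        𝓘(ℝ, EuclideanSpace ℝ (Fin n)) e x η) := rfl
    rw [this, mfderiv_extChartAt_self]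
    exact congrArg₂ _ hl.derivAlong_eq hl'.derivAlong_eq
  rw [h5]
  refine ⟨S.sub_mem hlS hlS', fun φ => ?_⟩
  rw [map_sub, ← (hasDerivAlong_euclidean.1 hl φ).2, ← (hasDerivAlong_euclidean.1 hl' φ).2, h3, h3]
  rfl

end ExtD

/-! ### Smooth dependence of inverse frames on the point. -/

section SmoothCoframe

open Topology

variable {n k : ℕ} {M : Type v} [TopologicalSpace M] [ChartedSpace (EuclideanSpace ℝ (Fin n)) M]
variable [IsManifold (𝓡 n) ∞ M]

/-- A smooth map into the tangent bundle, read in the chart around `G y`. -/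
lemma contDiffAt_chart_vector {G : EuclideanSpace ℝ (Fin k) → M}
    {ξ : ∀ t, TangentSpace (𝓡 n) (G t)} {y : EuclideanSpace ℝ (Fin k)}
    (hξ : ContMDiffAt 𝓘(ℝ, EuclideanSpace ℝ (Fin k)) (𝓡 n).tangent ∞
      (fun t => (⟨G t, ξ t⟩ : TangentBundle (𝓡 n) M)) y) :
    ContDiffAt ℝ ∞ (fun t => (mfderiv (𝓡 n) 𝓘(ℝ, EuclideanSpace ℝ (Fin n))
      (extChartAt (𝓡 n) (G y)) (G t) (ξ t) : EuclideanSpace ℝ (Fin n))) y ∧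
    ∀ᶠ t in 𝓝 y, G t ∈ (extChartAt (𝓡 n) (G y)).source := by
  obtain ⟨h1, h2⟩ := (Bundle.contMDiffAt_totalSpace).1 hξ
  have h3 : ∀ᶠ t in 𝓝 y, G t ∈ (extChartAt (𝓡 n) (G y)).source :=
    h1.continuousAt.preimage_mem_nhds (extChartAt_source_mem_nhds (G y))
  refine ⟨h2.contDiffAt.congr_of_eventuallyEq ?_, h3⟩
  filter_upwards [h3] with t ht
  rw [extChartAt_source] at ht
  rw [← TangentBundle.continuousLinearMapAt_trivializationAt ht]
  exact (trivializationAt (EuclideanSpace ℝ (Fin n)) (TangentSpace (𝓡 n))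
    (G y)).continuousLinearMapAt_apply_of_mem (R := ℝ) (by simpa using ht) _

/-- If a smooth family of linear maps `s t` is surjective, then `P (s t)⁻¹ (ξ t)` depends smoothly
on `t`, provided that it is well defined. -/
lemma contDiffAt_coframe {L : Type u} [AddCommGroup L] [Module ℝ L]
    {G : EuclideanSpace ℝ (Fin k) → M} {s : ∀ t, L →ₗ[ℝ] TangentSpace (𝓡 n) (G t)}
    {ξ : ∀ t, TangentSpace (𝓡 n) (G t)} {y : EuclideanSpace ℝ (Fin k)}
    (hs : ∀ X, ContMDiffAt 𝓘(ℝ, EuclideanSpace ℝ (Fin k)) (𝓡 n).tangent ∞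
      (fun t => (⟨G t, s t X⟩ : TangentBundle (𝓡 n) M)) y)
    (hξ : ContMDiffAt 𝓘(ℝ, EuclideanSpace ℝ (Fin k)) (𝓡 n).tangent ∞
      (fun t => (⟨G t, ξ t⟩ : TangentBundle (𝓡 n) M)) y)
    (hsurj : Function.Surjective (s y)) (P : L →ₗ[ℝ] L) {c : EuclideanSpace ℝ (Fin k) → L}
    (hc : ∀ᶠ t in 𝓝 y, ∀ X, s t X = ξ t → c t = P X) (φ : Module.Dual ℝ L) :
    ContDiffAt ℝ ∞ (fun t => φ (c t)) y := by
  let De : ∀ t, EuclideanSpace ℝ (Fin n) →ₗ[ℝ] EuclideanSpace ℝ (Fin n) := fun t =>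
    (mfderiv (𝓡 n) 𝓘(ℝ, EuclideanSpace ℝ (Fin n)) (extChartAt (𝓡 n) (G y)) (G t)).toLinearMap
  let s' : ∀ t, L →ₗ[ℝ] EuclideanSpace ℝ (Fin n) := s
  let ξ' : ∀ t, EuclideanSpace ℝ (Fin n) := ξ
  have hS : ∀ X, ContDiffAt ℝ ∞ (fun t => De t (s' t X)) y := fun X =>
    (contDiffAt_chart_vector (hs X)).1
  have hh : ContDiffAt ℝ ∞ (fun t => De t (ξ' t)) y := (contDiffAt_chart_vector hξ).1
  have hsrc := (contDiffAt_chart_vector hξ).2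
  have hDe : ∀ᶠ t in 𝓝 y, Function.Injective (De t) := by
    filter_upwards [hsrc] with t ht
    exact (isInvertible_mfderiv_extChartAt ht).injective
  have hDey : De y = LinearMap.id := by
    have : mfderiv (𝓡 n) 𝓘(ℝ, EuclideanSpace ℝ (Fin n)) (extChartAt (𝓡 n) (G y)) (G y) =
      ContinuousLinearMap.id ℝ _ := mfderiv_extChartAt_self
    ext1 v
    exact congrArg (fun f : EuclideanSpace ℝ (Fin n) →L[ℝ] EuclideanSpace ℝ (Fin n) => f v) this
  -- One right inverse b at the base point serves for all nearby t: in the chart, s t ∘ b is the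
  -- identity at y and hence invertible near y. Thus b(A⁻¹ξ) is a smooth choice of preimage.
  obtain ⟨b, hb⟩ := (s' y).exists_rightInverse_of_surjective (LinearMap.range_eq_top.2 hsurj)
  let A : EuclideanSpace ℝ (Fin k) → EuclideanSpace ℝ (Fin n) →L[ℝ] EuclideanSpace ℝ (Fin n) :=
    fun t => LinearMap.toContinuousLinearMap (De t ∘ₗ s' t ∘ₗ b)
  have hA : ContDiffAt ℝ ∞ A y := contDiffAt_clm_of_apply fun w => hS (b w)
  have hAy : A y = 1 := by
    ext1 w
    change De y (s' y (b w)) = w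
    rw [hDey]
    exact LinearMap.congr_fun hb w
  have hinv : ContDiffAt ℝ ∞ (fun t => Ring.inverse (A t)) y := by
    have h1 : ContDiffAt ℝ ∞ Ring.inverse (A y) := by
      rw [hAy]
      exact contDiffAt_ringInverse ℝ (1 : (EuclideanSpace ℝ (Fin n) →L[ℝ] EuclideanSpace ℝ (Fin n))ˣ)
    exact h1.comp y hA
  have hunit : ∀ᶠ t in 𝓝 y, IsUnit (A t) := by
    refine hA.continuousAt.preimage_mem_nhds (Units.isOpen.mem_nhds ?_)
    rw [hAy]
    exact isUnit_one
  let ℓ : EuclideanSpace ℝ (Fin n) →L[ℝ] ℝ := LinearMap.toContinuousLinearMap (φ ∘ₗ P ∘ₗ b)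
  have hfin : ContDiffAt ℝ ∞ (fun t => ℓ (Ring.inverse (A t) (De t (ξ' t)))) y :=
    ℓ.contDiff.contDiffAt.comp y (hinv.clm_apply hh)
  refine hfin.congr_of_eventuallyEq ?_
  filter_upwards [hDe, hunit, hc] with t ht hu hct
  have h2 : A t (Ring.inverse (A t) (De t (ξ' t))) = De t (ξ' t) := by
    have := Ring.mul_inverse_cancel (A t) hu
    exact congrArg (fun f : EuclideanSpace ℝ (Fin n) →L[ℝ] EuclideanSpace ℝ (Fin n) =>
      f (De t (ξ' t))) this
  -- The constructed preimage solves the equation in the chart; injectivity of the chart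
  -- differential makes it a solution in the tangent space, and `hct` applies to any solution.
  rw [hct (b (Ring.inverse (A t) (De t (ξ' t)))) (ht h2)]
  rfl

end SmoothCoframe

/-! ### Frames along the projective limit -/

lemma tcast_eq {n : ℕ} {M : Type v} [TopologicalSpace M]
    [ChartedSpace (EuclideanSpace ℝ (Fin n)) M] {x y : M} (h : x = y) (ξ : TangentSpace (𝓡 n) x) :
    (tcast h ξ : EuclideanSpace ℝ (Fin n)) = ξ := by
  subst h; rfl

namespace TowerData

variable {L : Type u} [LieRing L] [LieAlgebra ℝ L]
variable {𝒢 : ℤ → Submodule ℝ L} [GradedLieAlgebra 𝒢]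
variable {d e : ℕ → ℕ}
variable {Q : ℕ → Type v} [∀ n, TopologicalSpace (Q n)]
  [∀ n, ChartedSpace (EuclideanSpace ℝ (Fin (d n))) (Q n)] [∀ n, IsManifold (𝓡 (d n)) ∞ (Q n)]
variable {G : ℕ → Type w} [∀ n, Group (G n)] [∀ n, TopologicalSpace (G n)]
  [∀ n, ChartedSpace (EuclideanSpace ℝ (Fin (e n))) (G n)]

section Pointwise

variable {T : TowerData 𝒢 (d := d) (e := e) Q G} {μ : ℕ}

lemma mem_Fr_congr {n : ℕ} {z z' : Q (n + 1)} (hz : z = z') {q q' : Q n} (h : q = q')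
    {ζ : L →ₗ[ℝ] EuclideanSpace ℝ (Fin (d n))} (hζ : ζ ∈ T.Fr n z q) : ζ ∈ T.Fr n z' q' := by
  subst h; subst hz; exact hζ

lemma mem_filt_congr {n : ℕ} {p : ℤ} {q q' : Q n} (h : q = q')
    {ξ : EuclideanSpace ℝ (Fin (d n))} (hξ : ξ ∈ T.filt n p q) : ξ ∈ T.filt n p q' := by
  subst h; exact hξ

/-- This vanishing is what makes the vectors at level n independent of higher order choices of
frames. -/
lemma filt_eq_bot (hT : T.IsNormal μ) {n : ℕ} {p : ℤ} (h : (n : ℤ) ≤ p) (q : Q n) :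
    T.filt n p q = ⊥ := by
  cases n with
  | zero =>
    have h1 := hT.filtered.anti 0 p q (by simpa using h)
    rw [hT.filtered.bot q] at h1
    exact le_bot_iff.1 h1
  | succ n =>
    rw [filt, if_neg]
    push_cast at h
    omega

lemma eq_zero_of_mem_filt (hT : T.IsNormal μ) {n : ℕ} {p : ℤ} (h : (n : ℤ) ≤ p) {q : Q n}
    {ξ : EuclideanSpace ℝ (Fin (d n))} (hξ : ξ ∈ T.filt n p q) : ξ = 0 := by
  have h1 : ξ ∈ (⊥ : Submodule ℝ (TangentSpace (𝓡 (d n)) q)) := filt_eq_bot hT h q ▸ hξ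
  exact (Submodule.mem_bot ℝ).1 h1

lemma IsFilteredIso.eq_zero_iff {n : ℕ} {q : Q n} {ζ : L →ₗ[ℝ] EuclideanSpace ℝ (Fin (d n))}
    (h : T.IsFilteredIso n q ζ) {X : L} : ζ X = 0 ↔ X ∈ algFilt 𝒢 (n : ℤ) := by
  rw [← h.ker]
  exact (LinearMap.mem_ker (f := ζ)).symm

lemma mfderiv_π_mem_filt {n : ℕ} {p : ℤ} {q : Q (n + 1)} {ξ : TangentSpace (𝓡 (d (n + 1))) q}
    (h : ξ ∈ T.filt (n + 1) p q) :
    mfderiv (𝓡 (d (n + 1))) (𝓡 (d n)) (T.π n) q ξ ∈ T.filt n p (T.π n q) := by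
  rw [filt] at h
  split_ifs at h with hp
  · exact h
  · rw [Submodule.mem_bot] at h
    rw [h, map_zero]
    exact Submodule.zero_mem _

/-- The differential of `Q (n + 1) → Q n` at a point of the limit. -/
def dpi (z : T.Limit) (n : ℕ) :
    EuclideanSpace ℝ (Fin (d (n + 1))) →ₗ[ℝ] EuclideanSpace ℝ (Fin (d n)) :=
  (mfderiv (𝓡 (d (n + 1))) (𝓡 (d n)) (T.π n) (z.1 (n + 1))).toLinearMap

/-- The differential of `Q (n + j) → Q n` at a point of the limit, as a linear map. -/
def pushL (z : T.Limit) (n : ℕ) :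
    ∀ j : ℕ, EuclideanSpace ℝ (Fin (d (n + j))) →ₗ[ℝ] EuclideanSpace ℝ (Fin (d n))
  | 0 => LinearMap.id
  | j + 1 => pushL z n j ∘ₗ dpi z (n + j)

lemma push_eq_pushL (z : T.Limit) (n j : ℕ) (ξ : EuclideanSpace ℝ (Fin (d (n + j)))) :
    push z n j ξ = pushL z n j ξ := by
  induction j with
  | zero => rfl
  | succ j ih =>
    refine (ih _).trans ?_
    exact congrArg (pushL z n j) (tcast_eq _ _)

lemma dpi_mem_filt (z : T.Limit) {n : ℕ} {p : ℤ} {ξ : EuclideanSpace ℝ (Fin (d (n + 1)))}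
    (h : ξ ∈ T.filt (n + 1) p (z.1 (n + 1))) : dpi z n ξ ∈ T.filt n p (z.1 n) :=
  mem_filt_congr (z.2 n) (mfderiv_π_mem_filt h)

lemma pushL_mem_filt (z : T.Limit) {n j : ℕ} {p : ℤ} {ξ : EuclideanSpace ℝ (Fin (d (n + j)))}
    (h : ξ ∈ T.filt (n + j) p (z.1 (n + j))) : pushL z n j ξ ∈ T.filt n p (z.1 n) := by
  induction j with
  | zero => exact h
  | succ j ih => exact ih (dpi_mem_filt z h)

lemma dpi_comp_mem_Fr (hT : T.IsNormal μ) (z : T.Limit) {n : ℕ}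
    {ζ : L →ₗ[ℝ] EuclideanSpace ℝ (Fin (d (n + 1)))}
    (h : ζ ∈ T.Fr (n + 1) (z.1 (n + 1 + 1)) (z.1 (n + 1))) :
    dpi z n ∘ₗ ζ ∈ T.Fr n (z.1 (n + 1)) (z.1 n) :=
  mem_Fr_congr rfl (z.2 n) ((hT.subbundle (n + 1)).univ _ _ ζ h).2.2

lemma frame_isFilteredIso (hT : T.IsNormal μ) {n : ℕ} {z : Q (n + 1)} {q : Q n}
    {ζ : L →ₗ[ℝ] EuclideanSpace ℝ (Fin (d n))} (h : ζ ∈ T.Fr n z q) : T.IsFilteredIso n q ζ := by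
  have := (hT.subbundle n).univ _ _ ζ h
  cases n with
  | zero => exact this.1
  | succ n => exact this.1

lemma frame_sub_mem_filt (hT : T.IsNormal μ) {n : ℕ} {z : Q (n + 1)} {q : Q n}
    {ζ ζ' : L →ₗ[ℝ] EuclideanSpace ℝ (Fin (d n))} (h : ζ ∈ T.Fr n z q) (h' : ζ' ∈ T.Fr n z q)
    {p : ℤ} {X : L} (hX : X ∈ 𝒢 p) :
    (ζ' X - ζ X : EuclideanSpace ℝ (Fin (d n))) ∈ T.filt n (p + n + 1) q :=
  (((hT.subbundle n).frame_class z q ζ h ζ' ((hT.subbundle n).univ _ _ ζ' h')).1 h') p X hX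

/-- Projecting a frame in the class at level N gives a frame in the class at each lower level. Such
a compatible family computes all vectors of the parallelism up to level N − μ at once. -/
lemma exists_frame_family (hT : T.IsNormal μ) (z : T.Limit) (N : ℕ)
    (ζ : L →ₗ[ℝ] EuclideanSpace ℝ (Fin (d N))) (hζ : ζ ∈ T.Fr N (z.1 (N + 1)) (z.1 N)) :
    ∃ f : ∀ m, L →ₗ[ℝ] EuclideanSpace ℝ (Fin (d m)), f N = ζ ∧
      (∀ m ≤ N, f m ∈ T.Fr m (z.1 (m + 1)) (z.1 m)) ∧
      ∀ m < N, dpi z m ∘ₗ f (m + 1) = f m := by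
  induction N with
  | zero =>
    refine ⟨Function.update 0 0 ζ, by simp, fun m hm => ?_, fun m hm => by omega⟩
    obtain rfl : m = 0 := by omega
    simpa using hζ
  | succ N ih =>
    obtain ⟨f, hf1, hf2, hf3⟩ := ih _ (dpi_comp_mem_Fr hT z hζ)
    have hne : ∀ m ≤ N, Function.update f (N + 1) ζ m = f m := fun m hm =>
      Function.update_of_ne (by omega) _ _
    refine ⟨Function.update f (N + 1) ζ, by simp, fun m hm => ?_, fun m hm => ?_⟩
    · rcases Nat.lt_or_ge m (N + 1) with h | h
      · rw [hne m (by omega)]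
        exact hf2 m (by omega)
      · obtain rfl : m = N + 1 := by omega
        simpa using hζ
    · rw [hne m (by omega)]
      rcases Nat.lt_or_ge m N with h | h
      · rw [hne (m + 1) (by omega)]
        exact hf3 m h
      · obtain rfl : m = N := by omega
        simp [hf1]

lemma pushL_comp_family (z : T.Limit) {N : ℕ} {f : ∀ m, L →ₗ[ℝ] EuclideanSpace ℝ (Fin (d m))}
    (hf : ∀ m < N, dpi z m ∘ₗ f (m + 1) = f m) (n : ℕ) :
    ∀ j, n + j ≤ N → pushL z n j ∘ₗ f (n + j) = f n
  | 0, _ => rfl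
  | j + 1, h => by
    rw [pushL, LinearMap.comp_assoc]
    refine Eq.trans ?_ (pushL_comp_family z hf n j (by omega))
    congr 1
    exact hf (n + j) (by omega)

variable (μ) in
/-- `X ↦ vec μ z n X` as a linear map. -/
def vecL (z : T.Limit) (n : ℕ) : L →ₗ[ℝ] EuclideanSpace ℝ (Fin (d n)) :=
  pushL z n μ ∘ₗ (Classical.epsilon fun ζ => ζ ∈ T.Fr (n + μ) (z.1 (n + μ + 1)) (z.1 (n + μ)))

lemma vec_eq_vecL (z : T.Limit) (n : ℕ) (X : L) : vec μ z n X = vecL μ z n X :=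
  push_eq_pushL _ _ _ _

lemma exists_mem_Fr (hT : T.IsNormal μ) (z : T.Limit) (n : ℕ) :
    ∃ ζ : L →ₗ[ℝ] EuclideanSpace ℝ (Fin (d n)), ζ ∈ T.Fr n (z.1 (n + 1)) (z.1 n) := by
  obtain ⟨ζ, hζ⟩ := (hT.subbundle n).nonempty (z.1 (n + 1))
  exact ⟨ζ, mem_Fr_congr rfl (z.2 n) hζ⟩

/-- Two frames in the class at level n + μ differ on 𝔤_p by F^{p+n+μ+1}. Since p ≥ −μ this lies in
F^{n+1}, which is zero in the tangent space of `Q n`. Hence the choice made in `vecL` is immaterial.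
-/
lemma vecL_eq_pushL (h𝒢 : IsTransitive 𝒢 μ) (hT : T.IsNormal μ) (z : T.Limit) (n : ℕ)
    {ζ : L →ₗ[ℝ] EuclideanSpace ℝ (Fin (d (n + μ)))}
    (hζ : ζ ∈ T.Fr (n + μ) (z.1 (n + μ + 1)) (z.1 (n + μ))) :
    vecL μ z n = pushL z n μ ∘ₗ ζ := by
  have hε : (Classical.epsilon fun ζ => ζ ∈ T.Fr (n + μ) (z.1 (n + μ + 1)) (z.1 (n + μ))) ∈
      T.Fr (n + μ) (z.1 (n + μ + 1)) (z.1 (n + μ)) := Classical.epsilon_spec ⟨ζ, hζ⟩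
  refine linearMap_ext_graded 𝒢 fun p X hX => ?_
  by_cases hp : p < -(μ : ℤ)
  · rw [h𝒢.depth p hp, Submodule.mem_bot] at hX
    rw [hX, map_zero, map_zero]
  · have h1 := pushL_mem_filt z (frame_sub_mem_filt hT hζ hε hX)
    have h2 := eq_zero_of_mem_filt hT (by push_cast; omega) h1
    rw [map_sub] at h2
    exact sub_eq_zero.1 h2

lemma vecL_eq_family (h𝒢 : IsTransitive 𝒢 μ) (hT : T.IsNormal μ) (z : T.Limit) {N n : ℕ}
    {f : ∀ m, L →ₗ[ℝ] EuclideanSpace ℝ (Fin (d m))}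
    (hf2 : ∀ m ≤ N, f m ∈ T.Fr m (z.1 (m + 1)) (z.1 m))
    (hf3 : ∀ m < N, dpi z m ∘ₗ f (m + 1) = f m) (hn : n + μ ≤ N) : vecL μ z n = f n := by
  rw [vecL_eq_pushL h𝒢 hT z n (hf2 (n + μ) hn), pushL_comp_family z hf3 n μ hn]

/-- The canonical vectors form a representative of the class which the point of level n + 1 defines
at level n, so all axioms about frames apply to them. -/
lemma vecL_mem_Fr (h𝒢 : IsTransitive 𝒢 μ) (hT : T.IsNormal μ) (z : T.Limit) (n : ℕ) :
    vecL μ z n ∈ T.Fr n (z.1 (n + 1)) (z.1 n) := by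
  obtain ⟨ζ, hζ⟩ := exists_mem_Fr hT z (n + μ)
  obtain ⟨f, -, hf2, hf3⟩ := exists_frame_family hT z _ ζ hζ
  rw [vecL_eq_family h𝒢 hT z hf2 hf3 le_rfl]
  exact hf2 n (by omega)

/-- Both sides are read off from the same compatible family of frames. -/
lemma dpi_vecL (h𝒢 : IsTransitive 𝒢 μ) (hT : T.IsNormal μ) (z : T.Limit) (n : ℕ) (X : L) :
    dpi z n (vecL μ z (n + 1) X) = vecL μ z n X := by
  obtain ⟨ζ, hζ⟩ := exists_mem_Fr hT z (n + 1 + μ)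
  obtain ⟨f, -, hf2, hf3⟩ := exists_frame_family hT z _ ζ hζ
  rw [vecL_eq_family h𝒢 hT z hf2 hf3 le_rfl, vecL_eq_family h𝒢 hT z hf2 hf3 (n := n) (by omega)]
  exact LinearMap.congr_fun (hf3 n (by omega)) X

lemma vecL_isFilteredIso (h𝒢 : IsTransitive 𝒢 μ) (hT : T.IsNormal μ) (z : T.Limit) (n : ℕ) :
    T.IsFilteredIso n (z.1 n) (vecL μ z n) :=
  frame_isFilteredIso hT (vecL_mem_Fr h𝒢 hT z n)

lemma vecL_surjective (h𝒢 : IsTransitive 𝒢 μ) (hT : T.IsNormal μ) (z : T.Limit) (n : ℕ) :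
    Function.Surjective (vecL μ z n) :=
  (vecL_isFilteredIso h𝒢 hT z n).surj

lemma vecL_eq_zero_iff (h𝒢 : IsTransitive 𝒢 μ) (hT : T.IsNormal μ) (z : T.Limit) {n : ℕ} {X : L} :
    vecL μ z n X = 0 ↔ X ∈ algFilt 𝒢 (n : ℤ) :=
  (vecL_isFilteredIso h𝒢 hT z n).eq_zero_iff

lemma vecL_eq_iff (h𝒢 : IsTransitive 𝒢 μ) (hT : T.IsNormal μ) (z : T.Limit) {n : ℕ} {X Y : L} :
    vecL μ z n X = vecL μ z n Y ↔ X - Y ∈ algFilt 𝒢 (n : ℤ) := by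
  rw [← vecL_eq_zero_iff h𝒢 hT z, map_sub, sub_eq_zero]

lemma vecL_isFund (h𝒢 : IsTransitive 𝒢 μ) (hT : T.IsNormal μ) (z : T.Limit) (n : ℕ)
    (A : 𝒢 (n : ℤ)) : T.IsFund n A (z.1 (n + 1)) (vecL μ z (n + 1) A) :=
  ((hT.subbundle (n + 1)).univ _ _ _ (vecL_mem_Fr h𝒢 hT z (n + 1))).2.1 A

lemma limit_eq_of_le {z z' : T.Limit} {m : ℕ} (h : z.1 m = z'.1 m) : ∀ n ≤ m, z.1 n = z'.1 n := by
  intro n hn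
  induction hn using Nat.decreasingInduction with
  | self => exact h
  | of_succ k _ ih => rw [← z.2 k, ← z'.2 k, ih]

lemma dpi_congr {z z' : T.Limit} {n : ℕ} (h : z.1 (n + 1) = z'.1 (n + 1)) :
    dpi z n = dpi z' n := by
  rw [dpi, dpi]
  generalize z.1 (n + 1) = a at h
  subst h
  rfl

lemma pushL_congr {z z' : T.Limit} {n : ℕ} : ∀ {j : ℕ}, z.1 (n + j) = z'.1 (n + j) →
    pushL z n j = pushL z' n j
  | 0, _ => rfl
  | j + 1, h => by
    rw [pushL, pushL, dpi_congr (n := n + j) h,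
      pushL_congr (limit_eq_of_le (m := n + (j + 1)) h _ (by omega))]

/-- The vectors at level n use a frame at level n + μ, whose class is a point of level n + μ + 1. -/
lemma vecL_congr (h𝒢 : IsTransitive 𝒢 μ) (hT : T.IsNormal μ) {z z' : T.Limit} {n : ℕ}
    (h : z.1 (n + μ + 1) = z'.1 (n + μ + 1)) : vecL μ z n = vecL μ z' n := by
  obtain ⟨ζ, hζ⟩ := exists_mem_Fr hT z (n + μ)
  have h1 : z.1 (n + μ) = z'.1 (n + μ) := limit_eq_of_le h _ (by omega)
  rw [vecL_eq_pushL h𝒢 hT z n hζ, vecL_eq_pushL h𝒢 hT z' n (mem_Fr_congr h h1 hζ),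
    pushL_congr h1]

lemma π_surjective (hT : T.IsNormal μ) (n : ℕ) (q : Q n) : ∃ z, T.π n z = q := by
  obtain ⟨U, s, c, -, hq, -, -, hs, -⟩ := (hT.subbundle n).principal.locally_trivial q
  exact ⟨s q, hs q hq⟩

/-- The projections of the limit are surjective. -/
lemma exists_limit (hT : T.IsNormal μ) (N : ℕ) (q : Q N) : ∃ z : T.Limit, z.1 N = q := by
  have h1 : ∃ y : ∀ n, Q n, y N = q ∧ ∀ n < N, T.π n (y (n + 1)) = y n := by
    induction N with
    | zero =>
      exact ⟨fun n => Nat.rec q (fun k x => (π_surjective hT k x).choose) n, rfl,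
        fun n hn => by omega⟩
    | succ N ih =>
      obtain ⟨y, hy1, hy2⟩ := ih (T.π N q)
      have hne : ∀ m ≤ N, Function.update y (N + 1) q m = y m := fun m hm =>
        Function.update_of_ne (by omega) _ _
      refine ⟨Function.update y (N + 1) q, by simp, fun n hn => ?_⟩
      rw [hne n (by omega)]
      rcases Nat.lt_or_ge n N with h | h
      · rw [hne (n + 1) (by omega)]
        exact hy2 n h
      · obtain rfl : n = N := by omega
        simp [hy1]
  obtain ⟨y, hy1, hy2⟩ := h1
  -- A choice of preimages that follows y whenever possible makes the recursively built sequence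
  -- agree with y up to level N and continue compatibly above it.
  have h2 : ∀ (k : ℕ) (x : Q k), ∃ x', T.π k x' = x ∧ (T.π k (y (k + 1)) = x → x' = y (k + 1)) := by
    intro k x
    by_cases h : T.π k (y (k + 1)) = x
    · exact ⟨y (k + 1), h, fun _ => rfl⟩
    · obtain ⟨x', hx'⟩ := π_surjective hT k x
      exact ⟨x', hx', fun h' => absurd h' h⟩
  choose step hstep hstep' using h2
  let x : ∀ n, Q n := fun n => Nat.rec (y 0) step n
  have hxN : ∀ n ≤ N, x n = y n := by
    intro n
    induction n with
    | zero => intro _; rfl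
    | succ n ih =>
      intro hn
      refine hstep' n (x n) ?_
      rw [ih (by omega), hy2 n (by omega)]
  exact ⟨⟨x, fun n => hstep n (x n)⟩, (hxN N le_rfl).trans hy1⟩

/-- Components of low degree do not depend on the choice of a frame in its class. -/
lemma comp_eq_of_frames (h𝒢 : IsTransitive 𝒢 μ) (hT : T.IsNormal μ) {m : ℕ} {c : ℤ}
    (hcm : c + μ ≤ m) (hc : c < m) {z : Q (m + 1)} {q : Q m}
    {ζ ζ' : L →ₗ[ℝ] EuclideanSpace ℝ (Fin (d m))} (hζ : ζ ∈ T.Fr m z q) (hζ' : ζ' ∈ T.Fr m z q)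
    {X Y : L} (h : ζ Y = ζ' X) : comp 𝒢 c Y = comp 𝒢 c X := by
  have hiso := frame_isFilteredIso hT hζ
  -- The difference of the frames has order m + 1 + p on 𝔤_p and p ≥ −μ, so it comes from degrees ≥
  -- m + 1 − μ. These exceed c because c + μ ≤ m.
  have key : ∀ X, ∃ R ∈ algFilt 𝒢 ((m : ℤ) + 1 - μ), ζ R = ζ' X - ζ X := by
    intro X
    induction X using DirectSum.Decomposition.inductionOn 𝒢 with
    | zero => exact ⟨0, Submodule.zero_mem _, by simp⟩
    | @homogeneous p X =>
      by_cases hp : p < -(μ : ℤ)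
      · have : (X : L) = 0 := by
          have := (h𝒢.depth p hp).le X.2
          rwa [Submodule.mem_bot] at this
        exact ⟨0, Submodule.zero_mem _, by simp [this]⟩
      · have h3 := frame_sub_mem_filt hT hζ hζ' X.2
        rw [← hiso.filt] at h3
        obtain ⟨R, hR, hR'⟩ := h3
        exact ⟨R, algFilt_anti 𝒢 (by omega) hR, hR'⟩
    | add m m' h1 h2 =>
      obtain ⟨R1, hR1, hR1'⟩ := h1
      obtain ⟨R2, hR2, hR2'⟩ := h2
      refine ⟨R1 + R2, Submodule.add_mem _ hR1 hR2, ?_⟩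
      rw [map_add, hR1', hR2', map_add, map_add]
      abel
  obtain ⟨R, hR, hR'⟩ := key X
  have h3 : Y - X - R ∈ algFilt 𝒢 (m : ℤ) := by
    rw [← hiso.eq_zero_iff (ζ := ζ), map_sub, map_sub, hR', h, sub_self]
  have h4 := mem_algFilt.1 h3 c hc
  have h5 := mem_algFilt.1 hR c (by omega)
  rw [map_sub, map_sub, h5, sub_zero, sub_eq_zero] at h4
  exact h4

/-- Frees θ_c from the arbitrary representative and preimage in its definition: any frame in the
class and any preimage give the same value. -/
lemma theta_eq_of_frame (h𝒢 : IsTransitive 𝒢 μ) (hT : T.IsNormal μ) {m : ℕ} {c : ℤ}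
    (hcm : c + μ ≤ m) (hc : c < m) {z : Q (m + 1)}
    {ζ : L →ₗ[ℝ] EuclideanSpace ℝ (Fin (d m))} (hζ : ζ ∈ T.Fr m z (T.π m z))
    {ξ : EuclideanSpace ℝ (Fin (d (m + 1)))} {X : L}
    (h : ζ X = mfderiv (𝓡 (d (m + 1))) (𝓡 (d m)) (T.π m) z ξ) : T.theta c m z ξ = comp 𝒢 c X := by
  let ζ' : L →ₗ[ℝ] EuclideanSpace ℝ (Fin (d m)) :=
    Classical.epsilon fun ζ => ζ ∈ T.Fr m z (T.π m z)
  have hζ' : ζ' ∈ T.Fr m z (T.π m z) := Classical.epsilon_spec ((hT.subbundle m).nonempty z)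
  have h0 : ∃ Y, ζ' Y = mfderiv (𝓡 (d (m + 1))) (𝓡 (d m)) (T.π m) z ξ :=
    (frame_isFilteredIso hT hζ').surj _
  exact comp_eq_of_frames h𝒢 hT hcm hc hζ' hζ ((Classical.epsilon_spec h0).trans h.symm)

/-- The value of the canonical form on the vectors of the absolute parallelism. -/
lemma theta_vecL (h𝒢 : IsTransitive 𝒢 μ) (hT : T.IsNormal μ) (z : T.Limit) {m : ℕ} {c : ℤ}
    (hcm : c + μ ≤ m) (hc : c < m) (X : L) :
    T.theta c m (z.1 (m + 1)) (vecL μ z (m + 1) X) = comp 𝒢 c X :=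
  theta_eq_of_frame h𝒢 hT hcm hc (mem_Fr_congr rfl (z.2 m).symm (vecL_mem_Fr h𝒢 hT z m))
    (dpi_vecL h𝒢 hT z m X).symm

/-- The definition by choice is not visibly linear. Every tangent vector is a vector of the
parallelism at some point of the limit, and on these θ_c is the projection to 𝔤_c. -/
lemma theta_isLinearMap (h𝒢 : IsTransitive 𝒢 μ) (hT : T.IsNormal μ) {m : ℕ} {c : ℤ}
    (hcm : c + μ ≤ m) (hc : c < m) (q : Q (m + 1)) : IsLinearMap ℝ (T.theta c m q) := by
  obtain ⟨z, rfl⟩ := exists_limit hT (m + 1) q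
  have hs := vecL_surjective h𝒢 hT z (m + 1)
  constructor
  · intro ξ η
    obtain ⟨X, hX⟩ := hs ξ
    obtain ⟨Y, hY⟩ := hs η
    rw [← hX, ← hY]
    refine (congrArg (T.theta c m (z.1 (m + 1))) (map_add (vecL μ z (m + 1)) X Y).symm).trans ?_
    rw [theta_vecL h𝒢 hT z hcm hc, theta_vecL h𝒢 hT z hcm hc, theta_vecL h𝒢 hT z hcm hc, map_add]
  · intro t ξ
    obtain ⟨X, hX⟩ := hs ξ
    rw [← hX]
    refine (congrArg (T.theta c m (z.1 (m + 1))) (map_smul (vecL μ z (m + 1)) t X).symm).trans ?_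
    rw [theta_vecL h𝒢 hT z hcm hc, theta_vecL h𝒢 hT z hcm hc, map_smul]

lemma theta_mem (c : ℤ) (m : ℕ) (q : Q (m + 1)) (ξ : TangentSpace (𝓡 (d (m + 1))) q) :
    T.theta c m q ξ ∈ 𝒢 c :=
  comp_mem 𝒢 c _

/-- In degrees ≥ 0 the component is the Lie algebra of a finite dimensional group of the tower; in
negative degrees this is part of the hypotheses on 𝔤. -/
lemma finiteDimensional_grade (h𝒢 : IsTransitive 𝒢 μ) (T : TowerData 𝒢 (d := d) (e := e) Q G)
    (c : ℤ) : FiniteDimensional ℝ (𝒢 c) := by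
  rcases lt_or_ge c 0 with h | h
  · exact h𝒢.finite c h
  · obtain ⟨n, rfl⟩ := Int.eq_ofNat_of_zero_le h
    have : FiniteDimensional ℝ (TangentSpace (𝓡 (e n)) (1 : G n)) :=
      inferInstanceAs (FiniteDimensional ℝ (EuclideanSpace ℝ (Fin (e n))))
    exact LinearEquiv.finiteDimensional (T.lie n).symm

end Pointwise

end TowerData

/-! ### Smoothness of velocities and of functions read in a chart. -/

section Velocity

open Topology

variable {n k : ℕ} {M : Type v} [TopologicalSpace M] [ChartedSpace (EuclideanSpace ℝ (Fin n)) M]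
variable [IsManifold (𝓡 n) ∞ M]

/-- The velocity of a smooth map along a constant vector field is smooth. -/
lemma contMDiffAt_velocity {F : EuclideanSpace ℝ (Fin k) → M} {y : EuclideanSpace ℝ (Fin k)}
    (hF : ∀ᶠ t in 𝓝 y, ContMDiffAt 𝓘(ℝ, EuclideanSpace ℝ (Fin k)) (𝓡 n) ∞ F t)
    (w : EuclideanSpace ℝ (Fin k)) :
    ContMDiffAt 𝓘(ℝ, EuclideanSpace ℝ (Fin k)) (𝓡 n).tangent ∞
      (fun t => (⟨F t, mfderiv 𝓘(ℝ, EuclideanSpace ℝ (Fin k)) (𝓡 n) F t w⟩ :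
        TangentBundle (𝓡 n) M)) y := by
  refine (Bundle.contMDiffAt_totalSpace).2 ⟨hF.self_of_nhds, ?_⟩
  have hx : F y ∈ (extChartAt (𝓡 n) (F y)).source := mem_extChartAt_source _
  have h1 : ContDiffAt ℝ ∞ (fun t => extChartAt (𝓡 n) (F y) (F t)) y := by
    have : ContMDiffAt 𝓘(ℝ, EuclideanSpace ℝ (Fin k)) 𝓘(ℝ, EuclideanSpace ℝ (Fin n)) ∞
        (fun t => extChartAt (𝓡 n) (F y) (F t)) y :=
      (contMDiffAt_extChartAt (x := F y)).comp y hF.self_of_nhds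
    exact this.contDiffAt
  have h2 : ContDiffAt ℝ ∞ (fun t => fderiv ℝ (fun t => extChartAt (𝓡 n) (F y) (F t)) t w) y :=
    (h1.fderiv_right (m := ∞) (by simp)).clm_apply contDiffAt_const
  refine (h2.congr_of_eventuallyEq ?_).contMDiffAt
  filter_upwards [eventually_contMDiffAt hF (F y) hx] with t ht
  have ht' : F t ∈ (chartAt (EuclideanSpace ℝ (Fin n)) (F y)).source := by
    rw [← extChartAt_source (𝓡 n)]; exact ht.2
  have h3 : mfderiv 𝓘(ℝ, EuclideanSpace ℝ (Fin k)) 𝓘(ℝ, EuclideanSpace ℝ (Fin n))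
      (fun t => extChartAt (𝓡 n) (F y) (F t)) t =
      (mfderiv (𝓡 n) 𝓘(ℝ, EuclideanSpace ℝ (Fin n)) (extChartAt (𝓡 n) (F y)) (F t)).comp
      (mfderiv 𝓘(ℝ, EuclideanSpace ℝ (Fin k)) (𝓡 n) F t) :=
    mfderiv_comp t (mdifferentiableAt_extChartAt ht')
      (ht.1.mdifferentiableAt (by simp))
  rw [← mfderiv_eq_fderiv, h3, ← TangentBundle.continuousLinearMapAt_trivializationAt ht']
  exact ((trivializationAt (EuclideanSpace ℝ (Fin n)) (TangentSpace (𝓡 n))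
    (F y)).continuousLinearMapAt_apply_of_mem (R := ℝ) (by simpa using ht') _).symm

lemma tangentBundle_mk_congr {q q' : M} (h : q = q') {ξ ξ' : EuclideanSpace ℝ (Fin n)}
    (h' : ξ = ξ') : (⟨q, ξ⟩ : TangentBundle (𝓡 n) M) = ⟨q', ξ'⟩ := by
  subst h; subst h'; rfl

lemma contMDiffAt_of_chart {f : M → ℝ} (q : M)
    (h : ContDiffAt ℝ ∞ (fun t => f ((extChartAt (𝓡 n) q).symm t)) (extChartAt (𝓡 n) q q)) :
    ContMDiffAt (𝓡 n) 𝓘(ℝ, ℝ) ∞ f q := by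
  have h1 : ContMDiffAt (𝓡 n) 𝓘(ℝ, ℝ) ∞
      ((fun t => f ((extChartAt (𝓡 n) q).symm t)) ∘ (extChartAt (𝓡 n) q)) q :=
    h.contMDiffAt.comp q contMDiffAt_extChartAt
  refine h1.congr_of_eventuallyEq ?_
  filter_upwards [extChartAt_source_mem_nhds (I := 𝓡 n) q] with x hx
  exact congrArg f ((extChartAt (𝓡 n) q).left_inv hx).symm

end Velocity

namespace TowerData

variable {L : Type u} [LieRing L] [LieAlgebra ℝ L]
variable {𝒢 : ℤ → Submodule ℝ L} [GradedLieAlgebra 𝒢]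
variable {d e : ℕ → ℕ}
variable {Q : ℕ → Type v} [∀ n, TopologicalSpace (Q n)]
  [∀ n, ChartedSpace (EuclideanSpace ℝ (Fin (d n))) (Q n)] [∀ n, IsManifold (𝓡 (d n)) ∞ (Q n)]
variable {G : ℕ → Type w} [∀ n, Group (G n)] [∀ n, TopologicalSpace (G n)]
  [∀ n, ChartedSpace (EuclideanSpace ℝ (Fin (e n))) (G n)]

/-! ### Smoothness of the canonical form, and a finite dimensional model of the limit. -/

section SmoothStructure

open Topology

variable {T : TowerData 𝒢 (d := d) (e := e) Q G} {μ : ℕ}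

/-- The `𝔤_c`-component of the canonical form as a family of linear maps. -/
def thetaL (h𝒢 : IsTransitive 𝒢 μ) (hT : T.IsNormal μ) {m : ℕ} {c : ℤ}
    (hcm : c + μ ≤ m) (hc : c < m) (q : Q (m + 1)) : TangentSpace (𝓡 (d (m + 1))) q →ₗ[ℝ] L :=
  (theta_isLinearMap h𝒢 hT hcm hc q).mk' _

/-- Locally there is a smooth family of frames in the classes, and θ_c may be computed with any
frame. `contDiffAt_coframe` then applies to the projection of a constant vector field in the chart.
-/
lemma thetaL_smooth (h𝒢 : IsTransitive 𝒢 μ) (hT : T.IsNormal μ) {m : ℕ} {c : ℤ}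
    (hcm : c + μ ≤ m) (hc : c < m) (φ : Module.Dual ℝ L) (q : Q (m + 1)) :
    SmoothFormAt (fun q => φ ∘ₗ thetaL h𝒢 hT hcm hc q) q := by
  refine contDiffAt_clm_of_apply fun w => ?_
  set e := extChartAt (𝓡 (d (m + 1))) q
  have hq : e.symm (e q) = q := e.left_inv (mem_extChartAt_source q)
  have hsymm : ∀ᶠ t in 𝓝 (e q), ContMDiffAt 𝓘(ℝ, EuclideanSpace ℝ (Fin (d (m + 1))))
      (𝓡 (d (m + 1))) ∞ e.symm t := by
    filter_upwards [extChartAt_target_mem_nhds (I := 𝓡 (d (m + 1))) q] with t ht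
    exact contMDiffAt_extChartAt_symm ht
  have hπ : ContMDiff (𝓡 (d (m + 1))) (𝓡 (d m)) ∞ (T.π m) := (hT.subbundle m).principal.smooth_π
  obtain ⟨U, s, hU, hqU, hs1, hs2⟩ := (hT.subbundle m).smooth_frame q
  have hUe : ∀ᶠ t in 𝓝 (e q), e.symm t ∈ U :=
    hsymm.self_of_nhds.continuousAt.preimage_mem_nhds (hU.mem_nhds (by rwa [hq]))
  have hG : ∀ᶠ t in 𝓝 (e q), ContMDiffAt 𝓘(ℝ, EuclideanSpace ℝ (Fin (d (m + 1))))
      (𝓡 (d m)) ∞ (fun t => T.π m (e.symm t)) t := by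
    filter_upwards [hsymm] with t ht
    exact hπ.contMDiffAt.comp t ht
  refine contDiffAt_coframe (n := d m) (G := fun t => T.π m (e.symm t)) (s := fun t => s (e.symm t))
    (ξ := fun t => mfderiv 𝓘(ℝ, EuclideanSpace ℝ (Fin (d (m + 1)))) (𝓡 (d m))
      (fun t => T.π m (e.symm t)) t w) (fun X => ?_) (contMDiffAt_velocity hG w) ?_
    (comp 𝒢 c) ?_ φ
  · have h1 : ContMDiffAt (𝓡 (d (m + 1))) (𝓡 (d m)).tangent ∞
        (fun z => (⟨T.π m z, s z X⟩ : TangentBundle (𝓡 (d m)) (Q m))) (e.symm (e q)) := by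
      rw [hq]
      exact (hs2 X).contMDiffAt (hU.mem_nhds hqU)
    exact h1.comp (e q) hsymm.self_of_nhds
  · exact (frame_isFilteredIso hT (hs1 _ hUe.self_of_nhds)).surj
  · filter_upwards [hUe, hsymm] with t htU ht X hX
    refine theta_eq_of_frame h𝒢 hT hcm hc (hs1 _ htU) (hX.trans ?_)
    have h2 : mfderiv 𝓘(ℝ, EuclideanSpace ℝ (Fin (d (m + 1)))) (𝓡 (d m))
        (fun t => T.π m (e.symm t)) t =
        (mfderiv (𝓡 (d (m + 1))) (𝓡 (d m)) (T.π m) (e.symm t)).comp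
        (mfderiv 𝓘(ℝ, EuclideanSpace ℝ (Fin (d (m + 1)))) (𝓡 (d (m + 1))) e.symm t) :=
      mfderiv_comp t (hπ.contMDiffAt.mdifferentiableAt (by simp)) (ht.mdifferentiableAt (by simp))
    rw [h2]
    rfl

open Classical in
/-- A section of the projection of the limit onto `Q N`, through a given point. -/
def lift (hT : T.IsNormal μ) (p : T.Limit) (N : ℕ) (q : Q N) : T.Limit :=
  if q = p.1 N then p else (exists_limit hT N q).choose

lemma lift_apply (hT : T.IsNormal μ) (p : T.Limit) (N : ℕ) (q : Q N) :
    (lift hT p N q).1 N = q := by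
  rw [lift]
  split_ifs with h
  · exact h.symm
  · exact (exists_limit hT N q).choose_spec

lemma lift_self (hT : T.IsNormal μ) (p : T.Limit) (N : ℕ) : lift hT p N (p.1 N) = p := by
  rw [lift, if_pos rfl]

/-- The lift itself is a mere choice without continuity, but its components at levels ≤ N are
forced: they are composites of the projections. Only these components are ever differentiated. -/
lemma contMDiff_lift (hT : T.IsNormal μ) (p : T.Limit) {N n : ℕ} (hn : n ≤ N) :
    ContMDiff (𝓡 (d N)) (𝓡 (d n)) ∞ (fun q => (lift hT p N q).1 n) := by
  induction hn using Nat.decreasingInduction with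
  | self => simpa only [lift_apply] using! contMDiff_id
  | of_succ k _ ih =>
    have h := (hT.subbundle k).principal.smooth_π.comp ih
    have h2 : (T.π k ∘ fun q => (lift hT p N q).1 (k + 1)) = fun q => (lift hT p N q).1 k :=
      funext fun q => (lift hT p N q).2 k
    rwa [h2] at h

/-- The point of the limit over the point with coordinates `y` in the chart around `p.1 N`. -/
def locZ (hT : T.IsNormal μ) (p : T.Limit) (N : ℕ) (y : EuclideanSpace ℝ (Fin (d N))) : T.Limit :=
  lift hT p N ((extChartAt (𝓡 (d N)) (p.1 N)).symm y)

/-- The coordinates of `p.1 N`. -/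
def locBase (p : T.Limit) (N : ℕ) : EuclideanSpace ℝ (Fin (d N)) :=
  extChartAt (𝓡 (d N)) (p.1 N) (p.1 N)

/-- The differential of `y ↦ (locZ y).1 k`. -/
def locD (hT : T.IsNormal μ) (p : T.Limit) (N k : ℕ) (y : EuclideanSpace ℝ (Fin (d N))) :
    EuclideanSpace ℝ (Fin (d N)) →ₗ[ℝ] EuclideanSpace ℝ (Fin (d k)) :=
  (mfderiv 𝓘(ℝ, EuclideanSpace ℝ (Fin (d N))) (𝓡 (d k)) (fun t => (locZ hT p N t).1 k)
    y).toLinearMap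

/-- The vector `v` at `y` represents the vector `X` of the absolute parallelism. -/
def LocRel (hT : T.IsNormal μ) (p : T.Limit) (N : ℕ) (y v : EuclideanSpace ℝ (Fin (d N)))
    (X : L) : Prop :=
  locD hT p N N y v = vecL μ (locZ hT p N y) N X

lemma locZ_base (hT : T.IsNormal μ) (p : T.Limit) (N : ℕ) : locZ hT p N (locBase p N) = p := by
  have : (extChartAt (𝓡 (d N)) (p.1 N)).symm (locBase p N) = p.1 N :=
    (extChartAt (𝓡 (d N)) (p.1 N)).left_inv (mem_extChartAt_source _)
  rw [locZ, this, lift_self]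

/-- The domain of the chart around `p.1 N`. -/
def locDom (p : T.Limit) (N : ℕ) : Set (EuclideanSpace ℝ (Fin (d N))) :=
  (extChartAt (𝓡 (d N)) (p.1 N)).target

lemma locDom_isOpen (p : T.Limit) (N : ℕ) : IsOpen (locDom p N) := isOpen_extChartAt_target _

lemma locBase_mem (p : T.Limit) (N : ℕ) : locBase p N ∈ locDom p N := mem_extChartAt_target _

lemma eventually_locDom {p : T.Limit} {N : ℕ} {y : EuclideanSpace ℝ (Fin (d N))}
    (hy : y ∈ locDom p N) : ∀ᶠ t in 𝓝 y, t ∈ locDom p N :=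
  (locDom_isOpen p N).mem_nhds hy

lemma loc_contMDiffAt (hT : T.IsNormal μ) {p : T.Limit} {N k : ℕ} (hk : k ≤ N)
    {y : EuclideanSpace ℝ (Fin (d N))} (hy : y ∈ locDom p N) :
    ContMDiffAt 𝓘(ℝ, EuclideanSpace ℝ (Fin (d N))) (𝓡 (d k)) ∞ (fun t => (locZ hT p N t).1 k) y :=
  (contMDiff_lift hT p hk).contMDiffAt.comp y (contMDiffAt_extChartAt_symm hy)

lemma loc_eventually_contMDiffAt (hT : T.IsNormal μ) {p : T.Limit} {N k : ℕ} (hk : k ≤ N)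
    {y : EuclideanSpace ℝ (Fin (d N))} (hy : y ∈ locDom p N) :
    ∀ᶠ t in 𝓝 y, ContMDiffAt 𝓘(ℝ, EuclideanSpace ℝ (Fin (d N))) (𝓡 (d k)) ∞
      (fun t => (locZ hT p N t).1 k) t := by
  filter_upwards [eventually_locDom hy] with t ht
  exact loc_contMDiffAt hT hk ht

lemma dpi_locD (hT : T.IsNormal μ) {p : T.Limit} {N k : ℕ} (hk : k + 1 ≤ N)
    {y : EuclideanSpace ℝ (Fin (d N))} (hy : y ∈ locDom p N) (v : EuclideanSpace ℝ (Fin (d N))) :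
    dpi (locZ hT p N y) k (locD hT p N (k + 1) y v) = locD hT p N k y v := by
  have h1 : (fun t => (locZ hT p N t).1 k) = T.π k ∘ fun t => (locZ hT p N t).1 (k + 1) :=
    funext fun t => ((locZ hT p N t).2 k).symm
  have h2 := mfderiv_comp y
    (((hT.subbundle k).principal.smooth_π.contMDiffAt).mdifferentiableAt (by simp))
    ((loc_contMDiffAt hT hk hy).mdifferentiableAt (by simp))
  rw [← h1] at h2
  exact (congrArg (fun f : EuclideanSpace ℝ (Fin (d N)) →L[ℝ] EuclideanSpace ℝ (Fin (d k)) => f v)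
    h2).symm

/-- A match between coordinate vector and parallelism vector at level N descends to every lower
level, since both sides are compatible with the projections. -/
lemma LocRel.locD_eq (h𝒢 : IsTransitive 𝒢 μ) {hT : T.IsNormal μ} {p : T.Limit} {N : ℕ}
    {y v : EuclideanSpace ℝ (Fin (d N))} {X : L} (h : LocRel hT p N y v X) (hy : y ∈ locDom p N)
    {k : ℕ} (hk : k ≤ N) : locD hT p N k y v = vecL μ (locZ hT p N y) k X := by
  induction hk using Nat.decreasingInduction with
  | self => exact h
  | of_succ k hk ih => rw [← dpi_locD hT hk hy, ih, dpi_vecL h𝒢 hT]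

lemma exists_locRel (h𝒢 : IsTransitive 𝒢 μ) (hT : T.IsNormal μ) (p : T.Limit) (N : ℕ)
    (y v : EuclideanSpace ℝ (Fin (d N))) : ∃ X, LocRel hT p N y v X := by
  obtain ⟨X, hX⟩ := vecL_surjective h𝒢 hT (locZ hT p N y) N (locD hT p N N y v)
  exact ⟨X, hX.symm⟩

lemma exists_locRel_vector (hT : T.IsNormal μ) (p : T.Limit) {N : ℕ}
    {y : EuclideanSpace ℝ (Fin (d N))} (hy : y ∈ locDom p N) (X : L) :
    ∃ v, LocRel hT p N y v X := by
  have h1 : (fun t => (locZ hT p N t).1 N) = (extChartAt (𝓡 (d N)) (p.1 N)).symm :=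
    funext fun t => lift_apply _ _ _ _
  have h2 := isInvertible_mfderivWithin_extChartAt_symm hy
  rw [ModelWithCorners.range_eq_univ, mfderivWithin_univ] at h2
  obtain ⟨v, hv⟩ := h2.surjective (vecL μ (locZ hT p N y) N X)
  refine ⟨v, Eq.trans ?_ hv⟩
  rw [locD, h1]
  rfl

/-- Each projection contributes its tangent map, which is smooth; iterate over the j levels. -/
lemma contMDiffAt_pushL (hT : T.IsNormal μ) {p : T.Limit} {N n : ℕ} :
    ∀ (j : ℕ) {ξ : EuclideanSpace ℝ (Fin (d N)) → EuclideanSpace ℝ (Fin (d (n + j)))}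
      {y : EuclideanSpace ℝ (Fin (d N))},
    ContMDiffAt 𝓘(ℝ, EuclideanSpace ℝ (Fin (d N))) (𝓡 (d (n + j))).tangent ∞
      (fun t => (⟨(locZ hT p N t).1 (n + j), ξ t⟩ :
        TangentBundle (𝓡 (d (n + j))) (Q (n + j)))) y →
    ContMDiffAt 𝓘(ℝ, EuclideanSpace ℝ (Fin (d N))) (𝓡 (d n)).tangent ∞
      (fun t => (⟨(locZ hT p N t).1 n, pushL (locZ hT p N t) n j (ξ t)⟩ :
        TangentBundle (𝓡 (d n)) (Q n))) y
  | 0, ξ, y, h => h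
  | j + 1, ξ, y, h => by
    refine contMDiffAt_pushL hT j (ξ := fun t => dpi (locZ hT p N t) (n + j) (ξ t)) ?_
    have hπ := (hT.subbundle (n + j)).principal.smooth_π.contMDiff_tangentMap (m := ∞) (by simp)
    have h2 := hπ.contMDiffAt.comp y h
    have h3 : (fun t => (⟨(locZ hT p N t).1 (n + j), dpi (locZ hT p N t) (n + j) (ξ t)⟩ :
        TangentBundle (𝓡 (d (n + j))) (Q (n + j)))) =
        tangentMap (𝓡 (d (n + j + 1))) (𝓡 (d (n + j))) (T.π (n + j)) ∘
          (fun t => (⟨(locZ hT p N t).1 (n + j + 1), ξ t⟩ :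
            TangentBundle (𝓡 (d (n + j + 1))) (Q (n + j + 1)))) := by
      funext t
      exact tangentBundle_mk_congr ((locZ hT p N t).2 (n + j)).symm rfl
    rw [h3]
    exact h2

/-- The vectors of the absolute parallelism depend smoothly on the point. -/
lemma contMDiffAt_vecL (h𝒢 : IsTransitive 𝒢 μ) (hT : T.IsNormal μ) {p : T.Limit} {N n : ℕ}
    (hn : n + μ + 1 ≤ N) {y : EuclideanSpace ℝ (Fin (d N))} (hy : y ∈ locDom p N) (X : L) :
    ContMDiffAt 𝓘(ℝ, EuclideanSpace ℝ (Fin (d N))) (𝓡 (d n)).tangent ∞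
      (fun t => (⟨(locZ hT p N t).1 n, vecL μ (locZ hT p N t) n X⟩ :
        TangentBundle (𝓡 (d n)) (Q n))) y := by
  obtain ⟨U, s, hU, hyU, hs1, hs2⟩ :=
    (hT.subbundle (n + μ)).smooth_frame ((locZ hT p N y).1 (n + μ + 1))
  have hc := loc_contMDiffAt hT hn hy
  have hev : ∀ᶠ t in 𝓝 y, (locZ hT p N t).1 (n + μ + 1) ∈ U :=
    hc.continuousAt.preimage_mem_nhds (hU.mem_nhds hyU)
  let ξ : EuclideanSpace ℝ (Fin (d N)) → EuclideanSpace ℝ (Fin (d (n + μ))) := fun t =>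
    s ((locZ hT p N t).1 (n + μ + 1)) X
  have h1 : ContMDiffAt 𝓘(ℝ, EuclideanSpace ℝ (Fin (d N))) (𝓡 (d (n + μ))).tangent ∞
      (fun t => (⟨(locZ hT p N t).1 (n + μ), ξ t⟩ :
        TangentBundle (𝓡 (d (n + μ))) (Q (n + μ)))) y := by
    have h2 := ((hs2 X).contMDiffAt (hU.mem_nhds hyU)).comp y hc
    refine h2.congr_of_eventuallyEq (Filter.Eventually.of_forall fun t => ?_)
    exact tangentBundle_mk_congr ((locZ hT p N t).2 (n + μ)).symm rfl
  refine (contMDiffAt_pushL hT μ h1).congr_of_eventuallyEq ?_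
  filter_upwards [hev] with t ht
  refine tangentBundle_mk_congr rfl ?_
  rw [vecL_eq_pushL h𝒢 hT (locZ hT p N t) n
    (mem_Fr_congr rfl ((locZ hT p N t).2 (n + μ)) (hs1 _ ht))]
  rfl

end SmoothStructure

end TowerData

/-! ### Bilinearity and antisymmetry of the exterior derivative at a point. -/

section DFormAlgebra

variable {n : ℕ} {M : Type v} [TopologicalSpace M] [ChartedSpace (EuclideanSpace ℝ (Fin n)) M]
variable (α : ∀ q : M, TangentSpace (𝓡 n) q →ₗ[ℝ] ℝ) (x : M)

lemma dForm_add_left (ξ ξ' η : EuclideanSpace ℝ (Fin n)) :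
    dForm α x (ξ + ξ') η = dForm α x ξ η + dForm α x ξ' η := by
  simp only [dForm, map_add, add_apply]; ring

lemma dForm_smul_left (t : ℝ) (ξ η : EuclideanSpace ℝ (Fin n)) :
    dForm α x (t • ξ) η = t * dForm α x ξ η := by
  simp only [dForm, map_smul, smul_apply, smul_eq_mul]; ring

lemma dForm_swap (ξ η : EuclideanSpace ℝ (Fin n)) : dForm α x η ξ = -dForm α x ξ η := by
  simp only [dForm]; ring

lemma dForm_zero_left (η : EuclideanSpace ℝ (Fin n)) : dForm α x 0 η = 0 := by
  simp [dForm]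

end DFormAlgebra

namespace TowerData

variable {L : Type u} [LieRing L] [LieAlgebra ℝ L]
variable {𝒢 : ℤ → Submodule ℝ L} [GradedLieAlgebra 𝒢]
variable {d e : ℕ → ℕ}
variable {Q : ℕ → Type v} [∀ n, TopologicalSpace (Q n)]
  [∀ n, ChartedSpace (EuclideanSpace ℝ (Fin (d n))) (Q n)] [∀ n, IsManifold (𝓡 (d n)) ∞ (Q n)]
variable {G : ℕ → Type w} [∀ n, Group (G n)] [∀ n, TopologicalSpace (G n)]
  [∀ n, ChartedSpace (EuclideanSpace ℝ (Fin (e n))) (G n)]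

/-! ### The structure function: bilinearity, dependence on finite levels, smoothness. -/

section StructureFunction

open Topology

variable {T : TowerData 𝒢 (d := d) (e := e) Q G} {μ : ℕ}

/-- The structure function, tested on a linear functional. -/
lemma dual_gamma (h𝒢 : IsTransitive 𝒢 μ) (hT : T.IsNormal μ) {m : ℕ} {c : ℤ}
    (hcm : c + μ = m) (hc : c < m) (z : T.Limit) (X Y : L) :
    gamma μ z c X Y ∈ 𝒢 c ∧ ∀ φ : Module.Dual ℝ L,
      φ (gamma μ z c X Y) = -dForm (fun q => φ ∘ₗ thetaL h𝒢 hT hcm.le hc q) (z.1 (m + 1))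
        (vecL μ z (m + 1) X) (vecL μ z (m + 1) Y) := by
  obtain rfl : (c + μ).toNat = m := by omega
  have := finiteDimensional_grade h𝒢 T c
  have key := dual_extD (𝒢 c) (thetaL h𝒢 hT hcm.le hc)
    (fun q ξ => theta_mem c (c + μ).toNat q ξ) (z.1 ((c + μ).toNat + 1))
    (fun φ => thetaL_smooth h𝒢 hT hcm.le hc φ _) (vecL μ z ((c + μ).toNat + 1) X)
    (vecL μ z ((c + μ).toNat + 1) Y)
  have h1 : gamma μ z c X Y = -extD (fun q => thetaL h𝒢 hT hcm.le hc q)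
      (z.1 ((c + μ).toNat + 1)) (vecL μ z ((c + μ).toNat + 1) X)
      (vecL μ z ((c + μ).toNat + 1) Y) := by
    rw [gamma, vec_eq_vecL, vec_eq_vecL]
    rfl
  rw [h1]
  refine ⟨Submodule.neg_mem _ key.1, fun φ => ?_⟩
  rw [map_neg, key.2 φ]

/-- Kept apart from `dual_gamma` because for c < −μ the level c + μ is negative and is truncated to
0 by `toNat`. Here the form itself vanishes identically. -/
lemma gamma_eq_zero_of_bot {c : ℤ} (hc : 𝒢 c = ⊥) (z : T.Limit) (X Y : L) :
    gamma μ z c X Y = 0 := by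
  have h0 : (T.theta c (c + μ).toNat) =
      fun q => ((0 : TangentSpace (𝓡 (d ((c + μ).toNat + 1))) q →ₗ[ℝ] L) : _ → L) := by
    funext q ξ
    exact comp_eq_zero_of_bot hc _
  rw [gamma, h0]
  have key := dual_extD (⊥ : Submodule ℝ L) (n := d ((c + μ).toNat + 1))
    (M := Q ((c + μ).toNat + 1)) (fun q => 0)
    (fun q ξ => Submodule.zero_mem _) (z.1 ((c + μ).toNat + 1))
    (fun φ => by
      have : chartForm (fun q : Q ((c + μ).toNat + 1) =>
          φ ∘ₗ (0 : TangentSpace (𝓡 (d ((c + μ).toNat + 1))) q →ₗ[ℝ] L))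
          (z.1 ((c + μ).toNat + 1)) = fun _ => 0 := by
        funext u
        ext w
        rw [chartForm_apply]
        exact map_zero φ
      rw [SmoothFormAt, this]
      exact contDiffAt_const)
    (vec μ z ((c + μ).toNat + 1) X) (vec μ z ((c + μ).toNat + 1) Y)
  rw [neg_eq_zero]
  exact (Submodule.mem_bot ℝ).1 key.1

/-- For μ = 0 there is no negative part, so transitivity kills every component of degree ≥ 0. This
disposes of the case where c < c + μ fails. -/
lemma subsingleton_of_depth_zero (h𝒢 : IsTransitive 𝒢 0) : Subsingleton L := by
  have h0 : ∀ c, 𝒢 c = ⊥ := by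
    intro c
    rcases lt_or_ge c 0 with h | h
    · exact h𝒢.depth c (by simpa using h)
    · refine (Submodule.eq_bot_iff _).2 fun A hA => h𝒢.transitive c h A hA fun p hp X hX => ?_
      rw [h𝒢.depth p (by simpa using hp), Submodule.mem_bot] at hX
      rw [hX, lie_zero]
  refine ⟨fun X Y => ext_comp (𝒢 := 𝒢) fun p => ?_⟩
  rw [comp_eq_zero_of_bot (h0 p), comp_eq_zero_of_bot (h0 p)]

/-- Either the `𝔤_c`-component is trivial, or it belongs to the canonical form of some `Q (m + 1)`. -/
lemma bot_or_level (h𝒢 : IsTransitive 𝒢 μ) (c : ℤ) :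
    𝒢 c = ⊥ ∨ ∃ m : ℕ, c + μ = m ∧ c < m := by
  rcases Nat.eq_zero_or_pos μ with h | h
  · subst h
    have := subsingleton_of_depth_zero h𝒢
    exact Or.inl (Subsingleton.elim _ _)
  · rcases lt_or_ge c (-(μ : ℤ)) with hc | hc
    · exact Or.inl (h𝒢.depth c hc)
    · exact Or.inr ⟨(c + μ).toNat, by omega, by omega⟩

lemma gamma_mem (h𝒢 : IsTransitive 𝒢 μ) (hT : T.IsNormal μ) (z : T.Limit) (c : ℤ) (X Y : L) :
    gamma μ z c X Y ∈ 𝒢 c := by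
  rcases bot_or_level h𝒢 c with h | ⟨m, h1, h2⟩
  · rw [gamma_eq_zero_of_bot h]
    exact Submodule.zero_mem _
  · exact (dual_gamma h𝒢 hT h1 h2 z X Y).1

lemma gamma_swap (h𝒢 : IsTransitive 𝒢 μ) (hT : T.IsNormal μ) (z : T.Limit) (c : ℤ) (X Y : L) :
    gamma μ z c Y X = -gamma μ z c X Y := by
  rcases bot_or_level h𝒢 c with h | ⟨m, h1, h2⟩
  · rw [gamma_eq_zero_of_bot h, gamma_eq_zero_of_bot h, neg_zero]
  · refine eq_of_forall_dual fun φ => ?_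
    rw [map_neg, (dual_gamma h𝒢 hT h1 h2 z _ _).2, (dual_gamma h𝒢 hT h1 h2 z _ _).2, dForm_swap]

lemma gamma_add_left (h𝒢 : IsTransitive 𝒢 μ) (hT : T.IsNormal μ) (z : T.Limit) (c : ℤ)
    (X X' Y : L) : gamma μ z c (X + X') Y = gamma μ z c X Y + gamma μ z c X' Y := by
  rcases bot_or_level h𝒢 c with h | ⟨m, h1, h2⟩
  · simp [gamma_eq_zero_of_bot h]
  · refine eq_of_forall_dual fun φ => ?_
    rw [map_add, (dual_gamma h𝒢 hT h1 h2 z _ _).2, (dual_gamma h𝒢 hT h1 h2 z _ _).2,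
      (dual_gamma h𝒢 hT h1 h2 z _ _).2, map_add, dForm_add_left]
    ring

lemma gamma_smul_left (h𝒢 : IsTransitive 𝒢 μ) (hT : T.IsNormal μ) (z : T.Limit) (c : ℤ)
    (t : ℝ) (X Y : L) : gamma μ z c (t • X) Y = t • gamma μ z c X Y := by
  rcases bot_or_level h𝒢 c with h | ⟨m, h1, h2⟩
  · simp [gamma_eq_zero_of_bot h]
  · refine eq_of_forall_dual fun φ => ?_
    rw [map_smul, (dual_gamma h𝒢 hT h1 h2 z _ _).2, (dual_gamma h𝒢 hT h1 h2 z _ _).2,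
      map_smul, dForm_smul_left, smul_eq_mul]
    ring

/-- The `𝔤_c`-component of the structure function as a bilinear map. -/
def gammaL (h𝒢 : IsTransitive 𝒢 μ) (hT : T.IsNormal μ) (z : T.Limit) (c : ℤ) :
    L →ₗ[ℝ] L →ₗ[ℝ] L :=
  LinearMap.mk₂ ℝ (fun X Y => gamma μ z c X Y)
    (gamma_add_left h𝒢 hT z c)
    (gamma_smul_left h𝒢 hT z c)
    (fun X Y Y' => by
      rw [gamma_swap h𝒢 hT, gamma_add_left h𝒢 hT, gamma_swap h𝒢 hT z c X, gamma_swap h𝒢 hT z c X]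
      abel)
    (fun t X Y => by
      rw [gamma_swap h𝒢 hT, gamma_smul_left h𝒢 hT, gamma_swap h𝒢 hT z c X, smul_neg,
        neg_neg])

lemma gammaL_apply (h𝒢 : IsTransitive 𝒢 μ) (hT : T.IsNormal μ) (z : T.Limit) (c : ℤ) (X Y : L) :
    gammaL h𝒢 hT z c X Y = gamma μ z c X Y := rfl

lemma gamma_zero_left (h𝒢 : IsTransitive 𝒢 μ) (hT : T.IsNormal μ) (z : T.Limit) (c : ℤ) (Y : L) :
    gamma μ z c 0 Y = 0 := by
  rw [← gammaL_apply h𝒢 hT]; simp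

lemma gamma_zero_right (h𝒢 : IsTransitive 𝒢 μ) (hT : T.IsNormal μ) (z : T.Limit) (c : ℤ)
    (X : L) : gamma μ z c X 0 = 0 := by
  rw [← gammaL_apply h𝒢 hT]; simp

/-- γ_c is computed on `Q (c + μ + 1)`, where the parallelism vectors of this filtration step are
zero. -/
lemma gamma_eq_zero_of_mem_algFilt (h𝒢 : IsTransitive 𝒢 μ) (hT : T.IsNormal μ) (z : T.Limit)
    {c : ℤ} {X : L} (hX : X ∈ algFilt 𝒢 (c + μ + 1)) (Y : L) : gamma μ z c X Y = 0 := by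
  rcases bot_or_level h𝒢 c with h | ⟨m, h1, h2⟩
  · exact gamma_eq_zero_of_bot h _ _ _
  · refine eq_of_forall_dual fun φ => ?_
    have h3 : vecL μ z (m + 1) X = 0 := by
      rw [vecL_eq_zero_iff h𝒢 hT]
      rw [h1] at hX
      exact_mod_cast hX
    rw [map_zero, (dual_gamma h𝒢 hT h1 h2 z _ _).2, h3, dForm_zero_left, neg_zero]

/-- Makes the quadratic term γ_c(γ(X,Y), Z) a finite sum: only components of degree ≤ c + μ of an
argument matter. -/
lemma gamma_trunc (h𝒢 : IsTransitive 𝒢 μ) (hT : T.IsNormal μ) (z : T.Limit) {c n : ℤ}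
    (hn : c + μ + 1 ≤ n) (X Y : L) :
    gamma μ z c (trunc 𝒢 μ n X) (trunc 𝒢 μ n Y) = gamma μ z c X Y := by
  have key : ∀ X Y, gamma μ z c (trunc 𝒢 μ n X) Y = gamma μ z c X Y := by
    intro X Y
    have h1 := gamma_eq_zero_of_mem_algFilt h𝒢 hT z
      (algFilt_anti 𝒢 hn (sub_trunc_mem n h𝒢.depth X)) Y
    rw [← gammaL_apply h𝒢 hT, map_sub, LinearMap.sub_apply, sub_eq_zero] at h1
    exact h1.symm
  rw [key, gamma_swap h𝒢 hT, key, ← gamma_swap h𝒢 hT]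

lemma dForm_congr {n : ℕ} {M : Type v} [TopologicalSpace M]
    [ChartedSpace (EuclideanSpace ℝ (Fin n)) M] (α : ∀ q : M, TangentSpace (𝓡 n) q →ₗ[ℝ] ℝ)
    {x x' : M} (h : x = x') (ξ η : EuclideanSpace ℝ (Fin n)) :
    dForm α x ξ η = dForm α x' ξ η := by
  subst h; rfl

/-- The `𝔤_c`-component of the structure function is a function on `Q N` for `N ≥ c + 2μ + 2`. -/
lemma gamma_congr (h𝒢 : IsTransitive 𝒢 μ) (hT : T.IsNormal μ) {z z' : T.Limit} {N : ℕ}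
    (h : z.1 N = z'.1 N) {c : ℤ} (hN : c + 2 * μ + 2 ≤ N) (X Y : L) :
    gamma μ z c X Y = gamma μ z' c X Y := by
  rcases bot_or_level h𝒢 c with hb | ⟨m, h1, h2⟩
  · rw [gamma_eq_zero_of_bot hb, gamma_eq_zero_of_bot hb]
  · refine eq_of_forall_dual fun φ => ?_
    -- The form θ_c lives at level m + 1 = c + μ + 1, and its canonical vectors require a point μ +
    -- 1 levels higher; this is the bound c + 2μ + 2.
    rw [(dual_gamma h𝒢 hT h1 h2 z _ _).2, (dual_gamma h𝒢 hT h1 h2 z' _ _).2,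
      dForm_congr _ (limit_eq_of_le h (m + 1) (by omega)),
      vecL_congr h𝒢 hT (limit_eq_of_le h (m + 1 + μ + 1) (by omega))]

/-- The structure equation, in the local model. -/
lemma structure_equation (h𝒢 : IsTransitive 𝒢 μ) (hT : T.IsNormal μ) {p : T.Limit} {N m : ℕ}
    {c : ℤ} (hcm : c + μ = m) (hc : c < m) (hN : m + 1 ≤ N)
    {y v w : EuclideanSpace ℝ (Fin (d N))} (hy : y ∈ locDom p N) {X Y : L}
    (hX : LocRel hT p N y v X) (hY : LocRel hT p N y w Y) (φ : Module.Dual ℝ L) :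
    fderiv ℝ (fun t => φ (T.theta c m ((locZ hT p N t).1 (m + 1)) (locD hT p N (m + 1) t w))) y v -
      fderiv ℝ (fun t => φ (T.theta c m ((locZ hT p N t).1 (m + 1))
        (locD hT p N (m + 1) t v))) y w = -φ (gamma μ (locZ hT p N y) c X Y) := by
  rw [(dual_gamma h𝒢 hT hcm hc _ X Y).2 φ, neg_neg, ← hX.locD_eq h𝒢 hy hN,
    ← hY.locD_eq h𝒢 hy hN]
  exact fderiv_form_pullback (α := fun q => φ ∘ₗ thetaL h𝒢 hT hcm.le hc q)
    (F := fun t => (locZ hT p N t).1 (m + 1)) (thetaL_smooth h𝒢 hT hcm.le hc φ _)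
    (loc_eventually_contMDiffAt hT hN hy) v w

/-- The canonical form is smooth in the local model. -/
lemma contDiffAt_theta (h𝒢 : IsTransitive 𝒢 μ) (hT : T.IsNormal μ) {p : T.Limit} {N m : ℕ}
    {c : ℤ} (hcm : c + μ = m) (hc : c < m) (hN : m + 1 ≤ N)
    {y : EuclideanSpace ℝ (Fin (d N))} (hy : y ∈ locDom p N) (w : EuclideanSpace ℝ (Fin (d N)))
    (φ : Module.Dual ℝ L) :
    ContDiffAt ℝ ∞ (fun t => φ (T.theta c m ((locZ hT p N t).1 (m + 1))
      (locD hT p N (m + 1) t w))) y := by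
  set F := fun t => (locZ hT p N t).1 (m + 1) with hF
  have hev := loc_eventually_contMDiffAt hT hN hy
  set x := F y
  have hx : F y ∈ (extChartAt (𝓡 (d (m + 1))) x).source := mem_extChartAt_source _
  have h1 : ContDiffAt ℝ ∞ (fun t => extChartAt (𝓡 (d (m + 1))) x (F t)) y := by
    have : ContMDiffAt 𝓘(ℝ, EuclideanSpace ℝ (Fin (d N)))
        𝓘(ℝ, EuclideanSpace ℝ (Fin (d (m + 1)))) ∞
        (fun t => extChartAt (𝓡 (d (m + 1))) x (F t)) y :=
      (contMDiffAt_extChartAt (x := x)).comp y hev.self_of_nhds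
    exact this.contDiffAt
  have h2 : ContDiffAt ℝ ∞
      (fun t => fderiv ℝ (fun t => extChartAt (𝓡 (d (m + 1))) x (F t)) t w) y :=
    (h1.fderiv_right (m := ∞) (by simp)).clm_apply contDiffAt_const
  have h3 : ContDiffAt ℝ ∞ (fun t => chartForm (fun q => φ ∘ₗ thetaL h𝒢 hT hcm.le hc q) x
      (extChartAt (𝓡 (d (m + 1))) x (F t))) y :=
    ContDiffAt.comp (g := chartForm (fun q => φ ∘ₗ thetaL h𝒢 hT hcm.le hc q) x) y
      (thetaL_smooth h𝒢 hT hcm.le hc φ x) h1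
  refine (h3.clm_apply h2).congr_of_eventuallyEq ?_
  filter_upwards [eventually_contMDiffAt hev x hx] with t ht
  exact form_mfderiv_eq_chartForm (fun q => φ ∘ₗ thetaL h𝒢 hT hcm.le hc q) x ht.2 ht.1 w

/-- The structure function is smooth in the local model. -/
lemma contDiffAt_gamma (h𝒢 : IsTransitive 𝒢 μ) (hT : T.IsNormal μ) {p : T.Limit} {N : ℕ}
    {c : ℤ} (hN : c + 2 * μ + 2 ≤ N)
    {y : EuclideanSpace ℝ (Fin (d N))} (hy : y ∈ locDom p N) (X Y : L) (φ : Module.Dual ℝ L) :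
    ContDiffAt ℝ ∞ (fun t => φ (gamma μ (locZ hT p N t) c X Y)) y := by
  rcases bot_or_level h𝒢 c with hb | ⟨m, hcm, hc⟩
  · simp only [gamma_eq_zero_of_bot hb]
    exact contDiffAt_const
  set F := fun t => (locZ hT p N t).1 (m + 1) with hF
  have hev := loc_eventually_contMDiffAt hT (p := p) (N := N) (k := m + 1) (by omega) hy
  set x := F y
  set α : ∀ q : Q (m + 1), TangentSpace (𝓡 (d (m + 1))) q →ₗ[ℝ] ℝ :=
    fun q => φ ∘ₗ thetaL h𝒢 hT hcm.le hc q
  set ε := extChartAt (𝓡 (d (m + 1))) x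
  have hx : F y ∈ ε.source := mem_extChartAt_source _
  have h1 : ContDiffAt ℝ ∞ (fun t => ε (F t)) y := by
    have : ContMDiffAt 𝓘(ℝ, EuclideanSpace ℝ (Fin (d N)))
        𝓘(ℝ, EuclideanSpace ℝ (Fin (d (m + 1)))) ∞ (fun t => ε (F t)) y :=
      (contMDiffAt_extChartAt (x := x)).comp y hev.self_of_nhds
    exact this.contDiffAt
  have h2 : ContDiffAt ℝ ∞ (fun t => fderiv ℝ (chartForm α x) (ε (F t))) y :=
    ContDiffAt.comp y ((thetaL_smooth h𝒢 hT hcm.le hc φ x).fderiv_right (m := ∞) (by simp)) h1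
  let V : L → EuclideanSpace ℝ (Fin (d N)) → EuclideanSpace ℝ (Fin (d (m + 1))) := fun X t =>
    mfderiv (𝓡 (d (m + 1))) 𝓘(ℝ, EuclideanSpace ℝ (Fin (d (m + 1)))) ε (F t)
      (vecL μ (locZ hT p N t) (m + 1) X)
  have hV : ∀ X, ContDiffAt ℝ ∞ (V X) y := fun X =>
    (contDiffAt_chart_vector (contMDiffAt_vecL h𝒢 hT (n := m + 1) (by omega) hy X)).1
  have h3 : ContDiffAt ℝ ∞ (fun t => -(fderiv ℝ (chartForm α x) (ε (F t)) (V X t) (V Y t) -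
      fderiv ℝ (chartForm α x) (ε (F t)) (V Y t) (V X t))) y :=
    (((h2.clm_apply (hV X)).clm_apply (hV Y)).sub ((h2.clm_apply (hV Y)).clm_apply (hV X))).neg
  refine h3.congr_of_eventuallyEq ?_
  have hsm : ∀ᶠ u in 𝓝 (ε x), ContDiffAt ℝ 1 (chartForm α x) u :=
    ((thetaL_smooth h𝒢 hT hcm.le hc φ x).of_le (by simp : (1 : ℕ∞ω) ≤ ∞)).eventually (by simp)
  have hsm' : ∀ᶠ t in 𝓝 y, ContDiffAt ℝ 1 (chartForm α x) (ε (F t)) :=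
    h1.continuousAt.eventually hsm
  filter_upwards [eventually_contMDiffAt hev x hx, hsm'] with t ht hst
  rw [(dual_gamma h𝒢 hT hcm hc (locZ hT p N t) X Y).2 φ]
  congr 1
  have htt : ε (F t) ∈ ε.target := ε.map_source ht.2
  have hFt : ε.symm (ε (F t)) = F t := ε.left_inv ht.2
  -- `dForm` at F t refers to the chart around F t, which varies with t. Pulling back along the
  -- inverse of the fixed chart ε expresses it by the derivative of one fixed coordinate form.
  have hpull := fderiv_form_pullback (α := α) (F := ε.symm) (y := ε (F t))
    (thetaL_smooth h𝒢 hT hcm.le hc φ _)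
    (by
      filter_upwards [(isOpen_extChartAt_target (I := 𝓡 (d (m + 1))) x).mem_nhds htt] with u hu
      exact contMDiffAt_extChartAt_symm hu) (V X t) (V Y t)
  have hinv : ∀ ξ : EuclideanSpace ℝ (Fin (d (m + 1))),
      (mfderiv 𝓘(ℝ, EuclideanSpace ℝ (Fin (d (m + 1)))) (𝓡 (d (m + 1))) ε.symm (ε (F t))
        (mfderiv (𝓡 (d (m + 1))) 𝓘(ℝ, EuclideanSpace ℝ (Fin (d (m + 1)))) ε (F t) ξ) :
          EuclideanSpace ℝ (Fin (d (m + 1)))) = ξ := by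
    intro ξ
    have := mfderivWithin_extChartAt_symm_comp_mfderiv_extChartAt' (I := 𝓡 (d (m + 1))) ht.2
    rw [ModelWithCorners.range_eq_univ, mfderivWithin_univ] at this
    exact congrArg (fun f : EuclideanSpace ℝ (Fin (d (m + 1))) →L[ℝ]
      EuclideanSpace ℝ (Fin (d (m + 1))) => f ξ) this
  have h4 : ∀ w : EuclideanSpace ℝ (Fin (d (m + 1))), HasFDerivAt (fun u => chartForm α x u w)
      ((ContinuousLinearMap.apply ℝ ℝ w).comp (fderiv ℝ (chartForm α x) (ε (F t)))) (ε (F t)) :=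
    fun w => (ContinuousLinearMap.apply ℝ ℝ w).hasFDerivAt.comp _
      (hst.differentiableAt (by simp)).hasFDerivAt
  have h5 : ∀ w : EuclideanSpace ℝ (Fin (d (m + 1))), (fun t => α (ε.symm t)
      (mfderiv 𝓘(ℝ, EuclideanSpace ℝ (Fin (d (m + 1)))) (𝓡 (d (m + 1))) ε.symm t w)) =
      fun u => chartForm α x u w := fun w => rfl
  rw [h5, h5, (h4 _).fderiv, (h4 _).fderiv] at hpull
  have h6 : dForm α (ε.symm (ε (F t))) (vecL μ (locZ hT p N t) (m + 1) X)
      (vecL μ (locZ hT p N t) (m + 1) Y) = dForm α ((locZ hT p N t).1 (m + 1))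
      (vecL μ (locZ hT p N t) (m + 1) X) (vecL μ (locZ hT p N t) (m + 1) Y) :=
    dForm_congr α hFt _ _
  rw [← h6]
  refine Eq.trans ?_ hpull.symm
  exact congrArg₂ (dForm α (ε.symm (ε (F t)))) (hinv _).symm (hinv _).symm

end StructureFunction

end TowerData

lemma HasDerivAlong.congr_base {L : Type u} [AddCommGroup L] [Module ℝ L]
    {n : ℕ} {M : Type v} [TopologicalSpace M] [ChartedSpace (EuclideanSpace ℝ (Fin n)) M]
    {f : M → L} {x x' : M} (hx : x = x') {ξ ξ' : EuclideanSpace ℝ (Fin n)} (hξ : ξ = ξ') {l : L}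
    (h : HasDerivAlong f x ξ l) : HasDerivAlong f x' ξ' l := by
  subst hx; subst hξ; exact h

namespace TowerData

variable {L : Type u} [LieRing L] [LieAlgebra ℝ L]
variable {𝒢 : ℤ → Submodule ℝ L} [GradedLieAlgebra 𝒢]
variable {d e : ℕ → ℕ}
variable {Q : ℕ → Type v} [∀ n, TopologicalSpace (Q n)]
  [∀ n, ChartedSpace (EuclideanSpace ℝ (Fin (d n))) (Q n)] [∀ n, IsManifold (𝓡 (d n)) ∞ (Q n)]
variable {G : ℕ → Type w} [∀ n, Group (G n)] [∀ n, TopologicalSpace (G n)]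
  [∀ n, ChartedSpace (EuclideanSpace ℝ (Fin (e n))) (G n)]

/-! ### Covariant derivatives of functions on the limit. -/

section CovariantDerivative

open Topology

variable {T : TowerData 𝒢 (d := d) (e := e) Q G} {μ : ℕ}

lemma hasDerivAlong_comp_π (h𝒢 : IsTransitive 𝒢 μ) (hT : T.IsNormal μ) {z : T.Limit} {n : ℕ}
    {f : Q n → L} {X l : L} (h : HasDerivAlong (n := d n) f (z.1 n) (vecL μ z n X) l) :
    HasDerivAlong (n := d (n + 1)) (fun q => f (T.π n q)) (z.1 (n + 1)) (vecL μ z (n + 1) X) l := by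
  have h' := h.congr_base (z.2 n).symm (dpi_vecL h𝒢 hT z n X).symm
  intro φ
  have hπ : MDifferentiableAt (𝓡 (d (n + 1))) (𝓡 (d n)) (T.π n) (z.1 (n + 1)) :=
    (hT.subbundle n).principal.smooth_π.contMDiffAt.mdifferentiableAt (by simp)
  obtain ⟨h1, h2⟩ := h' φ
  refine ⟨MDifferentiableAt.comp (g := fun q => φ (f q)) (z.1 (n + 1)) h1 hπ, ?_⟩
  have h3 := mfderiv_comp (z.1 (n + 1)) h1 hπ
  exact (congrArg (fun f : EuclideanSpace ℝ (Fin (d (n + 1))) →L[ℝ] ℝ =>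
    f (vecL μ z (n + 1) X)) h3).trans h2

/-- Allows derivatives taken at different levels to be compared at a common one. -/
lemma exists_hasDerivAlong_of_le (h𝒢 : IsTransitive 𝒢 μ) (hT : T.IsNormal μ) {z : T.Limit}
    {n N : ℕ} (hN : n ≤ N) {f : Q n → L} {X l : L}
    (h : HasDerivAlong (n := d n) f (z.1 n) (vecL μ z n X) l) :
    ∃ f' : Q N → L, (∀ y : T.Limit, f (y.1 n) = f' (y.1 N)) ∧
      HasDerivAlong (n := d N) f' (z.1 N) (vecL μ z N X) l := by
  induction N, hN using Nat.le_induction with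
  | base => exact ⟨f, fun _ => rfl, h⟩
  | succ N _ ih =>
    obtain ⟨f', h1, h2⟩ := ih
    exact ⟨fun q => f' (T.π N q), fun y => (h1 y).trans (congrArg f' (y.2 N).symm),
      hasDerivAlong_comp_π h𝒢 hT h2⟩

/-- Two factorizations of f become the same function at a common level because the limit projects
onto every `Q m`; there the derivative is unique. -/
lemma HasCovDeriv.unique (h𝒢 : IsTransitive 𝒢 μ) (hT : T.IsNormal μ) {X : L} {f : T.Limit → L}
    {z : T.Limit} {l l' : L} (h : HasCovDeriv μ X f z l) (h' : HasCovDeriv μ X f z l') :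
    l = l' := by
  obtain ⟨m, f₁, hf₁, h₁⟩ := h
  obtain ⟨m', f₂, hf₂, h₂⟩ := h'
  rw [vec_eq_vecL] at h₁ h₂
  obtain ⟨g₁, hg₁, h₁⟩ := exists_hasDerivAlong_of_le h𝒢 hT (le_max_left m m') h₁
  obtain ⟨g₂, hg₂, h₂⟩ := exists_hasDerivAlong_of_le h𝒢 hT (le_max_right m m') h₂
  have : g₁ = g₂ := by
    funext q
    obtain ⟨y, rfl⟩ := exists_limit hT _ q
    rw [← hg₁, ← hg₂, ← hf₁, ← hf₂]
  subst this
  exact h₁.unique h₂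

/-- The covariant derivative, computed in the local model. -/
lemma covD_eq (h𝒢 : IsTransitive 𝒢 μ) (hT : T.IsNormal μ) (S : Submodule ℝ L)
    [FiniteDimensional ℝ S] {N : ℕ} {f : T.Limit → L} (hS : ∀ z, f z ∈ S)
    (hf : ∀ z z' : T.Limit, z.1 N = z'.1 N → f z = f z') {p : T.Limit}
    (hs : ∀ φ : Module.Dual ℝ L, ContDiffAt ℝ ∞ (fun t => φ (f (locZ hT p N t))) (locBase p N))
    {X : L} {v : EuclideanSpace ℝ (Fin (d N))} (hv : LocRel hT p N (locBase p N) v X) :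
    covD μ X f p ∈ S ∧ HasCovDeriv μ X f p (covD μ X f p) ∧ ∀ φ : Module.Dual ℝ L,
      φ (covD μ X f p) = fderiv ℝ (fun t => φ (f (locZ hT p N t))) (locBase p N) v := by
  -- f depends only on the point of level N, so the arbitrary lift is harmless.
  let f' : Q N → L := fun q => f (lift hT p N q)
  have hf' : ∀ y : T.Limit, f y = f' (y.1 N) := fun y => hf _ _ (lift_apply _ _ _ _).symm
  have h1 : ∀ φ : Module.Dual ℝ L, MDifferentiableAt (𝓡 (d N)) 𝓘(ℝ, ℝ) (fun q => φ (f' q))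
      (p.1 N) := fun φ => (contMDiffAt_of_chart (p.1 N) (hs φ)).mdifferentiableAt (by simp)
  obtain ⟨l, hlS, hl⟩ := exists_hasDerivAlong S (fun q => hS (lift hT p N q)) h1 (vecL μ p N X)
  have hcov : HasCovDeriv μ X f p l := ⟨N, f', hf', by rw [vec_eq_vecL]; exact hl⟩
  have hex : ∃ l, HasCovDeriv μ X f p l := ⟨l, hcov⟩
  have hl' : covD μ X f p = l := by
    rw [covD, dif_pos hex]
    exact hex.choose_spec.unique h𝒢 hT hcov
  rw [hl']
  refine ⟨hlS, hcov, fun φ => ?_⟩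
  have hbase := locZ_base hT p N
  have hl2 : HasDerivAlong (n := d N) f' ((locZ hT p N (locBase p N)).1 N)
      (locD hT p N N (locBase p N) v) l :=
    hl.congr_base (by rw [hbase]) (by rw [hv, hbase])
  obtain ⟨h2, h3⟩ := hl2 φ
  have hF := (loc_contMDiffAt hT (k := N) le_rfl (locBase_mem p N)).mdifferentiableAt
    (by simp : (∞ : ℕ∞ω) ≠ 0)
  have h4 := mfderiv_comp (locBase p N) h2 hF
  have h5 : (fun t => φ (f (locZ hT p N t))) =
      (fun q => φ (f' q)) ∘ fun t => (locZ hT p N t).1 N := by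
    funext t
    exact congrArg φ (hf' _)
  rw [h5, ← mfderiv_eq_fderiv, h4]
  exact h3.symm

lemma HasCovDeriv.covD_eq (h𝒢 : IsTransitive 𝒢 μ) (hT : T.IsNormal μ) {X : L} {f : T.Limit → L}
    {z : T.Limit} {l : L} (h : HasCovDeriv μ X f z l) : covD μ X f z = l := by
  have hex : ∃ l, HasCovDeriv μ X f z l := ⟨l, h⟩
  rw [covD, dif_pos hex]
  exact hex.choose_spec.unique h𝒢 hT h

lemma HasCovDeriv.neg {X : L} {f : T.Limit → L} {z : T.Limit} {l : L}
    (h : HasCovDeriv μ X f z l) : HasCovDeriv μ X (fun z => -f z) z (-l) := by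
  obtain ⟨m, f', hf', h⟩ := h
  refine ⟨m, fun q => -f' q, fun y => congrArg Neg.neg (hf' y), fun φ => ?_⟩
  have h1 := h (-φ)
  have h2 : (fun y => φ (-f' y)) = fun y => (-φ) (f' y) := by
    funext y
    simp
  rw [h2]
  exact ⟨h1.1, h1.2.trans (map_neg φ l).symm⟩

/-- `D_X γ_c(Y, Z)` in the local model. -/
lemma covD_gamma (h𝒢 : IsTransitive 𝒢 μ) (hT : T.IsNormal μ) {N : ℕ} {c : ℤ}
    (hN : c + 2 * μ + 2 ≤ N) (p : T.Limit) {X : L} (Y Z : L)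
    {v : EuclideanSpace ℝ (Fin (d N))} (hv : LocRel hT p N (locBase p N) v X) :
    covD μ X (fun p' : T.Limit => gamma μ p' c Y Z) p ∈ 𝒢 c ∧
    HasCovDeriv μ X (fun p' : T.Limit => gamma μ p' c Y Z) p
      (covD μ X (fun p' : T.Limit => gamma μ p' c Y Z) p) ∧ ∀ φ : Module.Dual ℝ L,
      φ (covD μ X (fun p' : T.Limit => gamma μ p' c Y Z) p) =
        fderiv ℝ (fun t => φ (gamma μ (locZ hT p N t) c Y Z)) (locBase p N) v := by
  have := finiteDimensional_grade h𝒢 T c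
  exact covD_eq h𝒢 hT (𝒢 c) (fun z => gamma_mem h𝒢 hT z c Y Z)
    (fun z z' h => gamma_congr h𝒢 hT h hN Y Z)
    (fun φ => contDiffAt_gamma h𝒢 hT hN (locBase_mem p N) Y Z φ) hv

lemma hasCovDeriv_gamma (h𝒢 : IsTransitive 𝒢 μ) (hT : T.IsNormal μ) (c : ℤ)
    (p : T.Limit) (X Y Z : L) : HasCovDeriv μ X (fun p' : T.Limit => gamma μ p' c Y Z) p
      (covD μ X (fun p' : T.Limit => gamma μ p' c Y Z) p) := by
  obtain ⟨v, hv⟩ := exists_locRel_vector hT p (locBase_mem p (c + 2 * μ + 2).toNat) X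
  exact (covD_gamma h𝒢 hT (by omega) p Y Z hv).2.1

lemma covD_gamma_swap (h𝒢 : IsTransitive 𝒢 μ) (hT : T.IsNormal μ) (c : ℤ)
    (p : T.Limit) (X Y Z : L) : covD μ X (fun p' : T.Limit => gamma μ p' c Z Y) p =
      -covD μ X (fun p' : T.Limit => gamma μ p' c Y Z) p := by
  have h := (hasCovDeriv_gamma h𝒢 hT c p X Y Z).neg
  simp only [← gamma_swap h𝒢 hT] at h
  exact h.covD_eq h𝒢 hT

lemma covD_zero (h𝒢 : IsTransitive 𝒢 μ) (hT : T.IsNormal μ) (p : T.Limit) (X : L) :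
    covD μ X (fun _ : T.Limit => (0 : L)) p = 0 := by
  refine HasCovDeriv.covD_eq h𝒢 hT ⟨0, fun _ => 0, fun _ => rfl, fun φ => ?_⟩
  simp only [map_zero]
  refine ⟨mdifferentiableAt_const, ?_⟩
  rw [mfderiv_const]
  rfl

/-- The components of the structure function are smooth. -/
lemma smoothLim_gamma (h𝒢 : IsTransitive 𝒢 μ) (hT : T.IsNormal μ) (c : ℤ) (X Y : L) :
    SmoothLim (fun z : T.Limit => gamma μ z c X Y) := by
  set N := (c + 2 * μ + 2).toNat with hNdef
  have hN : c + 2 * μ + 2 ≤ N := by omega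
  -- The function on `Q N` is defined with an arbitrary lift of each point. Near q it equals the
  -- function built from the lift based at `lam q`, for which the local model gives smoothness.
  choose lam hlam using exists_limit hT N
  refine ⟨N, fun q => gamma μ (lam q) c X Y, fun z => gamma_congr h𝒢 hT (hlam _).symm hN X Y,
    fun φ q _ => ContMDiffAt.contMDiffWithinAt ?_⟩
  have h1 : ∀ q', gamma μ (lam q') c X Y = gamma μ (lift hT (lam q) N q') c X Y := fun q' =>
    gamma_congr h𝒢 hT ((hlam q').trans (lift_apply _ _ _ _).symm) hN X Y
  simp only [h1]
  have h2 := contDiffAt_gamma h𝒢 hT hN (locBase_mem (lam q) N) X Y φ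
  have h3 := contMDiffAt_of_chart (f := fun q' => φ (gamma μ (lift hT (lam q) N q') c X Y))
    ((lam q).1 N) h2
  rwa [hlam q] at h3

end CovariantDerivative

/-! ### The Bianchi identity. -/

section Bianchi

open Topology

variable {T : TowerData 𝒢 (d := d) (e := e) Q G} {μ : ℕ}

/-- The `𝔤_c`-component of the canonical form in the local model. -/
def locTheta (hT : T.IsNormal μ) (p : T.Limit) (N : ℕ) (c : ℤ) (y v : EuclideanSpace ℝ (Fin (d N))) :
    L :=
  T.theta c (c + μ).toNat ((locZ hT p N y).1 ((c + μ).toNat + 1))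
    (locD hT p N ((c + μ).toNat + 1) y v)

/-- The canonical form in the local model, truncated to degrees in `[-μ, n)`. -/
def locThetaSum (hT : T.IsNormal μ) (p : T.Limit) (N : ℕ) (n : ℤ)
    (y v : EuclideanSpace ℝ (Fin (d N))) : L :=
  ∑ c ∈ Finset.Ico (-(μ : ℤ)) n, locTheta hT p N c y v

lemma locTheta_eq_comp (h𝒢 : IsTransitive 𝒢 μ) {hT : T.IsNormal μ} {p : T.Limit} {N : ℕ} {c : ℤ}
    (hN : c + μ + 1 ≤ N) {y v : EuclideanSpace ℝ (Fin (d N))} (hy : y ∈ locDom p N)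
    {X : L} (hX : LocRel hT p N y v X) : locTheta hT p N c y v = comp 𝒢 c X := by
  rcases bot_or_level h𝒢 c with hb | ⟨m, h1, h2⟩
  · rw [comp_eq_zero_of_bot hb]
    exact comp_eq_zero_of_bot hb _
  · obtain rfl : (c + μ).toNat = m := by omega
    rw [locTheta, hX.locD_eq h𝒢 hy (by omega), theta_vecL h𝒢 hT _ h1.le h2]

/-- Replaces the parallelism coefficients X of a fixed coordinate vector v, which vary with the
point, by a smooth function with values in a finite dimensional space. -/
lemma locThetaSum_eq_trunc (h𝒢 : IsTransitive 𝒢 μ) {hT : T.IsNormal μ} {p : T.Limit} {N : ℕ}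
    {n : ℤ} (hN : n + μ ≤ N) {y v : EuclideanSpace ℝ (Fin (d N))} (hy : y ∈ locDom p N)
    {X : L} (hX : LocRel hT p N y v X) : locThetaSum hT p N n y v = trunc 𝒢 μ n X := by
  rw [locThetaSum, trunc_apply]
  refine Finset.sum_congr rfl fun c hc => ?_
  rw [Finset.mem_Ico] at hc
  exact locTheta_eq_comp h𝒢 (by omega) hy hX

lemma locThetaSum_mem (hT : T.IsNormal μ) (p : T.Limit) (N : ℕ)
    (n : ℤ) (y v : EuclideanSpace ℝ (Fin (d N))) :
    locThetaSum hT p N n y v ∈ (Finset.Ico (-(μ : ℤ)) n).sup 𝒢 :=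
  Submodule.sum_mem _ fun c hc => (Finset.le_sup (f := 𝒢) hc) (comp_mem 𝒢 c _)

lemma contDiffAt_locTheta (h𝒢 : IsTransitive 𝒢 μ) (hT : T.IsNormal μ) {p : T.Limit} {N : ℕ} {c : ℤ}
    (hN : c + μ + 1 ≤ N) {y : EuclideanSpace ℝ (Fin (d N))} (hy : y ∈ locDom p N)
    (v : EuclideanSpace ℝ (Fin (d N))) (φ : Module.Dual ℝ L) :
    ContDiffAt ℝ ∞ (fun t => φ (locTheta hT p N c t v)) y := by
  rcases bot_or_level h𝒢 c with hb | ⟨m, h1, h2⟩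
  · have : (fun t => φ (locTheta hT p N c t v)) = fun _ => 0 := by
      funext t
      have : locTheta hT p N c t v = 0 := comp_eq_zero_of_bot hb _
      rw [this, map_zero]
    rw [this]
    exact contDiffAt_const
  · obtain rfl : (c + μ).toNat = m := by omega
    exact contDiffAt_theta h𝒢 hT h1 h2 (by omega) hy v φ

lemma contDiffAt_locThetaSum (h𝒢 : IsTransitive 𝒢 μ) (hT : T.IsNormal μ) {p : T.Limit} {N : ℕ}
    {n : ℤ} (hN : n + μ ≤ N) {y : EuclideanSpace ℝ (Fin (d N))} (hy : y ∈ locDom p N)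
    (v : EuclideanSpace ℝ (Fin (d N))) (φ : Module.Dual ℝ L) :
    ContDiffAt ℝ ∞ (fun t => φ (locThetaSum hT p N n t v)) y := by
  simp only [locThetaSum, map_sum]
  refine ContDiffAt.sum fun c hc => ?_
  rw [Finset.mem_Ico] at hc
  exact contDiffAt_locTheta h𝒢 hT (by omega) hy v φ

/-- The structure equation with the level eliminated, so that degrees with 𝔤_c = 0 are covered as
well. -/
lemma locTheta_structure (h𝒢 : IsTransitive 𝒢 μ) (hT : T.IsNormal μ) {p : T.Limit} {N : ℕ} {c : ℤ}
    (hN : c + μ + 1 ≤ N) {y v w : EuclideanSpace ℝ (Fin (d N))} (hy : y ∈ locDom p N) {X Y : L}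
    (hX : LocRel hT p N y v X) (hY : LocRel hT p N y w Y) (φ : Module.Dual ℝ L) :
    fderiv ℝ (fun t => φ (locTheta hT p N c t w)) y v -
      fderiv ℝ (fun t => φ (locTheta hT p N c t v)) y w =
      -φ (gamma μ (locZ hT p N y) c X Y) := by
  rcases bot_or_level h𝒢 c with hb | ⟨m, h1, h2⟩
  · have : ∀ v, (fun t => φ (locTheta hT p N c t v)) = fun _ => 0 := by
      intro v
      funext t
      have : locTheta hT p N c t v = 0 := comp_eq_zero_of_bot hb _
      rw [this, map_zero]
    rw [this, this, gamma_eq_zero_of_bot hb]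
    simp
  · obtain rfl : (c + μ).toNat = m := by omega
    exact structure_equation h𝒢 hT h1 h2 (by omega) hy hX hY φ

/-- The sum of the components of degree in `[-μ, n)` of the structure function. -/
def gammaSum (z : T.Limit) (μ : ℕ) (n : ℤ) (X Y : L) : L :=
  ∑ c ∈ Finset.Ico (-(μ : ℤ)) n, gamma μ z c X Y

/-- The derivatives of the truncated canonical form. -/
lemma exists_deriv_locThetaSum (h𝒢 : IsTransitive 𝒢 μ) (hT : T.IsNormal μ) (p : T.Limit) {N : ℕ}
    {n : ℤ} (hN : n + μ ≤ N) : ∃ l : EuclideanSpace ℝ (Fin (d N)) →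
      EuclideanSpace ℝ (Fin (d N)) → L,
      (∀ u v, l u v ∈ (Finset.Ico (-(μ : ℤ)) n).sup 𝒢) ∧
      (∀ u v, ∀ φ : Module.Dual ℝ L,
        DifferentiableAt ℝ (fun t => φ (locThetaSum hT p N n t v)) (locBase p N) ∧
        fderiv ℝ (fun t => φ (locThetaSum hT p N n t v)) (locBase p N) u = φ (l u v)) ∧
      ∀ u v X Y, LocRel hT p N (locBase p N) u X → LocRel hT p N (locBase p N) v Y →
        l u v - l v u = -gammaSum p μ n X Y := by
  have hfd : ∀ c, FiniteDimensional ℝ (𝒢 c) := finiteDimensional_grade h𝒢 T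
  have hy := locBase_mem p N
  have h1 : ∀ u v : EuclideanSpace ℝ (Fin (d N)), ∃ l ∈ (Finset.Ico (-(μ : ℤ)) n).sup 𝒢,
      HasDerivAlong (n := d N) (fun t => locThetaSum hT p N n t v) (locBase p N) u l := by
    intro u v
    refine exists_hasDerivAlong _ (fun t => locThetaSum_mem hT p N n t v) (fun φ => ?_) u
    rw [mdifferentiableAt_iff_differentiableAt]
    exact (contDiffAt_locThetaSum h𝒢 hT hN hy v φ).differentiableAt (by simp)
  choose l hl1 hl2 using h1
  have hl3 := fun u v => hasDerivAlong_euclidean.1 (hl2 u v)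
  refine ⟨l, hl1, hl3, fun u v X Y hX hY => eq_of_forall_dual fun φ => ?_⟩
  have h2 : ∀ u v : EuclideanSpace ℝ (Fin (d N)),
      fderiv ℝ (fun t => φ (locThetaSum hT p N n t v)) (locBase p N) u =
      ∑ c ∈ Finset.Ico (-(μ : ℤ)) n, fderiv ℝ (fun t => φ (locTheta hT p N c t v))
        (locBase p N) u := by
    intro u v
    simp only [locThetaSum, map_sum]
    rw [fderiv_fun_sum]
    · simp
    · intro c hc
      rw [Finset.mem_Ico] at hc
      exact (contDiffAt_locTheta h𝒢 hT (by omega) hy v φ).differentiableAt (by simp)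
  rw [map_sub, ← (hl3 u v φ).2, ← (hl3 v u φ).2, h2, h2, map_neg, gammaSum, map_sum,
    ← Finset.sum_sub_distrib, ← Finset.sum_neg_distrib]
  refine Finset.sum_congr rfl fun c hc => ?_
  rw [Finset.mem_Ico] at hc
  rw [locTheta_structure h𝒢 hT (by omega) hy hX hY φ, locZ_base]

/-- The Bianchi identity. -/
lemma bianchi (h𝒢 : IsTransitive 𝒢 μ) (hT : T.IsNormal μ) (p : T.Limit) (c : ℤ) (X Y Z : L) :
    (gamma μ p c (gammaSum p μ (c + μ + 1) X Y) Z -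
      covD μ Z (fun p' : T.Limit => gamma μ p' c X Y) p) +
    (gamma μ p c (gammaSum p μ (c + μ + 1) Y Z) X -
      covD μ X (fun p' : T.Limit => gamma μ p' c Y Z) p) +
    (gamma μ p c (gammaSum p μ (c + μ + 1) Z X) Y -
      covD μ Y (fun p' : T.Limit => gamma μ p' c Z X) p) = 0 := by
  rcases bot_or_level h𝒢 c with hb | ⟨m, h1, h2⟩
  · simp [gamma_eq_zero_of_bot hb, covD_zero h𝒢 hT]
  have hfd : ∀ c, FiniteDimensional ℝ (𝒢 c) := finiteDimensional_grade h𝒢 T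
  obtain ⟨N, hNdef⟩ : ∃ N : ℕ, (N : ℤ) = c + 2 * μ + 2 := ⟨(c + 2 * μ + 2).toNat, by omega⟩
  -- γ_c ignores degrees ≥ n in its arguments, so θ may be truncated below n; its components there
  -- live at levels ≤ N.
  set n : ℤ := c + μ + 1 with hn
  have hN : c + 2 * μ + 2 ≤ N := hNdef.ge
  have hy := locBase_mem p N
  obtain ⟨u, hu⟩ := exists_locRel_vector hT p hy X
  obtain ⟨v, hv⟩ := exists_locRel_vector hT p hy Y
  obtain ⟨w, hw⟩ := exists_locRel_vector hT p hy Z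
  obtain ⟨l, hlS, hl, hlγ⟩ := exists_deriv_locThetaSum h𝒢 hT p (N := N) (n := n) (by omega)
  refine eq_of_forall_dual fun φ => ?_
  -- d(dθ_c) = 0 on the constant coordinate fields u, v, w, which commute.
  have hcyc := fderiv_fderiv_cyclic (a := fun t w => φ (locTheta hT p N c t w))
    (y := locBase p N)
    (fun w => (contDiffAt_locTheta h𝒢 hT (by omega) hy w φ).of_le two_le_infty) u v w
  -- Near the base point dθ_c(v,w) = −γ_c(θ(v),θ(w)). Differentiating along u gives one term from
  -- γ_c, which is the covariant derivative, and one from each argument.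
  have key : ∀ (u v w : EuclideanSpace ℝ (Fin (d N))) (X Y Z : L), LocRel hT p N (locBase p N) u X →
      LocRel hT p N (locBase p N) v Y → LocRel hT p N (locBase p N) w Z →
      fderiv ℝ (fun t => fderiv ℝ (fun t => φ (locTheta hT p N c t w)) t v -
        fderiv ℝ (fun t => φ (locTheta hT p N c t v)) t w) (locBase p N) u =
      -(φ (covD μ X (fun p' : T.Limit => gamma μ p' c Y Z) p) +
        φ (gamma μ p c (trunc 𝒢 μ n Y) (l u w)) + φ (gamma μ p c (l u v) (trunc 𝒢 μ n Z))) := by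
    intro u v w X Y Z hX hY hZ
    have hev : (fun t => fderiv ℝ (fun t => φ (locTheta hT p N c t w)) t v -
        fderiv ℝ (fun t => φ (locTheta hT p N c t v)) t w) =ᶠ[𝓝 (locBase p N)]
        fun t => -φ (gamma μ (locZ hT p N t) c (locThetaSum hT p N n t v)
          (locThetaSum hT p N n t w)) := by
      filter_upwards [eventually_locDom hy] with t ht
      obtain ⟨Y', hY'⟩ := exists_locRel h𝒢 hT p N t v
      obtain ⟨Z', hZ'⟩ := exists_locRel h𝒢 hT p N t w
      rw [locTheta_structure h𝒢 hT (by omega) ht hY' hZ' φ,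
        locThetaSum_eq_trunc h𝒢 (by omega) ht hY', locThetaSum_eq_trunc h𝒢 (by omega) ht hZ',
        gamma_trunc h𝒢 hT _ le_rfl]
    rw [hev.fderiv_eq, fderiv_fun_neg]
    have hYt := locThetaSum_eq_trunc h𝒢 (n := n) (by omega) hy hY
    have hZt := locThetaSum_eq_trunc h𝒢 (n := n) (by omega) hy hZ
    have hdiff : ∀ x x', DifferentiableAt ℝ (fun t => φ (gamma μ (locZ hT p N t) c x x'))
        (locBase p N) := fun x x' =>
      (contDiffAt_gamma h𝒢 hT hN hy x x' φ).differentiableAt (by simp)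
    -- The product rule for the bilinear γ_c is applied to the two slots in turn: `hin` for the
    -- second, `hout` for the first.
    have hin : ∀ x, _ := fun x => fderiv_pairing ((Finset.Ico (-(μ : ℤ)) n).sup 𝒢)
      (h := fun t => φ ∘ₗ gammaL h𝒢 hT (locZ hT p N t) c x)
      (f := fun t => locThetaSum hT p N n t w) (fun t => locThetaSum_mem hT p N n t w)
      (hlS u w) (fun x' => hdiff x x') (hl u w)
    have hout := fderiv_pairing ((Finset.Ico (-(μ : ℤ)) n).sup 𝒢)
      (h := fun t => φ ∘ₗ (gammaL h𝒢 hT (locZ hT p N t) c).flip (locThetaSum hT p N n t w))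
      (f := fun t => locThetaSum hT p N n t v) (fun t => locThetaSum_mem hT p N n t v)
      (hlS u v) (fun x => (hin x).1) (hl u v)
    have h3 := hout.2
    have h4 := (hin (trunc 𝒢 μ n Y)).2
    simp only [LinearMap.comp_apply, LinearMap.flip_apply, gammaL_apply, hYt, hZt, locZ_base]
      at h3 h4
    rw [neg_apply, h3, h4]
    congr 3
    rw [(covD_gamma h𝒢 hT hN p Y Z hX).2.2 φ]
    simp only [gamma_trunc h𝒢 hT _ (le_refl n)]
  rw [key u v w X Y Z hu hv hw, key v w u Y Z X hv hw hu, key w u v Z X Y hw hu hv] at hcyc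
  -- In the cyclic sum the derivatives of θ occur in antisymmetric pairs, and `hlγ` turns each pair
  -- into −γ(X,Y). This produces the quadratic terms.
  have hsub : ∀ (u v : EuclideanSpace ℝ (Fin (d N))) (X Y Z : L),
      LocRel hT p N (locBase p N) u X → LocRel hT p N (locBase p N) v Y →
      φ (gamma μ p c (l u v) (trunc 𝒢 μ n Z)) + φ (gamma μ p c (trunc 𝒢 μ n Z) (l v u)) =
        -φ (gamma μ p c (gammaSum p μ n X Y) Z) := by
    intro u v X Y Z hX hY
    have h3 : gamma μ p c (gammaSum p μ n X Y) Z =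
        gamma μ p c (gammaSum p μ n X Y) (trunc 𝒢 μ n Z) := by
      have h5 := gamma_eq_zero_of_mem_algFilt h𝒢 hT p
        (algFilt_anti 𝒢 (le_refl n) (sub_trunc_mem n h𝒢.depth Z)) (gammaSum p μ n X Y)
      rw [gamma_swap h𝒢 hT, ← gammaL_apply h𝒢 hT, map_sub, gammaL_apply, gammaL_apply,
        neg_eq_zero, sub_eq_zero] at h5
      exact h5
    rw [h3, gamma_swap h𝒢 hT p c (l v u), map_neg, ← sub_eq_add_neg, ← map_sub, ← map_neg,
      ← gammaL_apply h𝒢 hT, ← gammaL_apply h𝒢 hT, ← gammaL_apply h𝒢 hT, ← LinearMap.sub_apply,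
      ← LinearMap.neg_apply, ← map_sub, ← map_neg, hlγ u v X Y hX hY]
  have hs1 := hsub u v X Y Z hu hv
  have hs2 := hsub v w Y Z X hv hw
  have hs3 := hsub w u Z X Y hw hu
  simp only [map_add, map_sub, map_zero]
  linarith

end Bianchi

end TowerData

/-! ### Exterior derivatives and brackets of vector fields. -/

section FormBracket

open Topology

/-- `da(V, V') = -a([V, V'])` for a 1-form with constant values on `V` and `V'`. -/
lemma fderiv_form_of_const {E : Type*} [NormedAddCommGroup E] [NormedSpace ℝ E] {a : E → E →L[ℝ] ℝ}
    {c c' : E → E} {y : E} {r r' : ℝ} (ha : DifferentiableAt ℝ a y) (hc : DifferentiableAt ℝ c y)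
    (hc' : DifferentiableAt ℝ c' y) (hr : ∀ᶠ t in 𝓝 y, a t (c t) = r)
    (hr' : ∀ᶠ t in 𝓝 y, a t (c' t) = r') :
    fderiv ℝ a y (c y) (c' y) - fderiv ℝ a y (c' y) (c y) =
      -a y (fderiv ℝ c' y (c y) - fderiv ℝ c y (c' y)) := by
  -- Differentiate the locally constant function a(c): the derivative of a evaluated on c is minus a
  -- evaluated on the derivative of c.
  have key : ∀ {c : E → E} {r : ℝ}, DifferentiableAt ℝ c y → (∀ᶠ t in 𝓝 y, a t (c t) = r) →
      ∀ ξ, fderiv ℝ a y ξ (c y) + a y (fderiv ℝ c y ξ) = 0 := by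
    intro c r hc hr ξ
    have h1 := (ha.hasFDerivAt.clm_apply hc.hasFDerivAt).fderiv
    rw [Filter.EventuallyEq.fderiv_eq (f₁ := fun t => a t (c t)) (f := fun _ => r) hr] at h1
    have h2 := congrArg (fun f : E →L[ℝ] ℝ => f ξ) h1
    simp at h2
    linarith
  rw [map_sub]
  linarith [key hc' hr' (c y), key hc hr (c' y)]

variable {n : ℕ} {M : Type v} [TopologicalSpace M] [ChartedSpace (EuclideanSpace ℝ (Fin n)) M]
variable [IsManifold (𝓡 n) ∞ M]

/-- `dα(V, V') = -α([V, V'])` if `α(V)` and `α(V')` are locally constant. -/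
lemma dForm_eq_neg_mlieBracket {α : ∀ q : M, TangentSpace (𝓡 n) q →ₗ[ℝ] ℝ} {x : M}
    (hα : SmoothFormAt α x) {V V' : ∀ q : M, TangentSpace (𝓡 n) q} {r r' : ℝ}
    (hV : ContMDiffAt (𝓡 n) (𝓡 n).tangent ∞ (fun q => (⟨q, V q⟩ : TangentBundle (𝓡 n) M)) x)
    (hV' : ContMDiffAt (𝓡 n) (𝓡 n).tangent ∞ (fun q => (⟨q, V' q⟩ : TangentBundle (𝓡 n) M)) x)
    (hr : ∀ᶠ q in 𝓝 x, α q (V q) = r) (hr' : ∀ᶠ q in 𝓝 x, α q (V' q) = r') :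
    dForm α x (V x) (V' x) = -α x (VectorField.mlieBracket (𝓡 n) V V' x) := by
  set e := extChartAt (𝓡 n) x with he
  have hex : e.symm (e x) = x := e.left_inv (mem_extChartAt_source x)
  have htgt : ∀ᶠ t in 𝓝 (e x), t ∈ e.target := extChartAt_target_mem_nhds (I := 𝓡 n) x
  have hinv : ∀ t ∈ e.target, (mfderiv 𝓘(ℝ, EuclideanSpace ℝ (Fin n)) (𝓡 n) e.symm t).IsInvertible := by
    intro t ht
    have h2 := isInvertible_mfderivWithin_extChartAt_symm ht
    rwa [ModelWithCorners.range_eq_univ, mfderivWithin_univ] at h2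
  -- The coordinate expression of a vector field, written through the inverse of the chart
  -- parametrization because this is how `mlieBracket` is defined.
  let c : (∀ q : M, TangentSpace (𝓡 n) q) → EuclideanSpace ℝ (Fin n) → EuclideanSpace ℝ (Fin n) :=
    fun V t => (mfderiv 𝓘(ℝ, EuclideanSpace ℝ (Fin n)) (𝓡 n) e.symm t).inverse (V (e.symm t))
  have hD1 : mfderiv (𝓡 n) 𝓘(ℝ, EuclideanSpace ℝ (Fin n)) e x = ContinuousLinearMap.id ℝ _ :=
    mfderiv_extChartAt_self
  have hcomp : ∀ t ∈ e.target, ∀ ξ : EuclideanSpace ℝ (Fin n),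
      mfderiv 𝓘(ℝ, EuclideanSpace ℝ (Fin n)) (𝓡 n) e.symm t
        (mfderiv (𝓡 n) 𝓘(ℝ, EuclideanSpace ℝ (Fin n)) e (e.symm t) ξ) = ξ := by
    intro t ht ξ
    have h := mfderivWithin_extChartAt_symm_comp_mfderiv_extChartAt' (I := 𝓡 n) (x := x) (y := e.symm t)
      (e.map_target ht)
    rw [ModelWithCorners.range_eq_univ, mfderivWithin_univ, ← he, e.right_inv ht] at h
    exact congrArg (fun f : EuclideanSpace ℝ (Fin n) →L[ℝ] EuclideanSpace ℝ (Fin n) => f ξ) h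
  have hc : ∀ V t, t ∈ e.target → c V t =
      mfderiv (𝓡 n) 𝓘(ℝ, EuclideanSpace ℝ (Fin n)) e (e.symm t) (V (e.symm t)) := by
    intro V t ht
    have h1 := hcomp t ht (V (e.symm t))
    have h2 : c V t = (mfderiv 𝓘(ℝ, EuclideanSpace ℝ (Fin n)) (𝓡 n) e.symm t).inverse
      (mfderiv 𝓘(ℝ, EuclideanSpace ℝ (Fin n)) (𝓡 n) e.symm t
        (mfderiv (𝓡 n) 𝓘(ℝ, EuclideanSpace ℝ (Fin n)) e (e.symm t) (V (e.symm t)))) :=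
      congrArg _ h1.symm
    rw [h2]
    exact (hinv t ht).inverse_apply_eq.2 rfl
  have hcx : ∀ V, c V (e x) = V x := by
    intro V
    rw [hc V _ (mem_extChartAt_target x)]
    have h3 : mfderiv (𝓡 n) 𝓘(ℝ, EuclideanSpace ℝ (Fin n)) e (e.symm (e x)) (V (e.symm (e x))) =
      mfderiv (𝓡 n) 𝓘(ℝ, EuclideanSpace ℝ (Fin n)) e x (V x) := by rw [hex]
    rw [h3, hD1]
    rfl
  have hsm : ∀ V : ∀ q : M, TangentSpace (𝓡 n) q, ContMDiffAt (𝓡 n) (𝓡 n).tangent ∞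
      (fun q => (⟨q, V q⟩ : TangentBundle (𝓡 n) M)) x → DifferentiableAt ℝ (c V) (e x) := by
    intro V hV
    have h1 : ContMDiffAt 𝓘(ℝ, EuclideanSpace ℝ (Fin n)) (𝓡 n).tangent ∞
        (fun t => (⟨e.symm t, V (e.symm t)⟩ : TangentBundle (𝓡 n) M)) (e x) := by
      rw [← hex] at hV
      exact hV.comp (e x) (contMDiffAt_extChartAt_symm (mem_extChartAt_target x))
    have h2 := (contDiffAt_chart_vector h1).1
    rw [hex] at h2
    refine (h2.congr_of_eventuallyEq ?_).differentiableAt (by simp)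
    filter_upwards [htgt] with t ht
    exact hc V t ht
  have hconst : ∀ (V : ∀ q : M, TangentSpace (𝓡 n) q) (r : ℝ), (∀ᶠ q in 𝓝 x, α q (V q) = r) →
      ∀ᶠ t in 𝓝 (e x), chartForm α x t (c V t) = r := by
    intro V r hr
    have h3 : ∀ᶠ t in 𝓝 (e x), α (e.symm t) (V (e.symm t)) = r := by
      have := (continuousAt_extChartAt_symm (I := 𝓡 n) x).tendsto
      rw [← he, hex] at this
      exact this.eventually hr
    filter_upwards [htgt, h3] with t ht h3
    refine Eq.trans ?_ h3
    refine (congrArg (chartForm α x t) (hc V t ht)).trans ?_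
    exact congrArg (α (e.symm t)) (hcomp t ht _)
  have hbr : (VectorField.mlieBracket (𝓡 n) V V' x : EuclideanSpace ℝ (Fin n)) =
      fderiv ℝ (c V') (e x) (c V (e x)) - fderiv ℝ (c V) (e x) (c V' (e x)) := by
    rw [VectorField.mlieBracket, VectorField.mlieBracketWithin_apply]
    simp only [ModelWithCorners.range_eq_univ, Set.preimage_univ, Set.univ_inter,
      VectorField.mpullbackWithin_univ]
    rw [← he, hD1]
    refine (congrArg (fun f : EuclideanSpace ℝ (Fin n) →L[ℝ] EuclideanSpace ℝ (Fin n) =>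
      f (VectorField.lieBracketWithin ℝ (c V) (c V') Set.univ (e x)))
      (ContinuousLinearMap.inverse_id (R := ℝ) (M := EuclideanSpace ℝ (Fin n)))).trans ?_
    rw [VectorField.lieBracketWithin_univ]
    rfl
  have hax : ∀ ξ : EuclideanSpace ℝ (Fin n), chartForm α x (e x) ξ = α x ξ := by
    intro ξ
    rw [chartForm_apply]
    refine form_congr (fun q => α q) hex ?_
    have h := hcomp (e x) (mem_extChartAt_target x) ξ
    rw [hex] at h
    refine Eq.trans ?_ h
    refine congrArg (mfderiv 𝓘(ℝ, EuclideanSpace ℝ (Fin n)) (𝓡 n) e.symm (e x)) ?_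
    exact (congrArg (fun f : EuclideanSpace ℝ (Fin n) →L[ℝ] EuclideanSpace ℝ (Fin n) => f ξ) hD1).symm
  have hmain := fderiv_form_of_const (hα.differentiableAt (by simp)) (hsm V hV) (hsm V' hV')
    (hconst V r hr) (hconst V' r' hr')
  refine (congrArg₂ (dForm α x) (hcx V).symm (hcx V').symm).trans (hmain.trans ?_)
  exact congrArg Neg.neg ((hax _).trans (congrArg (fun ξ : EuclideanSpace ℝ (Fin n) => α x ξ) hbr.symm))

end FormBracket

namespace TowerData

variable {L : Type u} [LieRing L] [LieAlgebra ℝ L]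
variable {𝒢 : ℤ → Submodule ℝ L} [GradedLieAlgebra 𝒢]
variable {d e : ℕ → ℕ}
variable {Q : ℕ → Type v} [∀ n, TopologicalSpace (Q n)]
  [∀ n, ChartedSpace (EuclideanSpace ℝ (Fin (d n))) (Q n)] [∀ n, IsManifold (𝓡 (d n)) ∞ (Q n)]
variable {G : ℕ → Type w} [∀ n, Group (G n)] [∀ n, TopologicalSpace (G n)]
  [∀ n, ChartedSpace (EuclideanSpace ℝ (Fin (e n))) (G n)] [∀ n, LieGroup (𝓡 (e n)) ∞ (G n)]

/-! ### Local sections of the frame bundles and their dual forms. -/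

section LocalSection

open Topology

variable {T : TowerData 𝒢 (d := d) (e := e) Q G} {μ : ℕ}

/-- A local section of `Q^{(n)} → Q^{(n-1)}` through `z₀`, a smooth family `ζ` of frames which
represents it, and the function `g` with `z = σ(π(z)) · g(z)`. -/
structure LocalSection (T : TowerData 𝒢 (d := d) (e := e) Q G) (n : ℕ) (z₀ : Q (n + 1)) where
  U : Set (Q n)
  σ : Q n → Q (n + 1)
  ζ : Q n → L →ₗ[ℝ] EuclideanSpace ℝ (Fin (d n))
  g : Q (n + 1) → G n
  isOpen : IsOpen U
  mem : T.π n z₀ ∈ U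
  section_base : σ (T.π n z₀) = z₀
  frame : ∀ q ∈ U, ζ q ∈ T.Fr n (σ q) q
  smooth : ∀ X, ContMDiffOn (𝓡 (d n)) (𝓡 (d n)).tangent ∞
    (fun q => (⟨q, ζ q X⟩ : TangentBundle (𝓡 (d n)) (Q n))) U
  smooth_g : ContMDiffAt (𝓡 (d (n + 1))) (𝓡 (e n)) ∞ g z₀
  act_g : ∀ z, T.π n z ∈ U → T.act n (σ (T.π n z)) (g z) = z
  g_act : ∀ a, g (T.act n z₀ a) = a

lemma exists_localSection (hT : T.IsNormal μ) (n : ℕ) (z₀ : Q (n + 1)) :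
    Nonempty (LocalSection T n z₀) := by
  have hp := (hT.subbundle n).principal
  obtain ⟨U₀, s, c, hU₀, hqU₀, hs, hc, hπs, hsc⟩ := hp.locally_trivial (T.π n z₀)
  obtain ⟨U₁, s', hU₁, hzU₁, hs'1, hs'2⟩ := (hT.subbundle n).smooth_frame z₀
  -- Translating the given section by the constant `c z₀` makes it pass through z₀.
  let σ : Q n → Q (n + 1) := fun q => T.act n (s q) (c z₀)
  have hσ : ContMDiffOn (𝓡 (d n)) (𝓡 (d (n + 1))) ∞ σ U₀ :=
    hp.smooth_act.comp_contMDiffOn (hs.prodMk contMDiffOn_const)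
  have hσπ : ∀ q ∈ U₀, T.π n (σ q) = q := fun q hq => (hp.π_act _ _).trans (hπs q hq)
  have hσ0 : σ (T.π n z₀) = z₀ := hsc z₀ hqU₀
  have hg : ∀ z, T.π n z ∈ U₀ → T.act n (σ (T.π n z)) ((c z₀)⁻¹ * c z) = z := by
    intro z hz
    rw [← hp.act_mul, mul_inv_cancel_left]
    exact hsc z hz
  refine ⟨⟨U₀ ∩ σ ⁻¹' U₁, σ, fun q => s' (σ q), fun z => (c z₀)⁻¹ * c z,
    hσ.continuousOn.isOpen_inter_preimage hU₀ hU₁, ⟨hqU₀, ?_⟩, hσ0, ?_, ?_, ?_, ?_, ?_⟩⟩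
  · rw [Set.mem_preimage, hσ0]
    exact hzU₁
  · exact fun q hq => mem_Fr_congr rfl (hσπ q hq.1) (hs'1 _ hq.2)
  · intro X
    refine ((hs'2 X).comp (hσ.mono Set.inter_subset_left) fun q hq => hq.2).congr fun q hq => ?_
    exact tangentBundle_mk_congr (hσπ q hq.1).symm rfl
  · have h1 : ContMDiffAt (𝓡 (d (n + 1))) (𝓡 (e n)) ∞ c z₀ :=
      hc.contMDiffAt ((hU₀.preimage hp.smooth_π.continuous).mem_nhds hqU₀)
    exact (contMDiff_mul_left (I := 𝓡 (e n)) (n := ∞) (a := (c z₀)⁻¹)).contMDiffAt.comp z₀ h1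
  · exact fun z hz => hg z hz.1
  -- Both a and the value of g at z₀ · a carry z₀ to z₀ · a, so simple transitivity identifies them.
  · intro a
    have h1 := hg (T.act n z₀ a) (by rw [hp.π_act]; exact hqU₀)
    rw [hp.π_act, hσ0] at h1
    obtain ⟨b, hb, hb'⟩ := hp.simply_transitive z₀ (T.act n z₀ a) (hp.π_act _ _).symm
    exact (hb' _ h1).trans (hb' a rfl).symm

open Classical in
/-- The `𝔤_u`-component of the inverse of a surjective frame. -/
def coframeL (𝒢 : ℤ → Submodule ℝ L) [GradedLieAlgebra 𝒢] {k : ℕ} (u : ℤ)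
    (ζ : L →ₗ[ℝ] EuclideanSpace ℝ (Fin k)) : EuclideanSpace ℝ (Fin k) →ₗ[ℝ] L :=
  if h : LinearMap.range ζ = ⊤ then
    comp 𝒢 u ∘ₗ (ζ.exists_rightInverse_of_surjective h).choose
  else 0

/-- The kernel of the frame is F^n, so components of degree u < n do not depend on the chosen right
inverse. -/
lemma coframeL_apply {n : ℕ} {q : Q n} {ζ : L →ₗ[ℝ] EuclideanSpace ℝ (Fin (d n))}
    (h : T.IsFilteredIso n q ζ) {u : ℤ} (hu : u < n) (X : L) :
    coframeL 𝒢 u ζ (ζ X) = comp 𝒢 u X := by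
  have hr : LinearMap.range ζ = ⊤ := LinearMap.range_eq_top.2 h.surj
  rw [coframeL, dif_pos hr, LinearMap.comp_apply, ← sub_eq_zero, ← map_sub]
  refine mem_algFilt.1 ?_ u hu
  rw [← h.eq_zero_iff, map_sub, sub_eq_zero]
  exact LinearMap.congr_fun (ζ.exists_rightInverse_of_surjective hr).choose_spec (ζ X)

lemma coframeL_eq_zero {n : ℕ} {q : Q n} {ζ : L →ₗ[ℝ] EuclideanSpace ℝ (Fin (d n))}
    (h : T.IsFilteredIso n q ζ) {u p : ℤ} (hu : u < n) (hp : u < p)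
    {ξ : EuclideanSpace ℝ (Fin (d n))} (hξ : ξ ∈ T.filt n p q) : coframeL 𝒢 u ζ ξ = 0 := by
  rw [← h.filt p] at hξ
  obtain ⟨X, hX, rfl⟩ := hξ
  exact (coframeL_apply h hu X).trans (mem_algFilt.1 hX u hp)

/-- The 1-forms dual to the frames of a local section are smooth. -/
lemma LocalSection.smoothFormAt (hT : T.IsNormal μ) {n : ℕ} {z₀ : Q (n + 1)}
    (S : LocalSection T n z₀) {u : ℤ} (hu : u < n) (φ : Module.Dual ℝ L) {q : Q n} (hq : q ∈ S.U) :
    SmoothFormAt (n := d n) (fun q => φ ∘ₗ coframeL 𝒢 u (S.ζ q)) q := by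
  refine contDiffAt_clm_of_apply fun w => ?_
  set e := extChartAt (𝓡 (d n)) q
  have hqe : e.symm (e q) = q := e.left_inv (mem_extChartAt_source q)
  have hsymm : ∀ᶠ t in 𝓝 (e q), ContMDiffAt 𝓘(ℝ, EuclideanSpace ℝ (Fin (d n)))
      (𝓡 (d n)) ∞ e.symm t := by
    filter_upwards [extChartAt_target_mem_nhds (I := 𝓡 (d n)) q] with t ht
    exact contMDiffAt_extChartAt_symm ht
  have hUe : ∀ᶠ t in 𝓝 (e q), e.symm t ∈ S.U :=
    hsymm.self_of_nhds.continuousAt.preimage_mem_nhds (S.isOpen.mem_nhds (by rwa [hqe]))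
  refine contDiffAt_coframe (n := d n) (G := e.symm) (s := fun t => S.ζ (e.symm t))
    (ξ := fun t => mfderiv 𝓘(ℝ, EuclideanSpace ℝ (Fin (d n))) (𝓡 (d n)) e.symm t w)
    (fun X => ?_) (contMDiffAt_velocity hsymm w) ?_ (comp 𝒢 u) ?_ φ
  · have h1 : ContMDiffAt (𝓡 (d n)) (𝓡 (d n)).tangent ∞
        (fun q => (⟨q, S.ζ q X⟩ : TangentBundle (𝓡 (d n)) (Q n))) (e.symm (e q)) := by
      rw [hqe]
      exact (S.smooth X).contMDiffAt (S.isOpen.mem_nhds hq)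
    exact h1.comp (e q) hsymm.self_of_nhds
  · exact (frame_isFilteredIso hT (S.frame _ hUe.self_of_nhds)).surj
  · filter_upwards [hUe] with t htU X hX
    have h2 := coframeL_apply (frame_isFilteredIso hT (S.frame _ htU)) hu X
    refine Eq.trans ?_ h2
    exact congrArg (coframeL 𝒢 u (S.ζ (e.symm t))) hX.symm

end LocalSection

end TowerData

namespace TowerData

variable {L : Type u} [LieRing L] [LieAlgebra ℝ L]
variable {𝒢 : ℤ → Submodule ℝ L} [GradedLieAlgebra 𝒢]
variable {d e : ℕ → ℕ}
variable {Q : ℕ → Type v} [∀ n, TopologicalSpace (Q n)]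
  [∀ n, ChartedSpace (EuclideanSpace ℝ (Fin (d n))) (Q n)] [∀ n, IsManifold (𝓡 (d n)) ∞ (Q n)]
variable {G : ℕ → Type w} [∀ n, Group (G n)] [∀ n, TopologicalSpace (G n)]
  [∀ n, ChartedSpace (EuclideanSpace ℝ (Fin (e n))) (G n)] [∀ n, LieGroup (𝓡 (e n)) ∞ (G n)]

/-! ### Comparison of the canonical frame with the frame of a local section. -/

section Comparison

open Topology

variable {T : TowerData 𝒢 (d := d) (e := e) Q G} {μ : ℕ}

lemma IsFilteredIso.map_mem {n : ℕ} {q : Q n} {ζ : L →ₗ[ℝ] TangentSpace (𝓡 (d n)) q}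
    (h : T.IsFilteredIso n q ζ) {p : ℤ} {X : L} (hX : X ∈ algFilt 𝒢 p) : ζ X ∈ T.filt n p q := by
  rw [← h.filt p]
  exact Submodule.mem_map_of_mem hX

lemma LocalSection.base_mem {n : ℕ} {p : T.Limit} (S : LocalSection T n (p.1 (n + 1))) :
    p.1 n ∈ S.U := by
  have := S.mem
  rwa [p.2 n] at this

lemma LocalSection.eventually_mem (hT : T.IsNormal μ) {n N : ℕ} {p : T.Limit}
    (S : LocalSection T n (p.1 (n + 1))) (hN : n ≤ N) :
    ∀ᶠ t in 𝓝 (locBase p N), (locZ hT p N t).1 n ∈ S.U := by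
  refine (loc_contMDiffAt hT hN (locBase_mem p N)).continuousAt.preimage_mem_nhds
    (S.isOpen.mem_nhds ?_)
  rw [locZ_base]
  exact S.base_mem

/-- The `𝔤_u`-component of the transformation from the canonical frame at `t` to the frame of a
local section. -/
def secH (hT : T.IsNormal μ) {n : ℕ} {p : T.Limit} (S : LocalSection T n (p.1 (n + 1))) (N : ℕ)
    (u : ℤ) (t : EuclideanSpace ℝ (Fin (d N))) : L →ₗ[ℝ] L :=
  coframeL 𝒢 u (S.ζ ((locZ hT p N t).1 n)) ∘ₗ vecL μ (locZ hT p N t) n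

lemma secH_apply (hT : T.IsNormal μ) {n : ℕ} {p : T.Limit} (S : LocalSection T n (p.1 (n + 1)))
    (N : ℕ) (u : ℤ) (t : EuclideanSpace ℝ (Fin (d N))) (X : L) : secH hT S N u t X =
      coframeL 𝒢 u (S.ζ ((locZ hT p N t).1 n)) (vecL μ (locZ hT p N t) n X) := rfl

lemma contDiffAt_secH (h𝒢 : IsTransitive 𝒢 μ) (hT : T.IsNormal μ) {n N : ℕ} {p : T.Limit}
    (S : LocalSection T n (p.1 (n + 1))) (hN : n + μ + 1 ≤ N) {u : ℤ} (hu : u < n)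
    (φ : Module.Dual ℝ L) (X : L) :
    ContDiffAt ℝ ∞ (fun t => φ (secH hT S N u t X)) (locBase p N) := by
  have hy := locBase_mem p N
  have hev := S.eventually_mem hT (N := N) (by omega)
  refine contDiffAt_coframe (n := d n) (G := fun t => (locZ hT p N t).1 n)
    (s := fun t => S.ζ ((locZ hT p N t).1 n)) (ξ := fun t => vecL μ (locZ hT p N t) n X)
    (fun X => ?_) (contMDiffAt_vecL h𝒢 hT hN hy X) ?_ (comp 𝒢 u) ?_ φ
  · have h1 : ContMDiffAt (𝓡 (d n)) (𝓡 (d n)).tangent ∞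
        (fun q => (⟨q, S.ζ q X⟩ : TangentBundle (𝓡 (d n)) (Q n)))
        ((locZ hT p N (locBase p N)).1 n) :=
      (S.smooth X).contMDiffAt (S.isOpen.mem_nhds hev.self_of_nhds)
    exact h1.comp (locBase p N) (loc_contMDiffAt hT (by omega) hy)
  · exact (frame_isFilteredIso hT (S.frame _ hev.self_of_nhds)).surj
  · filter_upwards [hev] with t ht X' hX'
    refine Eq.trans ?_ (coframeL_apply (frame_isFilteredIso hT (S.frame _ ht)) hu X')
    exact congrArg (coframeL 𝒢 u (S.ζ ((locZ hT p N t).1 n))) hX'.symm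

/-- The canonical frame at level n kills F^n, so the components of degree ≥ n do not contribute. -/
lemma secH_trunc (h𝒢 : IsTransitive 𝒢 μ) (hT : T.IsNormal μ) {n N : ℕ} {p : T.Limit}
    (S : LocalSection T n (p.1 (n + 1))) (u : ℤ) (t : EuclideanSpace ℝ (Fin (d N))) (X : L) :
    secH hT S N u t (trunc 𝒢 μ n X) = secH hT S N u t X := by
  rw [secH_apply, secH_apply]
  refine congrArg _ ?_
  rw [vecL_eq_iff h𝒢 hT, ← neg_sub]
  exact Submodule.neg_mem _ (sub_trunc_mem n h𝒢.depth X)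

/-- The structure function of a local section of the frame bundle in terms of the structure function
of the limit. -/
lemma dForm_section (h𝒢 : IsTransitive 𝒢 μ) (hT : T.IsNormal μ) {n N : ℕ} {p : T.Limit}
    (S : LocalSection T n (p.1 (n + 1))) (hN : n + μ + 1 ≤ N) {u : ℤ} (hu : u < n)
    (φ : Module.Dual ℝ L) {X Y : L} {v w : EuclideanSpace ℝ (Fin (d N))}
    (hX : LocRel hT p N (locBase p N) v X) (hY : LocRel hT p N (locBase p N) w Y) :
    dForm (n := d n) (fun q => φ ∘ₗ coframeL 𝒢 u (S.ζ q)) (p.1 n) (vecL μ p n X) (vecL μ p n Y) =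
      fderiv ℝ (fun t => φ (secH hT S N u t Y)) (locBase p N) v -
      fderiv ℝ (fun t => φ (secH hT S N u t X)) (locBase p N) w -
      φ (secH hT S N u (locBase p N) (gammaSum p μ n X Y)) := by
  have hfd : ∀ c, FiniteDimensional ℝ (𝒢 c) := finiteDimensional_grade h𝒢 T
  have hy := locBase_mem p N
  have hF := loc_eventually_contMDiffAt hT (k := n) (by omega) hy
  have hzn : (locZ hT p N (locBase p N)).1 n = p.1 n := by rw [locZ_base]
  have h1 := fderiv_form_pullback (n := d n) (F := fun t => (locZ hT p N t).1 n)
    (y := locBase p N) (α := fun q => φ ∘ₗ coframeL 𝒢 u (S.ζ q))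
    (by
      have := S.smoothFormAt hT hu φ S.base_mem
      rwa [← hzn] at this) hF v w
  have h2 : dForm (n := d n) (fun q => φ ∘ₗ coframeL 𝒢 u (S.ζ q)) (p.1 n)
      (vecL μ p n X) (vecL μ p n Y) = dForm (n := d n) (fun q => φ ∘ₗ coframeL 𝒢 u (S.ζ q))
      ((locZ hT p N (locBase p N)).1 n) (locD hT p N n (locBase p N) v)
      (locD hT p N n (locBase p N) w) := by
    rw [hX.locD_eq h𝒢 hy (by omega), hY.locD_eq h𝒢 hy (by omega), locZ_base]
  rw [h2]
  refine h1.symm.trans ?_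
  obtain ⟨l, hlS, hl, hlγ⟩ := exists_deriv_locThetaSum h𝒢 hT p (N := N) (n := n) (by omega)
  -- The coframe of the section pulls back to H θ with H = `secH`, and this is the product rule for
  -- it. Antisymmetrizing gives dH ∧ θ + H dθ, and the second term becomes −H γ.
  have key : ∀ (v w : EuclideanSpace ℝ (Fin (d N))) (Y : L), LocRel hT p N (locBase p N) w Y →
      fderiv ℝ (fun t => φ (coframeL 𝒢 u (S.ζ ((locZ hT p N t).1 n)) (locD hT p N n t w)))
        (locBase p N) v =
      fderiv ℝ (fun t => φ (secH hT S N u t Y)) (locBase p N) v +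
        φ (secH hT S N u (locBase p N) (l v w)) := by
    intro v w Y hY
    have hev : (fun t => φ (coframeL 𝒢 u (S.ζ ((locZ hT p N t).1 n)) (locD hT p N n t w)))
        =ᶠ[𝓝 (locBase p N)] fun t => φ (secH hT S N u t (locThetaSum hT p N n t w)) := by
      filter_upwards [eventually_locDom hy] with t ht
      obtain ⟨W, hW⟩ := exists_locRel h𝒢 hT p N t w
      rw [locThetaSum_eq_trunc h𝒢 (by omega) ht hW, secH_trunc h𝒢, secH_apply,
        hW.locD_eq h𝒢 ht (by omega)]
    have h3 := (fderiv_pairing ((Finset.Ico (-(μ : ℤ)) n).sup 𝒢)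
      (h := fun t => φ ∘ₗ secH hT S N u t)
      (f := fun t => locThetaSum hT p N n t w) (fun t => locThetaSum_mem hT p N n t w)
      (hlS v w) (fun x => (contDiffAt_secH h𝒢 hT S hN hu φ x).differentiableAt (by simp))
      (hl v w)).2
    simp only [LinearMap.comp_apply, locThetaSum_eq_trunc h𝒢 (n := n) (by omega) hy hY,
      secH_trunc h𝒢] at h3
    rw [hev.fderiv_eq, h3]
  have h4 := key v w Y hY
  have h5 := key w v X hX
  have h6 := hlγ v w X Y hX hY
  have h7 : φ (secH hT S N u (locBase p N) (l v w)) - φ (secH hT S N u (locBase p N) (l w v)) =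
      -φ (secH hT S N u (locBase p N) (gammaSum p μ n X Y)) := by
    rw [← map_sub, ← map_sub, h6, map_neg, map_neg]
  refine (congrArg₂ (fun a b : ℝ => a - b) h4 h5).trans ?_
  linarith

/-- The section frame moved by the group coordinate g lies in the class of the current point, as
does the canonical frame. On 𝔤_x they differ by F^{x+n+1}, which is invisible in degrees u ≤ x + n.
-/
lemma secH_eq_comp_rep (h𝒢 : IsTransitive 𝒢 μ) (hT : T.IsNormal μ) {n N : ℕ} {p : T.Limit}
    (S : LocalSection T n (p.1 (n + 1))) {u x : ℤ} (hu : u < n) (hux : u ≤ x + n)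
    {t : EuclideanSpace ℝ (Fin (d N))} (ht : (locZ hT p N t).1 n ∈ S.U) {X : L} (hX : X ∈ 𝒢 x) :
    secH hT S N u t X = comp 𝒢 u (T.rep n (S.g ((locZ hT p N t).1 (n + 1))) X) := by
  have hiso := frame_isFilteredIso hT (S.frame _ ht)
  have h1 := (hT.subbundle n).act_frame _ (S.g ((locZ hT p N t).1 (n + 1))) _ _ (S.frame _ ht)
  have h2 : T.act n (S.σ ((locZ hT p N t).1 n)) (S.g ((locZ hT p N t).1 (n + 1))) =
      (locZ hT p N t).1 (n + 1) := by
    have h3 := (locZ hT p N t).2 n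
    have h4 := S.act_g ((locZ hT p N t).1 (n + 1))
    rw [h3] at h4
    exact h4 ht
  rw [h2] at h1
  have h5 := frame_sub_mem_filt hT h1 (vecL_mem_Fr h𝒢 hT (locZ hT p N t) n) hX
  have h6 := coframeL_eq_zero hiso hu (by omega) h5
  rw [map_sub, sub_eq_zero] at h6
  refine h6.trans ?_
  exact coframeL_apply hiso hu _

/-- At the base point, the canonical frame and the frame of the section agree up to higher order. -/
lemma secH_base (h𝒢 : IsTransitive 𝒢 μ) (hT : T.IsNormal μ) {n N : ℕ} {p : T.Limit}
    (S : LocalSection T n (p.1 (n + 1))) {u x : ℤ} (hu : u < n) (hux : u ≤ x + n) {X : L}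
    (hX : X ∈ 𝒢 x) : secH hT S N u (locBase p N) X = comp 𝒢 u X := by
  rw [secH_apply, locZ_base]
  have h1 := S.frame _ S.base_mem
  have h2 : S.σ (p.1 n) = p.1 (n + 1) := by
    have := S.section_base
    rwa [p.2 n] at this
  rw [h2] at h1
  have hiso := frame_isFilteredIso hT h1
  have h5 := frame_sub_mem_filt hT h1 (vecL_mem_Fr h𝒢 hT p n) hX
  have h6 := coframeL_eq_zero hiso hu (by omega) h5
  rw [map_sub, sub_eq_zero] at h6
  refine h6.trans ?_
  exact coframeL_apply hiso hu _

/-- The components of low degree of an element are determined by its image under a filtered map which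
is the identity up to order `n`. -/
lemma comp_eq_of_filtered {n : ℕ} (hd : ∀ p : ℤ, p < -(μ : ℤ) → 𝒢 p = ⊥) {m : ℤ} (hm : m < n)
    {H : ℤ → L →ₗ[ℝ] L} (hH : ∀ u x, u < (n : ℤ) → u ≤ x + n → ∀ X ∈ 𝒢 x, H u X = comp 𝒢 u X)
    {s R : ℤ → L} (hs : ∀ c, s c ∈ 𝒢 c) (hR : ∀ c, R c ∈ 𝒢 c) (hR0 : ∀ c, c + n < m → R c = 0)
    (h : ∀ u ≤ m, H u (∑ c ∈ Finset.Ico (-(μ : ℤ)) n, s c) = R u) :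
    ∀ u ≤ m, s u = R u := by
  have key : ∀ k : ℕ, ∀ u : ℤ, u < -(μ : ℤ) + k → u ≤ m → s u = R u := by
    intro k
    induction k with
    | zero =>
      intro u hu _
      have hb := hd u (by simpa using hu)
      have h1 := hs u
      have h2 := hR u
      rw [hb, Submodule.mem_bot] at h1 h2
      rw [h1, h2]
    | succ k ih =>
      intro u hu hum
      by_cases hu' : u < -(μ : ℤ) + k
      · exact ih u hu' hum
      · have h1 := h u hum
        -- In degree u the summands with c ≥ u − n are seen unchanged, so only c = u survives among
        -- them. Those with c < u − n vanish by the induction hypothesis, because R does in these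
        -- degrees.
        rw [map_sum, Finset.sum_eq_single u] at h1
        · rw [hH u u (by omega) (by omega) _ (hs u), comp_of_mem (hs u)] at h1
          exact h1
        · intro c hc hcu
          rcases le_or_gt u (c + n) with h2 | h2
          · rw [hH u c (by omega) h2 _ (hs c), comp_of_mem_ne (hs c) hcu]
          · rw [ih c (by push_cast at hu; omega) (by omega), hR0 c (by omega), map_zero]
        · intro h2
          exact absurd (Finset.mem_Ico.2 ⟨by omega, by omega⟩) h2
  exact fun u hu => key ((u + μ).toNat + 1) u (by push_cast; omega) hu

/-- The derivative of `rep ∘ g` along a vertical vector of the absolute parallelism. -/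
lemma fderiv_rep (h𝒢 : IsTransitive 𝒢 μ) (hT : T.IsNormal μ) {n N : ℕ} {p : T.Limit}
    (S : LocalSection T n (p.1 (n + 1))) (hN : n + 1 ≤ N) {B : L} (hB : B ∈ 𝒢 (n : ℤ)) {X l : L}
    (hX : HasDerivAlong (n := e n) (fun a => T.rep n a X) 1 (T.lie n ⟨B, hB⟩) l)
    {v : EuclideanSpace ℝ (Fin (d N))} (hv : LocRel hT p N (locBase p N) v B)
    (φ : Module.Dual ℝ L) :
    fderiv ℝ (fun t => φ (T.rep n (S.g ((locZ hT p N t).1 (n + 1))) X)) (locBase p N) v = φ l := by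
  have hy := locBase_mem p N
  have hp := (hT.subbundle n).principal
  have hz : (locZ hT p N (locBase p N)).1 (n + 1) = p.1 (n + 1) := by rw [locZ_base]
  have hact0 : T.act n (p.1 (n + 1)) 1 = p.1 (n + 1) := hp.act_one _
  have hg0 : S.g (p.1 (n + 1)) = 1 := by
    have := S.g_act 1
    rwa [hact0] at this
  have hF : MDifferentiableAt 𝓘(ℝ, EuclideanSpace ℝ (Fin (d N))) (𝓡 (d (n + 1)))
      (fun t => (locZ hT p N t).1 (n + 1)) (locBase p N) :=
    (loc_contMDiffAt hT hN hy).mdifferentiableAt (by simp)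
  have hg : MDifferentiableAt (𝓡 (d (n + 1))) (𝓡 (e n)) S.g (p.1 (n + 1)) :=
    S.smooth_g.mdifferentiableAt (by simp)
  have hf := (hX φ).1
  have hact : MDifferentiableAt (𝓡 (e n)) (𝓡 (d (n + 1))) (fun a => T.act n (p.1 (n + 1)) a) 1 := by
    have h1 : ContMDiff (𝓡 (e n)) (𝓡 (d (n + 1))) ∞ (fun a => T.act n (p.1 (n + 1)) a) :=
      hp.smooth_act.comp (contMDiff_const.prodMk contMDiff_id)
    exact h1.contMDiffAt.mdifferentiableAt (by simp)
  let Dg : EuclideanSpace ℝ (Fin (d (n + 1))) →L[ℝ] EuclideanSpace ℝ (Fin (e n)) :=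
    mfderiv (𝓡 (d (n + 1))) (𝓡 (e n)) S.g (p.1 (n + 1))
  let Da : EuclideanSpace ℝ (Fin (e n)) →L[ℝ] EuclideanSpace ℝ (Fin (d (n + 1))) :=
    mfderiv (𝓡 (e n)) (𝓡 (d (n + 1))) (fun a => T.act n (p.1 (n + 1)) a) 1
  let lB : EuclideanSpace ℝ (Fin (e n)) := T.lie n ⟨B, hB⟩
  -- Differentiates g(z · a) = a at the identity, where z is the point of level n + 1.
  have hid : Dg.comp Da = ContinuousLinearMap.id ℝ _ := by
    have h1 : HasMFDerivAt (𝓡 (d (n + 1))) (𝓡 (e n)) S.g (T.act n (p.1 (n + 1)) 1) Dg := by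
      rw [hact0]
      exact hg.hasMFDerivAt
    have h2 := h1.comp 1 hact.hasMFDerivAt
    have h3 : S.g ∘ (fun a => T.act n (p.1 (n + 1)) a) = id := funext S.g_act
    rw [h3] at h2
    exact hasMFDerivAt_unique h2 (hasMFDerivAt_id 1)
  -- A universal frame sends 𝔤_n to fundamental vectors. Together with `hid`, g moves along B with
  -- velocity the Lie algebra element B.
  have hfund : vecL μ p (n + 1) B = Da lB := by
    have h1 := vecL_isFund h𝒢 hT p n ⟨B, hB⟩
    have h2 := Bundle.TotalSpace.mk.inj (show _ = _ from h1)
    exact eq_of_heq h2.2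
  have hDg : Dg (locD hT p N (n + 1) (locBase p N) v) = lB := by
    rw [hv.locD_eq h𝒢 hy hN, locZ_base, hfund]
    exact congrArg (fun f : EuclideanSpace ℝ (Fin (e n)) →L[ℝ] EuclideanSpace ℝ (Fin (e n)) => f lB)
      hid
  have hg' : HasMFDerivAt (𝓡 (d (n + 1))) (𝓡 (e n)) S.g
      ((locZ hT p N (locBase p N)).1 (n + 1)) Dg := by
    rw [hz]
    exact hg.hasMFDerivAt
  have hf' : HasMFDerivAt (𝓡 (e n)) 𝓘(ℝ, ℝ) (fun a => φ (T.rep n a X))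
      (S.g ((locZ hT p N (locBase p N)).1 (n + 1)))
      (mfderiv (𝓡 (e n)) 𝓘(ℝ, ℝ) (fun a => φ (T.rep n a X)) 1) := by
    rw [hz, hg0]
    exact hf.hasMFDerivAt
  have hcomp := hf'.comp (locBase p N) (hg'.comp (locBase p N) hF.hasMFDerivAt)
  have h8 := hcomp.mfderiv
  rw [mfderiv_eq_fderiv] at h8
  refine (congrArg (fun f : EuclideanSpace ℝ (Fin (d N)) →L[ℝ] ℝ => f v) h8).trans ?_
  refine Eq.trans ?_ (hX φ).2
  exact congrArg (fun w : EuclideanSpace ℝ (Fin (e n)) =>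
    (mfderiv (𝓡 (e n)) 𝓘(ℝ, ℝ) (fun a => φ (T.rep n a X)) 1) w) hDg

/-- The structure function on vertical vectors, up to the transformation to a local section. -/
lemma secH_gammaSum (h𝒢 : IsTransitive 𝒢 μ) (hT : T.IsNormal μ) {n N : ℕ} {p : T.Limit}
    (S : LocalSection T n (p.1 (n + 1))) (hN : n + μ + 1 ≤ N) {B : L} (hB : B ∈ 𝒢 (n : ℤ))
    {u : ℤ} (hu : u < n) (φ : Module.Dual ℝ L) {Y : L} {v : EuclideanSpace ℝ (Fin (d N))}
    (hv : LocRel hT p N (locBase p N) v B) :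
    φ (secH hT S N u (locBase p N) (gammaSum p μ n B Y)) =
      fderiv ℝ (fun t => φ (secH hT S N u t Y)) (locBase p N) v := by
  obtain ⟨w, hw⟩ := exists_locRel_vector hT p (locBase_mem p N) Y
  have h1 := dForm_section h𝒢 hT S hN hu φ hv hw
  -- B is vertical over `Q n`: the exterior derivative at level n and the derivative of H(B) both
  -- vanish, which leaves H(γ(B,Y)) = D_B H(Y).
  have h2 : ∀ z : T.Limit, vecL μ z n B = 0 := fun z =>
    (vecL_eq_zero_iff h𝒢 hT z).2 (mem_algFilt_of_mem hB le_rfl)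
  have h3 : (fun t => φ (secH hT S N u t B)) = fun _ => 0 := by
    funext t
    rw [secH_apply, h2, map_zero, map_zero]
  rw [h2, dForm_zero_left, h3] at h1
  simp only [fderiv_fun_const, Pi.zero_apply, zero_apply, sub_zero] at h1
  linarith

end Comparison

/-! ### The structure function in low degrees. -/

section Vanishing

open Topology

variable {T : TowerData 𝒢 (d := d) (e := e) Q G} {μ : ℕ}

/-- The structure function on `𝔤_b ∧ 𝔤_y`, `b ≥ 0 > y`, in degrees `≤ 0`. -/
lemma gamma_of_nonneg_neg (h𝒢 : IsTransitive 𝒢 μ) (hT : T.IsNormal μ) (p : T.Limit) {b y c : ℤ}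
    (hb : 0 ≤ b) (hy : y < 0) {B Y : L} (hB : B ∈ 𝒢 b) (hY : Y ∈ 𝒢 y) (hc : c ≤ b + y) :
    gamma μ p c B Y = comp 𝒢 c ⁅B, Y⁆ := by
  obtain ⟨n, rfl⟩ := Int.eq_ofNat_of_zero_le hb
  obtain ⟨S⟩ := exists_localSection hT n (p.1 (n + 1))
  obtain ⟨v, hv⟩ := exists_locRel_vector hT p (locBase_mem p (n + μ + 1)) B
  -- Since y < 0, the degree n + y of [B,Y] lies below n, where level n determines components. In
  -- degrees below y the bracket has no component, as the comparison requires.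
  refine comp_eq_of_filtered (n := n) (m := n + y) h𝒢.depth (by omega)
    (H := fun u => secH hT S (n + μ + 1) u (locBase p (n + μ + 1)))
    (fun u x hu hux X hX => secH_base h𝒢 hT S hu hux hX) (s := fun c => gamma μ p c B Y)
    (R := fun c => comp 𝒢 c ⁅B, Y⁆) (fun c => gamma_mem h𝒢 hT p c B Y) (fun c => comp_mem 𝒢 c _)
    (fun c hc => comp_of_mem_ne (lie_mem hB hY) (by omega)) (fun u hu => ?_) c hc
  refine eq_of_forall_dual fun φ => ?_
  have h1 := secH_gammaSum h𝒢 hT S le_rfl hB (u := u) (by omega) φ (Y := Y) hv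
  refine h1.trans ?_
  have hev : (fun t => φ (secH hT S (n + μ + 1) u t Y)) =ᶠ[𝓝 (locBase p (n + μ + 1))]
      fun t => (φ ∘ₗ comp 𝒢 u) (T.rep n (S.g ((locZ hT p (n + μ + 1) t).1 (n + 1))) Y) := by
    filter_upwards [S.eventually_mem hT (N := n + μ + 1) (by omega)] with t ht
    rw [secH_eq_comp_rep h𝒢 hT S (by omega) (by omega) ht hY]
    rfl
  rw [hev.fderiv_eq, fderiv_rep h𝒢 hT S (by omega) hB
    ((hT.group n).deriv_neg ⟨B, hB⟩ y hy Y hY) hv]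
  rfl

/-- Derivative of the representation along B once more. If 0 ≤ y < b, then 𝔤_b acts by zero on 𝔤_y;
if y ≥ b, then Y itself is zero at level b. Either way the transformation has zero derivative on Y.
-/
lemma gamma_of_nonneg_left (h𝒢 : IsTransitive 𝒢 μ) (hT : T.IsNormal μ) (p : T.Limit) {b y c : ℤ}
    (hb : 0 ≤ b) (hy : 0 ≤ y) {B Y : L} (hB : B ∈ 𝒢 b) (hY : Y ∈ 𝒢 y) (hc : c < b) :
    gamma μ p c B Y = 0 := by
  obtain ⟨n, rfl⟩ := Int.eq_ofNat_of_zero_le hb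
  obtain ⟨S⟩ := exists_localSection hT n (p.1 (n + 1))
  obtain ⟨v, hv⟩ := exists_locRel_vector hT p (locBase_mem p (n + μ + 1)) B
  refine comp_eq_of_filtered (n := n) (m := n - 1) h𝒢.depth (by omega)
    (H := fun u => secH hT S (n + μ + 1) u (locBase p (n + μ + 1)))
    (fun u x hu hux X hX => secH_base h𝒢 hT S hu hux hX) (s := fun c => gamma μ p c B Y)
    (R := fun c => 0) (fun c => gamma_mem h𝒢 hT p c B Y) (fun c => Submodule.zero_mem _)
    (fun c hc => rfl) (fun u hu => ?_) c (by omega)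
  refine eq_of_forall_dual fun φ => ?_
  have h1 := secH_gammaSum h𝒢 hT S le_rfl hB (u := u) (by omega) φ (Y := Y) hv
  refine h1.trans ?_
  rcases lt_or_ge y n with hyn | hyn
  · have hev : (fun t => φ (secH hT S (n + μ + 1) u t Y)) =ᶠ[𝓝 (locBase p (n + μ + 1))]
        fun t => (φ ∘ₗ comp 𝒢 u) (T.rep n (S.g ((locZ hT p (n + μ + 1) t).1 (n + 1))) Y) := by
      filter_upwards [S.eventually_mem hT (N := n + μ + 1) (by omega)] with t ht
      rw [secH_eq_comp_rep h𝒢 hT S (by omega) (by omega) ht hY]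
      rfl
    rw [hev.fderiv_eq, fderiv_rep h𝒢 hT S (by omega) hB
      ((hT.group n).deriv_nonneg ⟨B, hB⟩ y hy hyn Y hY) hv, map_zero, map_zero]
  · have h3 : (fun t => φ (secH hT S (n + μ + 1) u t Y)) = fun _ => 0 := by
      funext t
      rw [secH_apply, (vecL_eq_zero_iff h𝒢 hT _).2 (mem_algFilt_of_mem hY hyn), map_zero, map_zero]
    rw [h3, map_zero]
    simp

/-- The structure function on `𝔤_a ∧ 𝔤_b`, `a, b ≥ 0`, vanishes in degrees below `max(a, b)`. -/
lemma gamma_of_nonneg (h𝒢 : IsTransitive 𝒢 μ) (hT : T.IsNormal μ) (p : T.Limit) {a b c : ℤ}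
    (ha : 0 ≤ a) (hb : 0 ≤ b) {A B : L} (hA : A ∈ 𝒢 a) (hB : B ∈ 𝒢 b) (hc : c < max a b) :
    gamma μ p c A B = 0 := by
  rcases lt_max_iff.1 hc with h | h
  · exact gamma_of_nonneg_left h𝒢 hT p ha hb hA hB h
  · rw [gamma_swap h𝒢 hT, gamma_of_nonneg_left h𝒢 hT p hb ha hB hA h, neg_zero]

/-- The structure function on `∧² 𝔤_-` in degrees `≤ 0`. -/
lemma gamma_of_neg (h𝒢 : IsTransitive 𝒢 μ) (hT : T.IsNormal μ) (p : T.Limit) {x y c : ℤ}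
    (hx : x < 0) (hy : y < 0) {X Y : L} (hX : X ∈ 𝒢 x) (hY : Y ∈ 𝒢 y) (hc : c ≤ x + y) :
    gamma μ p c X Y = comp 𝒢 c ⁅X, Y⁆ := by
  obtain ⟨S⟩ := exists_localSection hT 0 (p.1 (0 + 1))
  set N := 0 + μ + 1 with hN
  obtain ⟨v, hv⟩ := exists_locRel_vector hT p (locBase_mem p N) X
  obtain ⟨w, hw⟩ := exists_locRel_vector hT p (locBase_mem p N) Y
  refine comp_eq_of_filtered (n := 0) (m := x + y) h𝒢.depth (by simp; omega)
    (H := fun u => secH hT S N u (locBase p N))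
    (fun u x hu hux X hX => secH_base h𝒢 hT S hu hux hX) (s := fun c => gamma μ p c X Y)
    (R := fun c => comp 𝒢 c ⁅X, Y⁆) (fun c => gamma_mem h𝒢 hT p c X Y) (fun c => comp_mem 𝒢 c _)
    (fun c hc => comp_of_mem_ne (lie_mem hX hY) (by push_cast at hc; omega)) (fun u hu => ?_) c hc
  refine eq_of_forall_dual fun φ => ?_
  have hu0 : u < ((0 : ℕ) : ℤ) := by push_cast; omega
  have h1 := dForm_section h𝒢 hT S le_rfl hu0 φ hv hw
  -- Both frames are filtered and u ≤ x + y lies below x and y, so H has no component of degree u on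
  -- X or Y. The derivative terms drop out and only −H(γ(X,Y)) remains.
  have h2 : ∀ z : ℤ, u < z → ∀ Z ∈ 𝒢 z, (fun t => φ (secH hT S N u t Z)) =ᶠ[𝓝 (locBase p N)]
      fun _ => 0 := by
    intro z hz Z hZ
    filter_upwards [S.eventually_mem hT (N := N) (by omega)] with t ht
    rw [secH_apply, coframeL_eq_zero (frame_isFilteredIso hT (S.frame _ ht)) hu0 hz, map_zero]
    exact (vecL_isFilteredIso h𝒢 hT _ 0).map_mem (mem_algFilt_of_mem hZ le_rfl)
  rw [(h2 y (by omega) Y hY).fderiv_eq, (h2 x (by omega) X hX).fderiv_eq] at h1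
  simp only [fderiv_fun_const, Pi.zero_apply, zero_apply, sub_zero, zero_sub] at h1
  have hfr := S.frame _ S.base_mem
  have hσ : S.σ (p.1 0) = p.1 (0 + 1) := by
    have := S.section_base
    rwa [p.2 0] at this
  rw [hσ] at hfr
  have hiso := frame_isFilteredIso hT hfr
  have hgr := ((hT.subbundle 0).univ _ _ _ hfr).2
  -- Constant coefficients Z' with respect to the section frame extend the canonical vector to a
  -- vector field in F^z. The dual forms are constant on such fields, so dα is minus α of their
  -- bracket.
  have hlift : ∀ z : ℤ, ∀ Z ∈ 𝒢 z, ∃ Z' ∈ algFilt 𝒢 z, S.ζ (p.1 0) Z' = vecL μ p 0 Z := by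
    intro z Z hZ
    have h3 : vecL μ p 0 Z ∈ T.filt 0 z (p.1 0) :=
      (vecL_isFilteredIso h𝒢 hT p 0).map_mem (mem_algFilt_of_mem hZ le_rfl)
    rw [← hiso.filt z] at h3
    obtain ⟨Z', hZ', h4⟩ := h3
    exact ⟨Z', hZ', h4⟩
  obtain ⟨X', hX', hXX⟩ := hlift x X hX
  obtain ⟨Y', hY', hYY⟩ := hlift y Y hY
  have hF : ∀ z : ℤ, ∀ Z ∈ algFilt 𝒢 z, ∀ q ∈ S.U, S.ζ q Z ∈ T.F z q := by
    intro z Z hZ q hq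
    exact (frame_isFilteredIso hT (S.frame q hq)).map_mem hZ
  have hsub : ∀ z : ℤ, ∀ Z ∈ 𝒢 z, ∀ Z', S.ζ (p.1 0) Z' = vecL μ p 0 Z →
      (S.ζ (p.1 0) Z' - S.ζ (p.1 0) Z : EuclideanSpace ℝ (Fin (d 0))) ∈ T.filt 0 (z + 1) (p.1 0) := by
    intro z Z hZ Z' h3
    rw [h3]
    have h4 := frame_sub_mem_filt hT hfr (vecL_mem_Fr h𝒢 hT p 0) hZ
    simpa using h4
  have hbr := hgr x y hx hy X hX Y hY S.U (fun q => S.ζ q X') (fun q => S.ζ q Y') S.isOpen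
    S.base_mem (S.smooth X') (S.smooth Y') (hF x X' hX') (hF y Y' hY') (hsub x X hX X' hXX)
    (hsub y Y hY Y' hYY)
  have hconst : ∀ Z, ∀ᶠ q in 𝓝 (p.1 0), (φ ∘ₗ coframeL 𝒢 u (S.ζ q)) (S.ζ q Z) = φ (comp 𝒢 u Z) := by
    intro Z
    filter_upwards [S.isOpen.mem_nhds S.base_mem] with q hq
    exact congrArg φ (coframeL_apply (frame_isFilteredIso hT (S.frame q hq)) hu0 Z)
  have hmain := dForm_eq_neg_mlieBracket (n := d 0) (S.smoothFormAt hT hu0 φ S.base_mem)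
    (V := fun q => S.ζ q X') (V' := fun q => S.ζ q Y')
    ((S.smooth X').contMDiffAt (S.isOpen.mem_nhds S.base_mem))
    ((S.smooth Y').contMDiffAt (S.isOpen.mem_nhds S.base_mem)) (hconst X') (hconst Y')
  have h5 : coframeL 𝒢 u (S.ζ (p.1 0)) (VectorField.mlieBracket (𝓡 (d 0)) (fun q => S.ζ q X')
      (fun q => S.ζ q Y') (p.1 0)) = comp 𝒢 u ⁅X, Y⁆ := by
    have h6 := coframeL_eq_zero hiso hu0 (p := x + y + 1) (by omega) hbr
    refine Eq.trans ?_ (coframeL_apply hiso hu0 ⁅X, Y⁆)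
    refine sub_eq_zero.1 (Eq.trans ?_ h6)
    exact (map_sub (coframeL 𝒢 u (S.ζ (p.1 0))) _ _).symm
  have h7 : dForm (n := d 0) (fun q => φ ∘ₗ coframeL 𝒢 u (S.ζ q)) (p.1 0) (vecL μ p 0 X)
      (vecL μ p 0 Y) = -φ (comp 𝒢 u ⁅X, Y⁆) := by
    rw [← hXX, ← hYY]
    refine hmain.trans ?_
    exact congrArg (fun l => -φ l) h5
  rw [h7] at h1
  exact (neg_injective h1).symm

end Vanishing

end TowerData

/-- Collapses the sums over degrees in κ, τ, σ to a single term on homogeneous arguments. -/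
lemma finsum_eq_ite {M : Type*} [AddCommMonoid M] {P : ℤ → ℤ → Prop} [∀ a b, Decidable (P a b)]
    {f : ℤ → ℤ → M} {x y : ℤ} (h : ∀ a b, a ≠ x ∨ b ≠ y → f a b = 0) :
    ∑ᶠ (a : ℤ) (b : ℤ) (_ : P a b), f a b = if P x y then f x y else 0 := by
  rw [finsum_eq_single _ x, finsum_eq_single _ y, finsum_eq_if]
  · intro b hb
    simp [h x b (Or.inr hb)]
  · intro a ha
    simp [h a _ (Or.inl ha)]

namespace TowerData

variable {L : Type u} [LieRing L] [LieAlgebra ℝ L]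
variable {𝒢 : ℤ → Submodule ℝ L} [GradedLieAlgebra 𝒢]
variable {d e : ℕ → ℕ}
variable {Q : ℕ → Type v} [∀ n, TopologicalSpace (Q n)]
  [∀ n, ChartedSpace (EuclideanSpace ℝ (Fin (d n))) (Q n)] [∀ n, IsManifold (𝓡 (d n)) ∞ (Q n)]
variable {G : ℕ → Type w} [∀ n, Group (G n)] [∀ n, TopologicalSpace (G n)]
  [∀ n, ChartedSpace (EuclideanSpace ℝ (Fin (e n))) (G n)]

/-! ### κ, τ and σ in terms of γ on homogeneous arguments. -/

section Components

variable {T : TowerData 𝒢 (d := d) (e := e) Q G} {μ : ℕ}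

lemma tilde_of_neg {a : ℤ} (h : a < 0) : tilde a = a := min_eq_left (by omega)

lemma tilde_of_nonneg {a : ℤ} (h : 0 ≤ a) : tilde a = -1 := min_eq_right (by omega)

lemma gamma_comp_comp (h𝒢 : IsTransitive 𝒢 μ) (hT : T.IsNormal μ) (z : T.Limit) (c : ℤ)
    {x y a b : ℤ} {X Y : L} (hX : X ∈ 𝒢 x) (hY : Y ∈ 𝒢 y) (h : a ≠ x ∨ b ≠ y) :
    gamma μ z c (comp 𝒢 a X) (comp 𝒢 b Y) = 0 := by
  rcases h with h | h
  · rw [comp_of_mem_ne hX (Ne.symm h), gamma_zero_left h𝒢 hT]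
  · rw [comp_of_mem_ne hY (Ne.symm h), gamma_zero_right h𝒢 hT]

lemma kappa_eq (h𝒢 : IsTransitive 𝒢 μ) (hT : T.IsNormal μ) (z : T.Limit) {x y s c : ℤ} (hx : x < 0)
    (hy : y < 0) {X Y : L} (hX : X ∈ 𝒢 x) (hY : Y ∈ 𝒢 y) (hc : c = x + y + s) :
    kappa μ z s X Y = gamma μ z c X Y := by
  subst hc
  rw [kappa, finsum_eq_ite fun a b h => gamma_comp_comp h𝒢 hT z _ hX hY h, if_pos ⟨hx, hy⟩,
    comp_of_mem hX, comp_of_mem hY, tilde_of_neg hx, tilde_of_neg hy]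

lemma kappa_zero_left (h𝒢 : IsTransitive 𝒢 μ) (hT : T.IsNormal μ) (z : T.Limit) (s : ℤ) (Y : L) :
    kappa μ z s 0 Y = 0 := by
  simp [kappa, gamma_zero_left h𝒢 hT]

lemma tau_zero_left (h𝒢 : IsTransitive 𝒢 μ) (hT : T.IsNormal μ) (z : T.Limit) (r s : ℤ) (Y : L) :
    tau μ z r s 0 Y = 0 := by
  simp [tau, gamma_zero_left h𝒢 hT]

lemma tau_zero_right (h𝒢 : IsTransitive 𝒢 μ) (hT : T.IsNormal μ) (z : T.Limit) (r s : ℤ) (X : L) :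
    tau μ z r s X 0 = 0 := by
  simp [tau, gamma_zero_right h𝒢 hT]

lemma sigma_zero_left (h𝒢 : IsTransitive 𝒢 μ) (hT : T.IsNormal μ) (z : T.Limit) (r s : ℤ) (Y : L) :
    sigma μ z r s 0 Y = 0 := by
  simp [sigma, gamma_zero_left h𝒢 hT]

lemma sigma_zero_right (h𝒢 : IsTransitive 𝒢 μ) (hT : T.IsNormal μ) (z : T.Limit) (r s : ℤ)
    (X : L) : sigma μ z r s X 0 = 0 := by
  simp [sigma, gamma_zero_right h𝒢 hT]

lemma gamma_neg_left (h𝒢 : IsTransitive 𝒢 μ) (hT : T.IsNormal μ) (z : T.Limit) (c : ℤ) (X Y : L) :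
    gamma μ z c (-X) Y = -gamma μ z c X Y := by
  rw [← gammaL_apply h𝒢 hT, map_neg]
  rfl

lemma gammaSum_swap (h𝒢 : IsTransitive 𝒢 μ) (hT : T.IsNormal μ) (z : T.Limit) (n : ℤ) (X Y : L) :
    gammaSum z μ n Y X = -gammaSum z μ n X Y := by
  rw [gammaSum, gammaSum, ← Finset.sum_neg_distrib]
  exact Finset.sum_congr rfl fun c _ => gamma_swap h𝒢 hT z c X Y

lemma kappa_zero_right (h𝒢 : IsTransitive 𝒢 μ) (hT : T.IsNormal μ) (z : T.Limit) (s : ℤ) (X : L) :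
    kappa μ z s X 0 = 0 := by
  simp [kappa, gamma_zero_right h𝒢 hT]

/-- ρ(A)κ carries [A,Y]_- in the second slot, whereas the Bianchi identity yields it in the first.
-/
lemma kappa_minusPart_right (h𝒢 : IsTransitive 𝒢 μ) (hT : T.IsNormal μ) (z : T.Limit) (s : ℤ)
    {x u : ℤ} (hx : x < 0) {X U : L} (hX : X ∈ 𝒢 x) (hU : U ∈ 𝒢 u) :
    kappa μ z s X (minusPart 𝒢 U) = -kappa μ z s (minusPart 𝒢 U) X := by
  rcases lt_or_ge u 0 with hu | hu
  · rw [minusPart_of_neg hU hu, kappa_eq h𝒢 hT z hx hu hX hU rfl, gamma_swap h𝒢 hT,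
      kappa_eq h𝒢 hT z hu hx hU hX (c := x + u + s) (by omega)]
  · rw [minusPart_of_nonneg hU hu, kappa_zero_left h𝒢 hT, kappa_zero_right h𝒢 hT, neg_zero]

/-- `τ_{(r)[s]}` on `𝔤_a ⊗ 𝔤_x`, `a ≥ 0 > x`. -/
lemma tau_eq (h𝒢 : IsTransitive 𝒢 μ) (hT : T.IsNormal μ) (z : T.Limit) {a x r s c : ℤ} (ha : 0 ≤ a)
    (hx : x < 0) {A X : L} (hA : A ∈ 𝒢 a) (hX : X ∈ 𝒢 x) (hs : s = r + a + 1)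
    (hc : c = a + x + r) : tau μ z r s A X = gamma μ z c A X := by
  subst hc
  rw [tau, finsum_eq_ite fun a b h => gamma_comp_comp h𝒢 hT z _ hA hX h, if_pos,
    comp_of_mem hA, comp_of_mem hX]
  rw [tilde_of_neg hx, tilde_of_nonneg ha]
  omega

/-- `τ_{(r)[s]}` on `𝔤_x ⊗ 𝔤_a`, `a ≥ 0 > x`. -/
lemma tau_eq_swap (h𝒢 : IsTransitive 𝒢 μ) (hT : T.IsNormal μ) (z : T.Limit) {a x r s c : ℤ}
    (ha : 0 ≤ a) (hx : x < 0) {A X : L} (hA : A ∈ 𝒢 a) (hX : X ∈ 𝒢 x) (hs : s = r + a + 1)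
    (hc : c = x + a + r) : tau μ z r s X A = gamma μ z c X A := by
  subst hc
  rw [tau, finsum_eq_ite fun a b h => gamma_comp_comp h𝒢 hT z _ hX hA h, if_pos,
    comp_of_mem hA, comp_of_mem hX]
  rw [tilde_of_neg hx, tilde_of_nonneg ha]
  omega

lemma sigma_eq (h𝒢 : IsTransitive 𝒢 μ) (hT : T.IsNormal μ) (z : T.Limit) {a b r s c : ℤ}
    (ha : 0 ≤ a) (hb : 0 ≤ b) {A B : L} (hA : A ∈ 𝒢 a) (hB : B ∈ 𝒢 b) (hs : s = a + b + r + 2)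
    (hc : c = a + b + r) : sigma μ z r s A B = gamma μ z c A B := by
  subst hc
  rw [sigma, finsum_eq_ite fun a b h => gamma_comp_comp h𝒢 hT z _ hA hB h, if_pos,
    comp_of_mem hA, comp_of_mem hB]
  rw [tilde_of_nonneg ha, tilde_of_nonneg hb]
  omega

/-- `γ(U, Z)` for `Z ∈ 𝔤_-` in terms of `κ` and `τ`. -/
lemma kappa_add_tau (h𝒢 : IsTransitive 𝒢 μ) (hT : T.IsNormal μ) (p : T.Limit) {u z r s c : ℤ}
    (hz : z < 0) {U Z : L} (hU : U ∈ 𝒢 u) (hZ : Z ∈ 𝒢 z) (hs : s = u + r + 1)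
    (hc : c = u + z + r) :
    kappa μ p r (minusPart 𝒢 U) Z + tau μ p r s (plusPart 𝒢 U) Z = gamma μ p c U Z := by
  rcases lt_or_ge u 0 with hu | hu
  · rw [minusPart_of_neg hU hu, plusPart_of_neg hU hu, tau_zero_left h𝒢 hT, add_zero,
      kappa_eq h𝒢 hT p hu hz hU hZ hc]
  · rw [minusPart_of_nonneg hU hu, plusPart_of_nonneg hU hu, kappa_zero_left h𝒢 hT, zero_add,
      tau_eq h𝒢 hT p hu hz hU hZ (by omega) hc]

/-- `γ(U, A)` for `A ∈ 𝔤_+` in terms of `τ` and `σ`. -/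
lemma tau_add_sigma (h𝒢 : IsTransitive 𝒢 μ) (hT : T.IsNormal μ) (p : T.Limit) {u a r s s' c : ℤ}
    (ha : 0 ≤ a) {U A : L} (hU : U ∈ 𝒢 u) (hA : A ∈ 𝒢 a) (hs : s = r + a + 1)
    (hs' : s' = u + a + r + 2) (hc : c = u + a + r) :
    tau μ p r s (minusPart 𝒢 U) A + sigma μ p r s' (plusPart 𝒢 U) A = gamma μ p c U A := by
  rcases lt_or_ge u 0 with hu | hu
  · rw [minusPart_of_neg hU hu, plusPart_of_neg hU hu, sigma_zero_left h𝒢 hT, add_zero,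
      tau_eq_swap h𝒢 hT p ha hu hA hU hs hc]
  · rw [minusPart_of_nonneg hU hu, plusPart_of_nonneg hU hu, tau_zero_left h𝒢 hT, zero_add,
      sigma_eq h𝒢 hT p hu ha hU hA hs' hc]

/-- `γ(A, U)` for `A ∈ 𝔤_+` in terms of `σ` and `τ`. -/
lemma sigma_add_tau (h𝒢 : IsTransitive 𝒢 μ) (hT : T.IsNormal μ) (p : T.Limit) {u a r s s' c : ℤ}
    (ha : 0 ≤ a) {U A : L} (hU : U ∈ 𝒢 u) (hA : A ∈ 𝒢 a) (hs : s = r + a + 1)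
    (hs' : s' = a + u + r + 2) (hc : c = a + u + r) :
    sigma μ p r s' A (plusPart 𝒢 U) + tau μ p r s A (minusPart 𝒢 U) = gamma μ p c A U := by
  rcases lt_or_ge u 0 with hu | hu
  · rw [minusPart_of_neg hU hu, plusPart_of_neg hU hu, sigma_zero_right h𝒢 hT, zero_add,
      tau_eq h𝒢 hT p ha hu hA hU hs hc]
  · rw [minusPart_of_nonneg hU hu, plusPart_of_nonneg hU hu, tau_zero_right h𝒢 hT, add_zero,
      sigma_eq h𝒢 hT p ha hu hA hU hs' hc]

/-- The quadratic term of the Bianchi identity as a sum over an arbitrary range which contains all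
nonzero terms. -/
lemma gamma_gammaSum (h𝒢 : IsTransitive 𝒢 μ) (hT : T.IsNormal μ) (p : T.Limit) (c : ℤ) {X Y Z : L}
    (E : ℤ ≃ ℤ) (I : Finset ℤ) (hI : ∀ r ∉ I, gamma μ p c (gamma μ p (E r) X Y) Z = 0) :
    gamma μ p c (gammaSum p μ (c + μ + 1) X Y) Z =
      ∑ r ∈ I, gamma μ p c (gamma μ p (E r) X Y) Z := by
  have h1 : gamma μ p c (gammaSum p μ (c + μ + 1) X Y) Z =
      ∑ r ∈ Finset.Ico (-(μ : ℤ)) (c + μ + 1), gamma μ p c (gamma μ p r X Y) Z := by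
    rw [gammaSum, ← gammaL_apply h𝒢 hT, map_sum, LinearMap.sum_apply]
    rfl
  have h2 : ∑ r ∈ I, gamma μ p c (gamma μ p (E r) X Y) Z =
      ∑ r ∈ I.map E.toEmbedding, gamma μ p c (gamma μ p r X Y) Z :=
    (Finset.sum_map I E.toEmbedding fun r => gamma μ p c (gamma μ p r X Y) Z).symm
  rw [h1, h2]
  -- Both ranges are compared with their union. Outside [−μ, c + μ] a term vanishes because 𝔤_r = 0
  -- or because γ_c ignores its first argument; outside the image of I it vanishes by `hI`.
  refine (Finset.sum_subset (Finset.subset_union_left (s₂ := I.map E.toEmbedding)) ?_).trans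
    (Finset.sum_subset Finset.subset_union_right ?_).symm
  · intro r _ hr
    rw [Finset.mem_Ico, not_and_or] at hr
    rcases hr with hr | hr
    · rw [gamma_eq_zero_of_bot (h𝒢.depth r (by omega)), gamma_zero_left h𝒢 hT]
    · exact gamma_eq_zero_of_mem_algFilt h𝒢 hT p
        (mem_algFilt_of_mem (gamma_mem h𝒢 hT p r X Y) (by omega)) Z
  · intro r _ hr
    have h3 := hI (E.symm r) fun h => hr (Finset.mem_map.2 ⟨E.symm r, h, by simp⟩)
    rwa [E.apply_symm_apply] at h3

end Components

/-! ### The components of the Bianchi identity. -/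

section Identities

variable [∀ n, LieGroup (𝓡 (e n)) ∞ (G n)]
variable {T : TowerData 𝒢 (d := d) (e := e) Q G} {μ : ℕ}

/-- Both signs of the degree of U are merged, so that the inner values of γ, which have either sign,
can be treated uniformly. -/
lemma gamma_of_neg_right (h𝒢 : IsTransitive 𝒢 μ) (hT : T.IsNormal μ) (p : T.Limit) {u z c : ℤ}
    (hz : z < 0) {U Z : L} (hU : U ∈ 𝒢 u) (hZ : Z ∈ 𝒢 z) (hc : c ≤ u + z) :
    gamma μ p c U Z = comp 𝒢 c ⁅U, Z⁆ := by
  rcases lt_or_ge u 0 with hu | hu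
  · exact gamma_of_neg h𝒢 hT p hu hz hU hZ hc
  · exact gamma_of_nonneg_neg h𝒢 hT p hu hz hU hZ hc

lemma gamma_eq_lie (h𝒢 : IsTransitive 𝒢 μ) (hT : T.IsNormal μ) (p : T.Limit) {u z c : ℤ}
    (hz : z < 0) {U Z : L} (hU : U ∈ 𝒢 u) (hZ : Z ∈ 𝒢 z) (hc : c = u + z) :
    gamma μ p c U Z = ⁅U, Z⁆ := by
  rw [gamma_of_neg_right h𝒢 hT p hz hU hZ hc.le, hc, comp_of_mem (lie_mem hU hZ)]

lemma gamma_eq_zero_of_lt (h𝒢 : IsTransitive 𝒢 μ) (hT : T.IsNormal μ) (p : T.Limit) {u z c : ℤ}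
    (hz : z < 0) {U Z : L} (hU : U ∈ 𝒢 u) (hZ : Z ∈ 𝒢 z) (hc : c < u + z) :
    gamma μ p c U Z = 0 := by
  rw [gamma_of_neg_right h𝒢 hT p hz hU hZ hc.le, comp_of_mem_ne (lie_mem hU hZ) (by omega)]

/-- `γ(U, A)` with `A ∈ 𝔤_a`, `a ≥ 0`, takes values in `F^u` if `U ∈ 𝔤_u`. -/
lemma gamma_nonneg_right_eq_zero (h𝒢 : IsTransitive 𝒢 μ) (hT : T.IsNormal μ) (p : T.Limit)
    {u a c : ℤ} (ha : 0 ≤ a) {U A : L} (hU : U ∈ 𝒢 u) (hA : A ∈ 𝒢 a) (hc : c < u) :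
    gamma μ p c U A = 0 := by
  rcases lt_or_ge u 0 with hu | hu
  · rw [gamma_swap h𝒢 hT, gamma_eq_zero_of_lt h𝒢 hT p hu hA hU (by omega), neg_zero]
  · exact gamma_of_nonneg h𝒢 hT p hu ha hU hA (lt_max_of_lt_left hc)

/-- The quadratic term of the Bianchi identity for `Y ∈ 𝔤_y`, `Z ∈ 𝔤_z`, `y, z < 0`. -/
lemma gamma_gammaSum_neg (h𝒢 : IsTransitive 𝒢 μ) (hT : T.IsNormal μ) (p : T.Limit)
    {x y z k c : ℤ} (hy : y < 0) (hz : z < 0) {X Y Z : L} (hX : X ∈ 𝒢 x) (hY : Y ∈ 𝒢 y)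
    (hZ : Z ∈ 𝒢 z) (hk : 0 < k) (hc : c = x + y + z + k) :
    gamma μ p c (gammaSum p μ (c + μ + 1) X Y) Z =
      ⁅gamma μ p (x + y + k) X Y, Z⁆ + gamma μ p c ⁅X, Y⁆ Z +
      ∑ r ∈ Finset.Ioo 0 k, gamma μ p c (gamma μ p (x + y + k - r) X Y) Z := by
  -- The index r is the degree of the outer γ, and k − r that of the inner one. Degrees are ≥ 0 on
  -- both sides; r = 0 makes the outer factor a bracket and r = k the inner one.
  rw [gamma_gammaSum h𝒢 hT p c (Equiv.subLeft (x + y + k)) (insert 0 (insert k (Finset.Ioo 0 k))),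
    Finset.sum_insert, Finset.sum_insert]
  · simp only [Equiv.subLeft_apply, sub_zero, ← add_assoc]
    rw [gamma_eq_lie h𝒢 hT p hz (gamma_mem h𝒢 hT p _ X Y) hZ (by omega),
      gamma_eq_lie h𝒢 hT p hy hX hY (c := x + y + k - k) (by omega)]
  · simp
  · simp [hk.ne]
  · intro r hr
    simp only [Finset.mem_insert, Finset.mem_Ioo, not_or, not_and, not_lt] at hr
    rcases lt_or_ge r 0 with h | h
    · exact gamma_eq_zero_of_lt h𝒢 hT p hz (gamma_mem h𝒢 hT p _ X Y) hZ
        (by simp only [Equiv.subLeft_apply]; omega)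
    · rw [gamma_eq_zero_of_lt h𝒢 hT p hy hX hY, gamma_zero_left h𝒢 hT]
      simp only [Equiv.subLeft_apply]
      omega

/-- The quadratic term of the Bianchi identity in degree zero for `Y, Z ∈ 𝔤_-`. -/
lemma gamma_gammaSum_neg_zero (h𝒢 : IsTransitive 𝒢 μ) (hT : T.IsNormal μ) (p : T.Limit)
    {x y z c : ℤ} (hy : y < 0) (hz : z < 0) {X Y Z : L} (hX : X ∈ 𝒢 x) (hY : Y ∈ 𝒢 y)
    (hZ : Z ∈ 𝒢 z) (hc : c = x + y + z) :
    gamma μ p c (gammaSum p μ (c + μ + 1) X Y) Z = ⁅⁅X, Y⁆, Z⁆ := by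
  rw [gamma_gammaSum h𝒢 hT p c (Equiv.refl ℤ) {x + y}, Finset.sum_singleton]
  · simp only [Equiv.refl_apply]
    rw [gamma_eq_lie h𝒢 hT p hy hX hY rfl, gamma_eq_lie h𝒢 hT p hz (lie_mem hX hY) hZ hc]
  · intro r hr
    simp only [Finset.mem_singleton] at hr
    simp only [Equiv.refl_apply]
    rcases lt_or_ge r (x + y) with h | h
    · rw [gamma_eq_zero_of_lt h𝒢 hT p hy hX hY h, gamma_zero_left h𝒢 hT]
    · exact gamma_eq_zero_of_lt h𝒢 hT p hz (gamma_mem h𝒢 hT p _ X Y) hZ (by omega)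

/-- The identity for `∂κ`. -/
lemma spencer_kappa (h𝒢 : IsTransitive 𝒢 μ) (hT : T.IsNormal μ) (p : T.Limit) (k : ℕ)
    {x y z : ℤ} (hx : x < 0) (hy : y < 0) (hz : z < 0) {X Y Z : L} (hX : X ∈ 𝒢 x) (hY : Y ∈ 𝒢 y)
    (hZ : Z ∈ 𝒢 z) :
    spencer2 (kappa μ p k) X Y Z =
      cyclicSum (fun x X y Y _ Z =>
        (∑ d₁ ∈ Finset.Ioo (0 : ℤ) k,
          (kappa μ p d₁ (minusPart 𝒢 (kappa μ p (k - d₁) X Y)) Z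
            + tau μ p d₁ (k + x + y + 1) (plusPart 𝒢 (kappa μ p (k - d₁) X Y)) Z))
        - covD μ X (fun p' : T.Limit => kappa μ p' (k + x) Y Z) p) x X y Y z Z := by
  have hsum : ∀ {x y z c : ℤ} {X Y Z : L}, x < 0 → y < 0 → z < 0 → X ∈ 𝒢 x → Y ∈ 𝒢 y → Z ∈ 𝒢 z →
      c = x + y + z + k → ∑ d₁ ∈ Finset.Ioo (0 : ℤ) k,
          (kappa μ p d₁ (minusPart 𝒢 (kappa μ p (k - d₁) X Y)) Z
            + tau μ p d₁ (k + x + y + 1) (plusPart 𝒢 (kappa μ p (k - d₁) X Y)) Z) =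
      ∑ r ∈ Finset.Ioo (0 : ℤ) k, gamma μ p c (gamma μ p (x + y + k - r) X Y) Z := by
    intro x y z c X Y Z hx hy hz hX hY hZ hc
    refine Finset.sum_congr rfl fun r _ => ?_
    rw [kappa_eq h𝒢 hT p hx hy hX hY (c := x + y + k - r) (by omega)]
    exact kappa_add_tau h𝒢 hT p hz (gamma_mem h𝒢 hT p _ X Y) hZ (by omega) (by omega)
  have hcov : ∀ {x y z c : ℤ} {X Y Z : L}, y < 0 → z < 0 → Y ∈ 𝒢 y → Z ∈ 𝒢 z →
      c = x + y + z + k → covD μ X (fun p' : T.Limit => kappa μ p' (k + x) Y Z) p =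
        covD μ X (fun p' : T.Limit => gamma μ p' c Y Z) p := by
    intro x y z c X Y Z hy hz hY hZ hc
    congr 1
    funext p'
    exact kappa_eq h𝒢 hT p' hy hz hY hZ (by omega)
  have hB := bianchi h𝒢 hT p (x + y + z + k) X Y Z
  simp only [cyclicSum, spencer2]
  rw [hsum hx hy hz hX hY hZ (c := x + y + z + k) (by omega),
    hsum hy hz hx hY hZ hX (c := x + y + z + k) (by omega),
    hsum hz hx hy hZ hX hY (c := x + y + z + k) (by omega),
    hcov (x := x) hy hz hY hZ (c := x + y + z + k) (by omega),
    hcov (x := y) hz hx hZ hX (c := x + y + z + k) (by omega),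
    hcov (x := z) hx hy hX hY (c := x + y + z + k) (by omega),
    kappa_eq h𝒢 hT p hy hz hY hZ rfl, kappa_eq h𝒢 hT p hx hz hX hZ rfl,
    kappa_eq h𝒢 hT p hx hy hX hY rfl,
    kappa_eq h𝒢 hT p (c := x + y + z + k) (by omega) hz (lie_mem hX hY) hZ (by omega),
    kappa_eq h𝒢 hT p (c := x + y + z + k) (by omega) hy (lie_mem hX hZ) hY (by omega),
    kappa_eq h𝒢 hT p (c := x + y + z + k) (by omega) hx (lie_mem hY hZ) hX (by omega)]
  -- For k = 0 the extreme terms r = 0 and r = k are the same double bracket, which ∂κ counts twice;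
  -- the Jacobi identity settles the difference.
  rcases Nat.eq_zero_or_pos k with hk | hk
  · subst hk
    rw [gamma_gammaSum_neg_zero h𝒢 hT p hy hz hX hY hZ (by omega),
      gamma_gammaSum_neg_zero h𝒢 hT p hz hx hY hZ hX (by omega),
      gamma_gammaSum_neg_zero h𝒢 hT p hx hy hZ hX hY (by omega)] at hB
    rw [gamma_eq_lie h𝒢 hT p hz hY hZ (by simp), gamma_eq_lie h𝒢 hT p hz hX hZ (by simp),
      gamma_eq_lie h𝒢 hT p hy hX hY (by simp), gamma_eq_lie h𝒢 hT p hz (lie_mem hX hY) hZ (by simp),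
      gamma_eq_lie h𝒢 hT p hy (lie_mem hX hZ) hY (by push_cast; omega),
      gamma_eq_lie h𝒢 hT p hx (lie_mem hY hZ) hX (by push_cast; omega)]
    simp only [Nat.cast_zero, Finset.Ioo_self, Finset.sum_empty, zero_sub] at hB ⊢
    have e3 := lie_skew Y ⁅Z, X⁆
    have e4 : ⁅Y, ⁅Z, X⁆⁆ = -⁅Y, ⁅X, Z⁆⁆ := by rw [← lie_skew Z X, lie_neg]
    have e5 := lie_skew Y ⁅X, Z⁆
    have e6 := lie_jacobi X Y Z
    linear_combination (norm := abel1) e6 - hB - e3 - e4 - e4 - e5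
  · have hk' : (0 : ℤ) < k := by omega
    rw [gamma_gammaSum_neg h𝒢 hT p hy hz hX hY hZ hk' (by omega),
      gamma_gammaSum_neg h𝒢 hT p hz hx hY hZ hX hk' (by omega),
      gamma_gammaSum_neg h𝒢 hT p hx hy hZ hX hY hk' (by omega)] at hB
    have e1 := lie_skew X (gamma μ p (y + z + k) Y Z)
    have e2 : ⁅gamma μ p (z + x + k) Z X, Y⁆ = ⁅Y, gamma μ p (x + z + k) X Z⁆ := by
      rw [gamma_swap h𝒢 hT, neg_lie, lie_skew, add_comm z x]
    have e3 := lie_skew Z (gamma μ p (x + y + k) X Y)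
    have e4 : gamma μ p (x + y + z + k) ⁅Z, X⁆ Y = -gamma μ p (x + y + z + k) ⁅X, Z⁆ Y := by
      rw [← lie_skew, gamma_neg_left h𝒢 hT]
    linear_combination (norm := abel1) -hB - e1 + e2 - e3 + e4

/-- `γ(U, A)` in degree zero for `A ∈ 𝔤_+`. -/
lemma gamma_degree_zero (h𝒢 : IsTransitive 𝒢 μ) (hT : T.IsNormal μ) (p : T.Limit) {u a s c : ℤ}
    (ha : 0 ≤ a) {U A : L} (hU : U ∈ 𝒢 u) (hA : A ∈ 𝒢 a) (hs : s = u + a + 2) (hc : c = u + a) :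
    gamma μ p c U A = ⁅U, A⁆ - ⁅plusPart 𝒢 U, A⁆ + sigma μ p 0 s (plusPart 𝒢 U) A := by
  rcases lt_or_ge u 0 with hu | hu
  · rw [plusPart_of_neg hU hu, sigma_zero_left h𝒢 hT, gamma_swap h𝒢 hT,
      gamma_eq_lie h𝒢 hT p hu hA hU (by omega), lie_skew]
    simp
  · rw [plusPart_of_nonneg hU hu, sigma_eq h𝒢 hT p hu ha hU hA (c := c) (by omega) (by omega)]
    simp

/-- The quadratic term of the Bianchi identity for `X, Y ∈ 𝔤_-` and `A ∈ 𝔤_+`. -/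
lemma gamma_gammaSum_neg_nonneg (h𝒢 : IsTransitive 𝒢 μ) (hT : T.IsNormal μ) (p : T.Limit)
    {x y a δ c : ℤ} (hy : y < 0) (ha : 0 ≤ a) {X Y A : L} (hX : X ∈ 𝒢 x) (hY : Y ∈ 𝒢 y)
    (hA : A ∈ 𝒢 a) (hδ : 0 < δ) (hc : c = x + y + a + δ) :
    gamma μ p c (gammaSum p μ (c + μ + 1) X Y) A =
      gamma μ p c (gamma μ p (x + y + δ) X Y) A + gamma μ p c ⁅X, Y⁆ A +
      ∑ r ∈ (Finset.Ico (-a) δ).erase 0, gamma μ p c (gamma μ p (x + y + δ - r) X Y) A := by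
  -- The index is again the outer degree. It may now be negative down to −a, since γ(·,A) preserves
  -- the filtration degree of its first argument but need not raise it by a.
  rw [gamma_gammaSum h𝒢 hT p c (Equiv.subLeft (x + y + δ))
    (insert 0 (insert δ ((Finset.Ico (-a) δ).erase 0))), Finset.sum_insert, Finset.sum_insert]
  · simp only [Equiv.subLeft_apply, sub_zero, ← add_assoc]
    rw [gamma_eq_lie h𝒢 hT p hy hX hY (c := x + y + δ - δ) (by omega)]
  · simp
  · simp [hδ.ne]
  · intro r hr
    simp only [Finset.mem_insert, Finset.mem_erase, Finset.mem_Ico, not_or, not_and, not_lt] at hr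
    rcases lt_or_ge r (-a) with h | h
    · exact gamma_nonneg_right_eq_zero h𝒢 hT p ha (gamma_mem h𝒢 hT p _ X Y) hA
        (by simp only [Equiv.subLeft_apply]; omega)
    · rw [gamma_eq_zero_of_lt h𝒢 hT p hy hX hY, gamma_zero_left h𝒢 hT]
      simp only [Equiv.subLeft_apply]
      have := hr.2.2 hr.1 h
      omega

/-- For δ = 0 the outer degrees 0 and δ coincide and are counted once. Erasing 0 from the range
removes nothing and only keeps the shape of the general formula. -/
lemma gamma_gammaSum_neg_nonneg_zero (h𝒢 : IsTransitive 𝒢 μ) (hT : T.IsNormal μ) (p : T.Limit)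
    {x y a c : ℤ} (hy : y < 0) (ha : 0 ≤ a) {X Y A : L} (hX : X ∈ 𝒢 x) (hY : Y ∈ 𝒢 y)
    (hA : A ∈ 𝒢 a) (hc : c = x + y + a) :
    gamma μ p c (gammaSum p μ (c + μ + 1) X Y) A = gamma μ p c ⁅X, Y⁆ A +
      ∑ r ∈ (Finset.Ico (-a) 0).erase 0, gamma μ p c (gamma μ p (x + y + 0 - r) X Y) A := by
  rw [gamma_gammaSum h𝒢 hT p c (Equiv.subLeft (x + y + 0))
    (insert 0 ((Finset.Ico (-a) 0).erase 0)), Finset.sum_insert]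
  · simp only [Equiv.subLeft_apply]
    rw [gamma_eq_lie h𝒢 hT p hy hX hY (c := x + y + 0 - 0) (by omega)]
  · simp
  · intro r hr
    simp only [Finset.mem_insert, Finset.mem_erase, Finset.mem_Ico, not_or, not_and, not_lt] at hr
    rcases lt_or_ge r (-a) with h | h
    · exact gamma_nonneg_right_eq_zero h𝒢 hT p ha (gamma_mem h𝒢 hT p _ X Y) hA
        (by simp only [Equiv.subLeft_apply]; omega)
    · rw [gamma_eq_zero_of_lt h𝒢 hT p hy hX hY, gamma_zero_left h𝒢 hT]
      simp only [Equiv.subLeft_apply]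
      have := hr.2 hr.1 h
      omega

/-- The identity for `∂τ(A, ·)`. -/
lemma spencer_tau (h𝒢 : IsTransitive 𝒢 μ) (hT : T.IsNormal μ) (p : T.Limit)
    {x y a δ k : ℤ} (hx : x < 0) (hy : y < 0) (ha : 0 ≤ a) (hδ : 0 ≤ δ) (hk : k = δ + a + 1)
    {X Y A : L} (hX : X ∈ 𝒢 x) (hY : Y ∈ 𝒢 y) (hA : A ∈ 𝒢 a) :
    spencer1 (tau μ p δ k A) X Y =
      covD μ A (fun p' : T.Limit => kappa μ p' (k - 1) X Y) p
      + rhoKappa μ p δ A X Y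
      - altSum (fun x X _ Y => tau μ p δ (k + x) (plusPart 𝒢 ⁅A, X⁆) Y) x X y Y
      + ⁅plusPart 𝒢 (kappa μ p δ X Y), A⁆
      - sigma μ p 0 (k + x + y + 1) (plusPart 𝒢 (kappa μ p δ X Y)) A
      - (∑ δ₁ ∈ (Finset.Ico (-a) δ).erase 0,
          (tau μ p δ₁ (δ₁ + a + 1) (minusPart 𝒢 (kappa μ p (δ - δ₁) X Y)) A
            + sigma μ p δ₁ (k + x + y + 1) (plusPart 𝒢 (kappa μ p (δ - δ₁) X Y)) A))
      - altSum (fun x X _ Y => ∑ d₁ ∈ Finset.Ioo 0 δ,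
          (kappa μ p d₁ (minusPart 𝒢 (tau μ p (δ - d₁) (k - d₁) A X)) Y
            + tau μ p d₁ (k + x) (plusPart 𝒢 (tau μ p (δ - d₁) (k - d₁) A X)) Y)) x X y Y
      + altSum (fun _ X y Y =>
          covD μ Y (fun p' : T.Limit => tau μ p' (δ + y) (k + y) A X) p) x X y Y := by
  set c := x + y + a + δ with hc
  have hM : ∀ {x y : ℤ} {X Y : L}, x < 0 → y < 0 → X ∈ 𝒢 x → Y ∈ 𝒢 y → c = x + y + a + δ →
      ∑ d₁ ∈ Finset.Ioo 0 δ, (kappa μ p d₁ (minusPart 𝒢 (tau μ p (δ - d₁) (k - d₁) A X)) Y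
        + tau μ p d₁ (k + x) (plusPart 𝒢 (tau μ p (δ - d₁) (k - d₁) A X)) Y) =
      ∑ r ∈ Finset.Ioo 0 δ, gamma μ p c (gamma μ p (a + x + δ - r) A X) Y := by
    intro x y X Y hx hy hX hY hc
    refine Finset.sum_congr rfl fun r _ => ?_
    rw [tau_eq h𝒢 hT p ha hx hA hX (c := a + x + δ - r) (by omega) (by omega)]
    exact kappa_add_tau h𝒢 hT p hy (gamma_mem h𝒢 hT p _ A X) hY (by omega) (by omega)
  have hS : ∑ δ₁ ∈ (Finset.Ico (-a) δ).erase 0,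
      (tau μ p δ₁ (δ₁ + a + 1) (minusPart 𝒢 (kappa μ p (δ - δ₁) X Y)) A
        + sigma μ p δ₁ (k + x + y + 1) (plusPart 𝒢 (kappa μ p (δ - δ₁) X Y)) A) =
      ∑ r ∈ (Finset.Ico (-a) δ).erase 0, gamma μ p c (gamma μ p (x + y + δ - r) X Y) A := by
    refine Finset.sum_congr rfl fun r _ => ?_
    rw [kappa_eq h𝒢 hT p hx hy hX hY (c := x + y + δ - r) (by omega)]
    exact tau_add_sigma h𝒢 hT p ha (gamma_mem h𝒢 hT p _ X Y) hA (by omega) (by omega) (by omega)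
  have hD : ∀ {x y : ℤ} {X Y : L}, x < 0 → X ∈ 𝒢 x → c = x + y + a + δ →
      covD μ Y (fun p' : T.Limit => tau μ p' (δ + y) (k + y) A X) p =
      covD μ Y (fun p' : T.Limit => gamma μ p' c A X) p := by
    intro x y X Y hx hX hc
    congr 1
    funext p'
    exact tau_eq h𝒢 hT p' ha hx hA hX (by omega) (by omega)
  have hDA : covD μ A (fun p' : T.Limit => kappa μ p' (k - 1) X Y) p =
      covD μ A (fun p' : T.Limit => gamma μ p' c X Y) p := by
    congr 1
    funext p'
    exact kappa_eq h𝒢 hT p' hx hy hX hY (by omega)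
  have hB := bianchi h𝒢 hT p c X Y A
  rw [gammaSum_swap h𝒢 hT p _ A Y, gamma_neg_left h𝒢 hT, covD_gamma_swap h𝒢 hT c p X A Y] at hB
  -- The inner bracket [A,X] can have either sign: its negative part enters through ρ(A)κ and its
  -- nonnegative part through τ([A,X]_+, Y).
  have h1 := kappa_add_tau h𝒢 hT p hy (lie_mem hA hX) hY (r := δ) (s := k + x) (c := c)
    (by omega) (by omega)
  have h2 := kappa_add_tau h𝒢 hT p hx (lie_mem hA hY) hX (r := δ) (s := k + y) (c := c)
    (by omega) (by omega)
  have h3 := kappa_minusPart_right h𝒢 hT p δ hx hX (lie_mem hA hY)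
  simp only [altSum, spencer1, rhoKappa]
  rw [hM hx hy hX hY hc, hM hy hx hY hX (by omega), hS, hD (y := y) hx hX (by omega),
    hD (y := x) hy hY (by omega), hDA, kappa_eq h𝒢 hT p hx hy hX hY (c := x + y + δ) (by omega),
    tau_eq h𝒢 hT p ha hx hA hX (c := a + x + δ) (by omega) (by omega),
    tau_eq h𝒢 hT p ha hy hA hY (c := a + y + δ) (by omega) (by omega),
    tau_eq h𝒢 hT p ha (by omega) hA (lie_mem hX hY) (c := c) (by omega) (by omega)]
  have e1 := lie_skew X (gamma μ p (a + y + δ) A Y)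
  have e2 := lie_skew Y (gamma μ p (a + x + δ) A X)
  have e3 := lie_skew A (gamma μ p (x + y + δ) X Y)
  have e4 := gamma_swap h𝒢 hT p c A ⁅X, Y⁆
  rcases hδ.lt_or_eq with hδ | hδ
  · rw [gamma_gammaSum_neg_nonneg h𝒢 hT p hy ha hX hY hA hδ hc,
      gamma_gammaSum_neg h𝒢 hT p hx hy hA hX hY hδ (by omega),
      gamma_gammaSum_neg h𝒢 hT p hy hx hA hY hX hδ (by omega),
      gamma_degree_zero h𝒢 hT p ha (gamma_mem h𝒢 hT p (x + y + δ) X Y) hA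
        (s := k + x + y + 1) (by omega) (by omega)] at hB
    linear_combination (norm := abel1) hB - e1 + e2 + e3 - e4 + h1 - h2 + h3
  -- In degree 0 every γ with an argument in 𝔤_- is a bracket, and the extra terms cancel by the
  -- Leibniz rule for ad A.
  · subst hδ
    have e5 := gamma_degree_zero h𝒢 hT p ha (gamma_mem h𝒢 hT p (x + y + 0) X Y) hA
        (s := k + x + y + 1) (c := c) (by omega) (by omega)
    have e6 : gamma μ p (x + y + 0) X Y = ⁅X, Y⁆ := gamma_eq_lie h𝒢 hT p hy hX hY (by omega)
    rw [gamma_gammaSum_neg_nonneg_zero h𝒢 hT p hy ha hX hY hA (by omega),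
      gamma_gammaSum_neg_zero h𝒢 hT p hx hy hA hX hY (by omega),
      gamma_gammaSum_neg_zero h𝒢 hT p hy hx hA hY hX (by omega)] at hB
    rw [gamma_eq_lie h𝒢 hT p hy (lie_mem hA hX) hY (by omega)] at h1
    rw [gamma_eq_lie h𝒢 hT p hx (lie_mem hA hY) hX (by omega)] at h2
    rw [gamma_eq_lie h𝒢 hT p hx hA hX (c := a + x + 0) (by omega)] at e2 ⊢
    rw [gamma_eq_lie h𝒢 hT p hy hA hY (c := a + y + 0) (by omega)]
    rw [e6] at e5 ⊢
    have e7 : gamma μ p c ⁅X, Y⁆ A = ⁅⁅X, Y⁆, A⁆ := by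
      rw [e4, gamma_eq_lie h𝒢 hT p (by omega) hA (lie_mem hX hY) (by omega), lie_skew]
    have e8 := leibniz_lie A X Y
    simp only [Finset.Ioo_self, Finset.sum_empty]
    linear_combination (norm := abel1) hB + e2 - e4 - e5 + e7 - e8 + h1 - h2 + h3

/-- The quadratic term of the Bianchi identity for `B, A ∈ 𝔤_+` and `X ∈ 𝔤_-`. -/
lemma gamma_gammaSum_mixed (h𝒢 : IsTransitive 𝒢 μ) (hT : T.IsNormal μ) (p : T.Limit)
    {a b x δ c : ℤ} (ha : 0 ≤ a) (hx : x < 0) {A B X : L} (hA : A ∈ 𝒢 a) (hB : B ∈ 𝒢 b)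
    (hX : X ∈ 𝒢 x) (hc : c = a + b + x + δ) :
    gamma μ p c (gammaSum p μ (c + μ + 1) B X) A =
      ∑ r ∈ Finset.Icc 0 (δ + a), gamma μ p c (gamma μ p (b + x + r) B X) A := by
  -- Here r is the inner degree. It is ≥ 0 because of X, and at most δ + a because γ(·,A) never
  -- lowers the degree of its first argument.
  refine gamma_gammaSum h𝒢 hT p c (Equiv.addLeft (b + x)) _ fun r hr => ?_
  simp only [Equiv.coe_addLeft]
  rw [Finset.mem_Icc, not_and_or] at hr
  rcases hr with hr | hr
  · rw [gamma_eq_zero_of_lt h𝒢 hT p hx hB hX (by omega), gamma_zero_left h𝒢 hT]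
  · exact gamma_nonneg_right_eq_zero h𝒢 hT p ha (gamma_mem h𝒢 hT p _ B X) hA (by omega)

/-- The quadratic term of the Bianchi identity for `A, B ∈ 𝔤_+` and `X ∈ 𝔤_-`. -/
lemma gamma_gammaSum_nonneg_neg (h𝒢 : IsTransitive 𝒢 μ) (hT : T.IsNormal μ) (p : T.Limit)
    {a b x δ c : ℤ} (ha : 0 ≤ a) (hb : 0 ≤ b) (hx : x < 0) {A B X : L} (hA : A ∈ 𝒢 a)
    (hB : B ∈ 𝒢 b) (hX : X ∈ 𝒢 x) (hc : c = a + b + x + δ) :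
    gamma μ p c (gammaSum p μ (c + μ + 1) A B) X = ⁅gamma μ p (a + b + δ) A B, X⁆ +
      ∑ r ∈ Finset.Ioc 0 (δ + min a b), gamma μ p c (gamma μ p (a + b + δ - r) A B) X := by
  -- Here r is the outer degree. The inner value sits in degree a + b + δ − r, which is at least
  -- max(a,b) exactly when r ≤ δ + min(a,b).
  rw [gamma_gammaSum h𝒢 hT p c (Equiv.subLeft (a + b + δ))
    (insert 0 (Finset.Ioc 0 (δ + min a b))), Finset.sum_insert]
  · simp only [Equiv.subLeft_apply, sub_zero]
    rw [gamma_eq_lie h𝒢 hT p hx (gamma_mem h𝒢 hT p _ A B) hX (by omega)]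
  · simp
  · intro r hr
    simp only [Finset.mem_insert, Finset.mem_Ioc, not_or, not_and, not_le] at hr
    simp only [Equiv.subLeft_apply]
    rcases lt_or_ge r 0 with h | h
    · exact gamma_eq_zero_of_lt h𝒢 hT p hx (gamma_mem h𝒢 hT p _ A B) hX (by omega)
    · have := hr.2 (by omega)
      rw [gamma_of_nonneg h𝒢 hT p ha hb hA hB (by omega), gamma_zero_left h𝒢 hT]

/-- The quadratic term of the Bianchi identity for `A, B, C ∈ 𝔤_+`. -/
lemma gamma_gammaSum_nonneg (h𝒢 : IsTransitive 𝒢 μ) (hT : T.IsNormal μ) (p : T.Limit)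
    {a b c δ m : ℤ} (ha : 0 ≤ a) (hb : 0 ≤ b) (hc : 0 ≤ c) {A B C : L} (hA : A ∈ 𝒢 a)
    (hB : B ∈ 𝒢 b) (hC : C ∈ 𝒢 c) (hm : m = a + b + c + δ) :
    gamma μ p m (gammaSum p μ (m + μ + 1) A B) C =
      ∑ r ∈ Finset.Icc (-min a b) (δ + c), gamma μ p m (gamma μ p (a + b + r) A B) C := by
  refine gamma_gammaSum h𝒢 hT p m (Equiv.addLeft (a + b)) _ fun r hr => ?_
  simp only [Equiv.coe_addLeft]
  rw [Finset.mem_Icc, not_and_or] at hr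
  rcases hr with hr | hr
  · rw [gamma_of_nonneg h𝒢 hT p ha hb hA hB (by omega), gamma_zero_left h𝒢 hT]
  · exact gamma_nonneg_right_eq_zero h𝒢 hT p hc (gamma_mem h𝒢 hT p _ A B) hC (by omega)

/-- The identity for `[σ(A, B), X]`. -/
lemma lie_sigma (h𝒢 : IsTransitive 𝒢 μ) (hT : T.IsNormal μ) (p : T.Limit)
    {a b x δ k : ℤ} (ha : 0 ≤ a) (hb : 0 ≤ b) (hx : x < 0) (hk : k = δ + a + b + 2)
    {A B X : L} (hA : A ∈ 𝒢 a) (hB : B ∈ 𝒢 b) (hX : X ∈ 𝒢 x) :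
    ⁅sigma μ p δ k A B, X⁆ =
      altSum (fun a A b B => ∑ d₂ ∈ Finset.Icc 0 (δ + a),
        (sigma μ p (δ - d₂) (k + x) A
            (plusPart 𝒢 (tau μ p d₂ (k - 1 - (δ - d₂ + a)) B X))
          + tau μ p (δ - d₂) (k - 1 - (d₂ + b)) A
            (minusPart 𝒢 (tau μ p d₂ (k - 1 - (δ - d₂ + a)) B X)))) a A b B
      + (∑ δ₁ ∈ Finset.Ioc 0 (δ + min a b),
          tau μ p δ₁ (k - 1) X (sigma μ p (δ - δ₁) (k - δ₁) A B))
      + covD μ X (fun p' : T.Limit => sigma μ p' (δ + x) (k + x) A B) p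
      + altSum (fun a A _ B =>
          covD μ A (fun p' : T.Limit => tau μ p' (δ + a) (k - 1) B X) p) a A b B := by
  set c := a + b + x + δ with hc
  have hN : ∀ {a b : ℤ} {A B : L}, 0 ≤ a → 0 ≤ b → A ∈ 𝒢 a → B ∈ 𝒢 b → k = δ + a + b + 2 →
      c = a + b + x + δ → ∑ d₂ ∈ Finset.Icc 0 (δ + a),
        (sigma μ p (δ - d₂) (k + x) A
            (plusPart 𝒢 (tau μ p d₂ (k - 1 - (δ - d₂ + a)) B X))
          + tau μ p (δ - d₂) (k - 1 - (d₂ + b)) A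
            (minusPart 𝒢 (tau μ p d₂ (k - 1 - (δ - d₂ + a)) B X))) =
      -gamma μ p c (gammaSum p μ (c + μ + 1) B X) A := by
    intro a b A B ha hb hA hB hk hc
    rw [gamma_gammaSum_mixed h𝒢 hT p ha hx hA hB hX hc, ← Finset.sum_neg_distrib]
    refine Finset.sum_congr rfl fun r _ => ?_
    rw [tau_eq h𝒢 hT p hb hx hB hX (c := b + x + r) (by omega) rfl, ← gamma_swap h𝒢 hT]
    exact sigma_add_tau h𝒢 hT p ha (gamma_mem h𝒢 hT p _ B X) hA (by omega) (by omega) (by omega)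
  have hS : ∑ δ₁ ∈ Finset.Ioc 0 (δ + min a b),
      tau μ p δ₁ (k - 1) X (sigma μ p (δ - δ₁) (k - δ₁) A B) =
      -∑ r ∈ Finset.Ioc 0 (δ + min a b), gamma μ p c (gamma μ p (a + b + δ - r) A B) X := by
    rw [← Finset.sum_neg_distrib]
    refine Finset.sum_congr rfl fun r hr => ?_
    rw [Finset.mem_Ioc] at hr
    rw [sigma_eq h𝒢 hT p ha hb hA hB (c := a + b + δ - r) (by omega) (by omega),
      ← gamma_swap h𝒢 hT]
    exact tau_eq_swap h𝒢 hT p (by omega) hx (gamma_mem h𝒢 hT p _ A B) hX (by omega) (by omega)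
  have hD : ∀ {a b : ℤ} {A B : L}, 0 ≤ b → B ∈ 𝒢 b → k = δ + a + b + 2 → c = a + b + x + δ →
      covD μ A (fun p' : T.Limit => tau μ p' (δ + a) (k - 1) B X) p =
      covD μ A (fun p' : T.Limit => gamma μ p' c B X) p := by
    intro a b A B hb hB hk hc
    congr 1
    funext p'
    exact tau_eq h𝒢 hT p' hb hx hB hX (by omega) (by omega)
  have hDX : covD μ X (fun p' : T.Limit => sigma μ p' (δ + x) (k + x) A B) p =
      covD μ X (fun p' : T.Limit => gamma μ p' c A B) p := by
    congr 1
    funext p'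
    exact sigma_eq h𝒢 hT p' ha hb hA hB (by omega) (by omega)
  have hBi := bianchi h𝒢 hT p c A B X
  rw [gammaSum_swap h𝒢 hT p _ A X, gamma_neg_left h𝒢 hT, covD_gamma_swap h𝒢 hT c p B A X,
    gamma_gammaSum_nonneg_neg h𝒢 hT p ha hb hx hA hB hX hc] at hBi
  simp only [altSum]
  rw [hN ha hb hA hB hk hc, hN hb ha hB hA (by omega) (by omega), hS, hDX,
    hD (a := a) hb hB (by omega) (by omega), hD (a := b) ha hA (by omega) (by omega),
    sigma_eq h𝒢 hT p ha hb hA hB (c := a + b + δ) (by omega) rfl]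
  linear_combination (norm := abel1) hBi

/-- The identity for `σ` on `∧³ 𝔤_+`. -/
lemma cyclic_sigma (h𝒢 : IsTransitive 𝒢 μ) (hT : T.IsNormal μ) (p : T.Limit)
    {a b c δ k : ℤ} (ha : 0 ≤ a) (hb : 0 ≤ b) (hc : 0 ≤ c) (hk : k = δ + a + b + c + 3)
    {A B C : L} (hA : A ∈ 𝒢 a) (hB : B ∈ 𝒢 b) (hC : C ∈ 𝒢 c) :
    cyclicSum (fun a A b B c C =>
      (∑ d₂ ∈ Finset.Icc (-min a b) (δ + c),
        sigma μ p (δ - d₂) (k - 1) (sigma μ p d₂ (k - 1 - c - (δ - d₂)) A B) C)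
      - covD μ C (fun p' : T.Limit => sigma μ p' (δ + c) (k - 1) A B) p) a A b B c C = 0 := by
  set m := a + b + c + δ with hm
  have key : ∀ {a b c : ℤ} {A B C : L}, 0 ≤ a → 0 ≤ b → 0 ≤ c → A ∈ 𝒢 a → B ∈ 𝒢 b → C ∈ 𝒢 c →
      k = δ + a + b + c + 3 → m = a + b + c + δ →
      (∑ d₂ ∈ Finset.Icc (-min a b) (δ + c),
        sigma μ p (δ - d₂) (k - 1) (sigma μ p d₂ (k - 1 - c - (δ - d₂)) A B) C)
      - covD μ C (fun p' : T.Limit => sigma μ p' (δ + c) (k - 1) A B) p =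
      gamma μ p m (gammaSum p μ (m + μ + 1) A B) C -
        covD μ C (fun p' : T.Limit => gamma μ p' m A B) p := by
    intro a b c A B C ha hb hc hA hB hC hk hm
    rw [gamma_gammaSum_nonneg h𝒢 hT p ha hb hc hA hB hC hm]
    congr 1
    · refine Finset.sum_congr rfl fun r hr => ?_
      -- The lower bound on r gives a + b + r ≥ max(a,b) ≥ 0, so the outer factor is again a
      -- component of σ.
      rw [Finset.mem_Icc] at hr
      rw [sigma_eq h𝒢 hT p ha hb hA hB (c := a + b + r) (by omega) rfl]
      exact sigma_eq h𝒢 hT p (by omega) hc (gamma_mem h𝒢 hT p _ A B) hC (by omega) (by omega)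
    · congr 1
      funext p'
      exact sigma_eq h𝒢 hT p' ha hb hA hB (by omega) (by omega)
  simp only [cyclicSum]
  rw [key ha hb hc hA hB hC hk hm, key hb hc ha hB hC hA (by omega) (by omega),
    key hc ha hb hC hA hB (by omega) (by omega)]
  exact bianchi h𝒢 hT p m A B C

end Identities

end TowerData

end StepProlongation

end

open StepProlongation StepProlongation.TowerData in
theorem theoremB {L : Type*} [LieRing L] [LieAlgebra ℝ L]
    (𝒢 : ℤ → Submodule ℝ L) [GradedLieAlgebra 𝒢] (μ : ℕ) (h𝒢 : IsTransitive 𝒢 μ)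
    (k₀ : ℕ) (hprol : IsProlongation 𝒢 k₀)
    (W1 : ℕ → Submodule ℝ (L →ₗ[ℝ] L)) (W2 : ℕ → Submodule ℝ (L →ₗ[ℝ] L →ₗ[ℝ] L))
    (hW : IsComplements 𝒢 k₀ W1 W2)
    {d e : ℕ → ℕ}
    (Q : ℕ → Type*) [∀ n, TopologicalSpace (Q n)] [∀ n, T2Space (Q n)]
    [∀ n, ChartedSpace (EuclideanSpace ℝ (Fin (d n))) (Q n)] [∀ n, IsManifold (𝓡 (d n)) ∞ (Q n)]
    (G : ℕ → Type*) [∀ n, Group (G n)] [∀ n, TopologicalSpace (G n)]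
    [∀ n, ChartedSpace (EuclideanSpace ℝ (Fin (e n))) (G n)] [∀ n, LieGroup (𝓡 (e n)) ∞ (G n)]
    (T : TowerData 𝒢 (d := d) (e := e) Q G) (hT : T.IsNormal μ)
    (hTW : T.IsStepProlongation k₀ W1 W2) :
    -- the components of the structure function are smooth
    (∀ (c : ℤ) (X Y : L), SmoothLim (fun z : T.Limit => gamma μ z c X Y)) ∧
    ∀ p : T.Limit,
    -- (1)
    (∀ (k : ℕ) (x y z : ℤ), x < 0 → y < 0 → z < 0 → ∀ X ∈ 𝒢 x, ∀ Y ∈ 𝒢 y, ∀ Z ∈ 𝒢 z,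
      spencer2 (kappa μ p k) X Y Z =
        cyclicSum (fun x X y Y _ Z =>
          (∑ d₁ ∈ Finset.Ioo (0 : ℤ) k,
            (kappa μ p d₁ (minusPart 𝒢 (kappa μ p (k - d₁) X Y)) Z
              + tau μ p d₁ (k + x + y + 1) (plusPart 𝒢 (kappa μ p (k - d₁) X Y)) Z))
          - covD μ X (fun p' : T.Limit => kappa μ p' (k + x) Y Z) p) x X y Y z Z) ∧
    -- (2)
    (∀ (x y a δ k : ℤ), x < 0 → y < 0 → 0 ≤ a → 0 ≤ δ → k = δ + a + 1 →
      ∀ X ∈ 𝒢 x, ∀ Y ∈ 𝒢 y, ∀ A ∈ 𝒢 a,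
      spencer1 (tau μ p δ k A) X Y =
        covD μ A (fun p' : T.Limit => kappa μ p' (k - 1) X Y) p
        + rhoKappa μ p δ A X Y
        - altSum (fun x X _ Y => tau μ p δ (k + x) (plusPart 𝒢 ⁅A, X⁆) Y) x X y Y
        + ⁅plusPart 𝒢 (kappa μ p δ X Y), A⁆
        - sigma μ p 0 (k + x + y + 1) (plusPart 𝒢 (kappa μ p δ X Y)) A
        - (∑ δ₁ ∈ (Finset.Ico (-a) δ).erase 0,
            (tau μ p δ₁ (δ₁ + a + 1) (minusPart 𝒢 (kappa μ p (δ - δ₁) X Y)) A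
              + sigma μ p δ₁ (k + x + y + 1) (plusPart 𝒢 (kappa μ p (δ - δ₁) X Y)) A))
        - altSum (fun x X _ Y => ∑ d₁ ∈ Finset.Ioo 0 δ,
            (kappa μ p d₁ (minusPart 𝒢 (tau μ p (δ - d₁) (k - d₁) A X)) Y
              + tau μ p d₁ (k + x) (plusPart 𝒢 (tau μ p (δ - d₁) (k - d₁) A X)) Y)) x X y Y
        + altSum (fun _ X y Y =>
            covD μ Y (fun p' : T.Limit => tau μ p' (δ + y) (k + y) A X) p) x X y Y) ∧
    -- (3)
    (∀ (a b x δ k : ℤ), 0 ≤ a → 0 ≤ b → x < 0 → k = δ + a + b + 2 →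
      ∀ A ∈ 𝒢 a, ∀ B ∈ 𝒢 b, ∀ X ∈ 𝒢 x,
      ⁅sigma μ p δ k A B, X⁆ =
        altSum (fun a A b B => ∑ d₂ ∈ Finset.Icc 0 (δ + a),
          (sigma μ p (δ - d₂) (k + x) A
              (plusPart 𝒢 (tau μ p d₂ (k - 1 - (δ - d₂ + a)) B X))
            + tau μ p (δ - d₂) (k - 1 - (d₂ + b)) A
              (minusPart 𝒢 (tau μ p d₂ (k - 1 - (δ - d₂ + a)) B X)))) a A b B
        + (∑ δ₁ ∈ Finset.Ioc 0 (δ + min a b),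
            tau μ p δ₁ (k - 1) X (sigma μ p (δ - δ₁) (k - δ₁) A B))
        + covD μ X (fun p' : T.Limit => sigma μ p' (δ + x) (k + x) A B) p
        + altSum (fun a A _ B =>
            covD μ A (fun p' : T.Limit => tau μ p' (δ + a) (k - 1) B X) p) a A b B) ∧
    -- (4)
    (∀ (a b c δ k : ℤ), 0 ≤ a → 0 ≤ b → 0 ≤ c → k = δ + a + b + c + 3 →
      ∀ A ∈ 𝒢 a, ∀ B ∈ 𝒢 b, ∀ C ∈ 𝒢 c,
      cyclicSum (fun a A b B c C =>
        (∑ d₂ ∈ Finset.Icc (-min a b) (δ + c),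
          sigma μ p (δ - d₂) (k - 1) (sigma μ p d₂ (k - 1 - c - (δ - d₂)) A B) C)
        - covD μ C (fun p' : T.Limit => sigma μ p' (δ + c) (k - 1) A B) p) a A b B c C = 0) := by
  refine ⟨fun c X Y => smoothLim_gamma h𝒢 hT c X Y, fun p => ⟨?_, ?_, ?_, ?_⟩⟩
  · intro k x y z hx hy hz X hX Y hY Z hZ
    exact spencer_kappa h𝒢 hT p k hx hy hz hX hY hZ
  · intro x y a δ k hx hy ha hδ hk X hX Y hY A hA
    exact spencer_tau h𝒢 hT p hx hy ha hδ hk hX hY hA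
  · intro a b x δ k ha hb hx hk A hA B hB X hX
    exact lie_sigma h𝒢 hT p ha hb hx hk hA hB hX
  · intro a b c δ k ha hb hc hk A hA B hB C hC
    exact cyclic_sigma h𝒢 hT p ha hb hc hk hA hB hC
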